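/- **Setting.** Let $n,m\ge 1$ be integers and let $\Omega\subset\mathbb R^n$ be a compact set with Lipschitz boundary, i.e. near each boundary point, in suitable Cartesian coordinates, $\Omega$ is the closed region above the graph of a Lipschitz function. Let $K:\Omega\times\Omega\to\mathbb R$ be a Mercer kernel (continuous, symmetric, positive semidefinite) with $K\in C^{2m}(\Omega\times\Omega)$. Let $\{\psi_i\}$ be an orthonormal basis of $L_2(\Omega)$ consisting of eigenvectors of the integral operator $O_K[f](x)=\int_\Omega K(x,y)f(y)\,dy$. Let $\lambda_1,\lambda_2,\dots$ be those of the eigenvalues of the $\psi_i$ that are positive, in the order of the basis, and let $\phi_1,\phi_2,\dots\in C(\Omega)$ be (the continuous representatives of) the corresponding $\psi_i$; if there are only finitely many positive eigenvalues, put $\lambda_i=0$ for the remaining indices. Put $$C_K^N=\sup_{x,y\in\Omega}\Big|K(x,y)-\sum_{i=1}^N\lambda_i\phi_i(x)\phi_i(y)\Big|,\qquad D_\alpha(x)=\partial_x^\alpha\partial_y^\alpha K(x,y)\big|_{y=x}.$$ For $p\in[1,\infty]$ with $p>n/m$ put $\theta=\big(1+\tfrac mn-\tfrac1p\big)^{-1}$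 (with $1/\infty=0$) and $$C^m_{\Omega,p}=\sup_{u}\frac{\|u\|_{L_\infty(\Omega)}}{\|u\|_{L_1(\Omega)}^{1-\theta}\,\|D^mu\|_{L_p(\Omega)}^{\theta}+\|u\|_{L_1(\Omega)}},\qquad \|D^mu\|_{L_p(\Omega)}=\max_{|\alpha|=m}\|\partial^\alpha u\|_{L_p(\Omega)},$$ the supremum being over all nonzero $u\in L_1(\Omega)\cap L_p(\Omega)$ whose weak derivatives $\partial^\alpha u$, $|\alpha|=m$, exist and lie in $L_p(\Omega)$; this is the optimal constant in the $L_1$–$L_\infty$ Gagliardo–Nirenberg inequality on $\Omega$. Finally put $$M=\max_{|\alpha|=m}\ \sum_{\beta\le\alpha}\binom{\alpha}{\beta}\,\big\|\sqrt{D_\beta D_{\alpha-\beta}}\big\|_{L_p(\Omega)}.$$ **Theorem.** One has $\sum_i\lambda_i<\infty$. For every $p\in[1,\infty]$ with $p>n/m$, the quantities $C^m_{\Omega,p}$ and $M$ are finite, and for all $N\ge 0$ $$C_K^N\le C^m_{\Omega,p}\Big(\sum_{i=N+1}^\infty\lambda_i\Big)^{1-\theta}M^\theta+C^m_{\Omega,p}\sum_{i=N+1}^\infty\lambda_i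 .$$ In particular (taking $p=\infty$) there is a constant $A$, independent of $N$, such that for all $N\ge 0$ $$C_K^N\le A\Big(\sum_{i=N+1}^\infty\lambda_i\Big)^{\frac m{m+n}},$$ that is, $C_K^N=\mathcal O\big((\sum_{i>N}\lambda_i)^{m/(m+n)}\big)$. -/

import Mathlib

open MeasureTheory Set
open scoped ENNReal NNReal

noncomputable section

namespace MercerGN

/-- `Ω ⊆ ℝⁿ` has Lipschitz boundary: near each boundary point, in suitable Cartesian coordinates
with vertical unit direction `ν`, the set `Ω` is the closed region above the graph of a Lipschitz
function `g` of the horizontal component `y - ⟪ν, y⟫ ν`. -/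
def HasLipschitzBoundary {n : ℕ} (Ω : Set (EuclideanSpace ℝ (Fin n))) : Prop :=
  ∀ x ∈ frontier Ω, ∃ (ν : EuclideanSpace ℝ (Fin n)) (g : EuclideanSpace ℝ (Fin n) → ℝ)
    (L : ℝ≥0) (r : ℝ), ‖ν‖ = 1 ∧ LipschitzWith L g ∧ 0 < r ∧
      ∀ y ∈ Metric.ball x r, y ∈ Ω ↔ g (y - (inner ℝ ν y) • ν) ≤ inner ℝ ν y

/-- The partial derivative `∂f/∂xᵢ` on `Ω` (one-sided at boundary points). -/
def partialDeriv {n : ℕ} (Ω : Set (EuclideanSpace ℝ (Fin n))) (i : Fin n)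
    (f : EuclideanSpace ℝ (Fin n) → ℝ) : EuclideanSpace ℝ (Fin n) → ℝ :=
  fun x => fderivWithin ℝ f Ω x (EuclideanSpace.single i 1)

/-- The multi-index derivative `∂^α f = ∂₁^{α₁} ⋯ ∂ₙ^{αₙ} f` on `Ω`. -/
def multiDeriv {n : ℕ} (Ω : Set (EuclideanSpace ℝ (Fin n))) (α : Fin n → ℕ)
    (f : EuclideanSpace ℝ (Fin n) → ℝ) : EuclideanSpace ℝ (Fin n) → ℝ :=
  (List.finRange n).foldr (fun i h => (partialDeriv Ω i)^[α i] h) f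

/-- The multi-indices `α ∈ ℕⁿ` with `|α| = m`. -/
def multiIndices (n m : ℕ) : Finset (Fin n → ℕ) := Finset.piAntidiag Finset.univ m

/-- `D_α(x) = ∂^α_x ∂^α_y K(x, y)` at `y = x`. -/
def diagDeriv {n : ℕ} (Ω : Set (EuclideanSpace ℝ (Fin n)))
    (K : EuclideanSpace ℝ (Fin n) → EuclideanSpace ℝ (Fin n) → ℝ) (α : Fin n → ℕ)
    (x : EuclideanSpace ℝ (Fin n)) : ℝ :=
  multiDeriv Ω α (fun x' => multiDeriv Ω α (fun y' => K x' y') x) x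

/-- `K` restricted to `Ω × Ω` is a Mercer kernel: continuous, symmetric and positive
semidefinite (symmetry is part of `Matrix.PosSemidef`, which tests all finitely supported
coefficient families). -/
def IsMercerKernel {n : ℕ} (Ω : Set (EuclideanSpace ℝ (Fin n)))
    (K : EuclideanSpace ℝ (Fin n) → EuclideanSpace ℝ (Fin n) → ℝ) : Prop :=
  ContinuousOn (fun z : EuclideanSpace ℝ (Fin n) × EuclideanSpace ℝ (Fin n) => K z.1 z.2)
    (Ω ×ˢ Ω) ∧
  (Matrix.of fun x y : Ω => K x y).PosSemidef

/-- The integral operator `O_K[f](x) = ∫_Ω K(x, y) f(y) dy`. -/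
def kernelOp {n : ℕ} (Ω : Set (EuclideanSpace ℝ (Fin n)))
    (K : EuclideanSpace ℝ (Fin n) → EuclideanSpace ℝ (Fin n) → ℝ)
    (f : EuclideanSpace ℝ (Fin n) → ℝ) (x : EuclideanSpace ℝ (Fin n)) : ℝ :=
  ∫ y in Ω, K x y * f y

/-- `(lam j, φ j)`, `j = 0, 1, …`, are the positive eigenvalues and the corresponding continuous
eigenfunctions picked, in order, from an orthonormal basis `ψ` of `L₂(Ω)` that consists of
eigenvectors of `O_K`. If there are only finitely many positive eigenvalues, the sequence `lam`
is continued by zeros (and then the values of `φ` do not matter). -/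
def IsMercerSystem {n : ℕ} (Ω : Set (EuclideanSpace ℝ (Fin n)))
    (K : EuclideanSpace ℝ (Fin n) → EuclideanSpace ℝ (Fin n) → ℝ)
    (lam : ℕ → ℝ) (φ : ℕ → EuclideanSpace ℝ (Fin n) → ℝ) : Prop :=
  ∃ (ψ : HilbertBasis ℕ ℝ (Lp ℝ 2 ((volume : Measure (EuclideanSpace ℝ (Fin n))).restrict Ω)))
    (ev : ℕ → ℝ),
    (∀ i, kernelOp Ω K (ψ i) =ᵐ[volume.restrict Ω] fun x => ev i * ψ i x) ∧
    (∀ j : ℕ, (j : ℕ∞) < {i | 0 < ev i}.encard →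
      lam j = ev (Nat.nth (fun i => 0 < ev i) j) ∧ ContinuousOn (φ j) Ω ∧
        φ j =ᵐ[volume.restrict Ω] ψ (Nat.nth (fun i => 0 < ev i) j)) ∧
    (∀ j : ℕ, {i | 0 < ev i}.encard ≤ (j : ℕ∞) → lam j = 0)

/-- The uniform truncation error
`C_K^N = sup_{x, y ∈ Ω} |K(x, y) - ∑_{i ≤ N} λᵢ φᵢ(x) φᵢ(y)|`. -/
def truncError {n : ℕ} (Ω : Set (EuclideanSpace ℝ (Fin n)))
    (K : EuclideanSpace ℝ (Fin n) → EuclideanSpace ℝ (Fin n) → ℝ)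
    (lam : ℕ → ℝ) (φ : ℕ → EuclideanSpace ℝ (Fin n) → ℝ) (N : ℕ) : ℝ≥0∞ :=
  ⨆ x ∈ Ω, ⨆ y ∈ Ω, ENNReal.ofReal |K x y - ∑ i ∈ Finset.range N, lam i * φ i x * φ i y|

/-- The tail `∑_{i > N} λᵢ` (with `λ₁ = lam 0`). -/
def tailSum (lam : ℕ → ℝ) (N : ℕ) : ℝ≥0∞ := ∑' i, ENNReal.ofReal (lam (N + i))

/-- The exponent `θ = (1 + m/n - 1/p)⁻¹`, with `1/∞ = 0`. -/
def gnTheta (n m : ℕ) (p : ℝ≥0∞) : ℝ := (1 + (m : ℝ) / n - (p⁻¹).toReal)⁻¹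

/-- `v` is the weak derivative `∂^α u` on the interior of `Ω`: for all test functions `η`,
`∫ u ∂^α η = (-1)^{|α|} ∫ v η`. -/
def IsWeakDeriv {n : ℕ} (Ω : Set (EuclideanSpace ℝ (Fin n))) (α : Fin n → ℕ)
    (u v : EuclideanSpace ℝ (Fin n) → ℝ) : Prop :=
  ∀ η : EuclideanSpace ℝ (Fin n) → ℝ, ContDiff ℝ (⊤ : ℕ∞) η → HasCompactSupport η →
    tsupport η ⊆ interior Ω →
    ∫ x in interior Ω, u x * multiDeriv univ α η x =
      (-1) ^ (∑ i, α i) * ∫ x in interior Ω, v x * η x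

/-- `u ≠ 0` lies in `L₁(Ω) ∩ L_p(Ω)` and has weak derivatives `∂^α u = v α` in `L_p(Ω)` for all
`|α| = m`. -/
structure GNAdmissible {n : ℕ} (Ω : Set (EuclideanSpace ℝ (Fin n))) (m : ℕ) (p : ℝ≥0∞)
    (u : EuclideanSpace ℝ (Fin n) → ℝ)
    (v : (Fin n → ℕ) → EuclideanSpace ℝ (Fin n) → ℝ) : Prop where
  memL1 : MemLp u 1 (volume.restrict Ω)
  memLp : MemLp u p (volume.restrict Ω)
  ne_zero : ¬ u =ᵐ[volume.restrict Ω] 0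
  deriv_memLp : ∀ α ∈ multiIndices n m, MemLp (v α) p (volume.restrict Ω)
  weakDeriv : ∀ α ∈ multiIndices n m, IsWeakDeriv Ω α u (v α)

/-- The optimal constant in the `L₁`–`L_∞` Gagliardo–Nirenberg inequality on `Ω`, the supremum of
`‖u‖_∞ / (‖u‖₁^{1-θ} ‖D^m u‖_p^θ + ‖u‖₁)` where `‖D^m u‖_p = max_{|α| = m} ‖∂^α u‖_p`.
The denominators are positive and finite. -/
def gnConst {n : ℕ} (Ω : Set (EuclideanSpace ℝ (Fin n))) (m : ℕ) (p : ℝ≥0∞) : ℝ≥0∞ :=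
  ⨆ (u : EuclideanSpace ℝ (Fin n) → ℝ) (v : (Fin n → ℕ) → EuclideanSpace ℝ (Fin n) → ℝ)
    (_ : GNAdmissible Ω m p u v),
    eLpNorm u ∞ (volume.restrict Ω) /
      (eLpNorm u 1 (volume.restrict Ω) ^ (1 - gnTheta n m p) *
          ((multiIndices n m).sup fun α => eLpNorm (v α) p (volume.restrict Ω)) ^ gnTheta n m p +
        eLpNorm u 1 (volume.restrict Ω))

/-- `M = max_{|α| = m} ∑_{β ≤ α} (α choose β) ‖√(D_β D_{α-β})‖_{L_p(Ω)}`. -/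
def derivBound {n : ℕ} (Ω : Set (EuclideanSpace ℝ (Fin n)))
    (K : EuclideanSpace ℝ (Fin n) → EuclideanSpace ℝ (Fin n) → ℝ) (m : ℕ) (p : ℝ≥0∞) : ℝ≥0∞ :=
  (multiIndices n m).sup fun α => ∑ β ∈ Finset.Iic α,
    ((∏ i, (α i).choose (β i) : ℕ) : ℝ≥0∞) *
      eLpNorm (fun x => √(diagDeriv Ω K β x * diagDeriv Ω K (α - β) x)) p (volume.restrict Ω)

end MercerGN

end

noncomputable section

namespace MercerGN

/-! ### Geometry of sets with Lipschitz boundary -/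

section Geometry

variable {n : ℕ} {Ω : Set (EuclideanSpace ℝ (Fin n))}

/-! Write `K x y = ⟪Φ x, Φ y⟫` with a total feature map `Φ` into a Hilbert space. The positive
eigenfunctions become a complete orthonormal system `e j` there, with `⟪e j, Φ x⟫ = √(lam j) * φ j
x`. Let `Q` be the orthogonal projection off the first `N` vectors. The remainder of the expansion
is then exactly `⟪Q (Φ x), Q (Φ y)⟫`, so by Cauchy–Schwarz its supremum is controlled by the
diagonal `u x = ‖Q (Φ x)‖ ^ 2` (`truncError_le`), and by Parseval the `L₁` norm of `u` is the tail
of the eigenvalues (`IsMercerSystem.exists_remainder`). Uniform convergence of the Mercer series is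
not needed.

The Gagliardo–Nirenberg inequality bounds `sup u` by this `L₁` norm and by `D^m u`. Leibniz' rule
expands `∂^α u` into terms `⟪Q ∂^β Φ, Q ∂^(α-β) Φ⟫`. Since `Q` is a contraction, each is at most
`‖∂^β Φ‖ * ‖∂^(α-β) Φ‖ = √(D_β D_(α-β))`, independently of `N`; this is where `M` comes from
(`eLpNorm_norm_sq_le`). The derivatives of `Φ` exist because a Gram kernel of class `C^(2m)` has a
feature map of class `C^m` (`contDiffOn_of_kernel`). They are bounded because the derivatives of `K`
are bounded up to the boundary of the compact set (`exists_norm_iteratedFDeriv_le`).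

The constant in the inequality is finite (`gnConst_lt_top`) because a Lipschitz domain contains a
cone of fixed shape at each of its points. The value of a mollified function at the apex is
expressed along each ray through an `m`-th finite difference; averaging over the directions of the
cone gives a bound by `L₁` and `L_p` norms at every small length scale `r`
(`exists_enorm_mollify_le`). Optimising over `r` produces the exponent `θ`, and the mollification is
removed at Lebesgue points. -/

theorem mem_interior_of_graph_lt {x ν : EuclideanSpace ℝ (Fin n)}
    {g : EuclideanSpace ℝ (Fin n) → ℝ} {r : ℝ} (hg : Continuous g)
    (h : ∀ y ∈ Metric.ball x r, y ∈ Ω ↔ g (y - (inner ℝ ν y) • ν) ≤ inner ℝ ν y)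
    {y : EuclideanSpace ℝ (Fin n)} (hy : y ∈ Metric.ball x r)
    (hlt : g (y - (inner ℝ ν y) • ν) < inner ℝ ν y) : y ∈ interior Ω := by
  rw [mem_interior]
  refine ⟨Metric.ball x r ∩ {y | g (y - (inner ℝ ν y) • ν) < inner ℝ ν y}, ?_, ?_, hy, hlt⟩
  · rintro z ⟨hz, hz'⟩
    exact (h z hz).2 (le_of_lt hz')
  · exact Metric.isOpen_ball.inter (isOpen_lt (by fun_prop) (by fun_prop))

/-- `Ω` has the interior cone property on `S`, with opening `κ` and height `r`. -/
def HasInteriorCones (Ω S : Set (EuclideanSpace ℝ (Fin n))) (r κ : ℝ) : Prop :=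
  ∀ x ∈ S, ∃ ν : EuclideanSpace ℝ (Fin n), ‖ν‖ ≤ 1 ∧
    ∀ s ∈ Ioc 0 r, ∀ z ∈ Metric.closedBall ν κ, x + s • z ∈ interior Ω

theorem HasInteriorCones.mono {S : Set (EuclideanSpace ℝ (Fin n))} {r κ r' κ' : ℝ}
    (h : HasInteriorCones Ω S r κ) (hr : r' ≤ r) (hκ : κ' ≤ κ) : HasInteriorCones Ω S r' κ' := by
  intro x hx
  obtain ⟨ν, hν, H⟩ := h x hx
  exact ⟨ν, hν, fun s hs z hz => H s ⟨hs.1, hs.2.trans hr⟩ z (Metric.closedBall_subset_closedBall hκ hz)⟩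

/-- At an interior point the axis is `0` and the cone is a ball. At a boundary point the axis is the
vertical direction. With `κ = 1 / (L + 2)`, a step `s • z` raises the height by at least `s * (1 -
κ)`, while its horizontal part, at most `s * κ`, raises the graph by at most `L * s * κ`, which is
smaller because `(L + 1) * κ < 1`. -/
theorem exists_local_cone (hΩL : HasLipschitzBoundary Ω) {x : EuclideanSpace ℝ (Fin n)}
    (hx : x ∈ Ω) : ∃ δ > 0, ∃ r > 0, ∃ κ > 0, HasInteriorCones Ω (Ω ∩ Metric.ball x δ) r κ := by
  by_cases hxi : x ∈ interior Ω
  · obtain ⟨ρ, hρ, hball⟩ := Metric.isOpen_iff.1 isOpen_interior x hxi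
    refine ⟨ρ / 2, by positivity, ρ / 4, by positivity, 1, one_pos, ?_⟩
    rintro y ⟨-, hy⟩
    refine ⟨0, by simp, fun s hs z hz => hball ?_⟩
    rw [Metric.mem_ball, dist_eq_norm] at hy ⊢
    have hz' : ‖z‖ ≤ 1 := by simpa using hz
    have h1 : ‖s • z‖ ≤ ρ / 4 := by
      rw [norm_smul, Real.norm_of_nonneg hs.1.le]
      nlinarith [hs.1, hs.2, norm_nonneg z]
    calc ‖y + s • z - x‖ = ‖(y - x) + s • z‖ := by congr 1; abel
      _ ≤ ‖y - x‖ + ‖s • z‖ := norm_add_le _ _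
      _ < ρ := by linarith
  · obtain ⟨ν, g, L, r, hν, hg, hr, H⟩ := hΩL x ⟨subset_closure hx, hxi⟩
    have hL : (0 : ℝ) ≤ L := L.2
    refine ⟨r / 2, by positivity, r / 8, by positivity, 1 / (L + 2), by positivity, ?_⟩
    rintro y ⟨hyΩ, hy⟩
    refine ⟨ν, hν.le, fun s hs z hz => ?_⟩
    rw [Metric.mem_ball, dist_eq_norm] at hy
    rw [mem_closedBall_iff_norm] at hz
    have hκ1 : (1 : ℝ) / (L + 2) ≤ 1 := by rw [div_le_one (by positivity)]; linarith
    have hs0 := hs.1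
    have hz' : ‖z‖ ≤ 2 := by
      calc ‖z‖ = ‖(z - ν) + ν‖ := by simp
        _ ≤ ‖z - ν‖ + ‖ν‖ := norm_add_le _ _
        _ ≤ 2 := by linarith
    have h1 : ‖s • z‖ ≤ r / 4 := by
      rw [norm_smul, Real.norm_of_nonneg hs.1.le]
      nlinarith [hs.1, hs.2, norm_nonneg z]
    have hmem : y + s • z ∈ Metric.ball x r := by
      rw [Metric.mem_ball, dist_eq_norm]
      calc ‖y + s • z - x‖ = ‖(y - x) + s • z‖ := by congr 1; abel
        _ ≤ ‖y - x‖ + ‖s • z‖ := norm_add_le _ _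
        _ < r := by linarith
    refine mem_interior_of_graph_lt hg.continuous H hmem ?_
    have hy0 : g (y - (inner ℝ ν y) • ν) ≤ inner ℝ ν y :=
      (H y (by rw [Metric.mem_ball, dist_eq_norm]; linarith)).1 hyΩ
    have hνν : inner ℝ ν ν = (1 : ℝ) := by rw [real_inner_self_eq_norm_sq, hν]; norm_num
    have hzin : 1 - 1 / (L + 2) ≤ inner ℝ ν z := by
      have h2 : inner ℝ ν z = 1 + inner ℝ ν (z - ν) := by rw [inner_sub_right, hνν]; ring
      have h3 := abs_le.1 (abs_real_inner_le_norm ν (z - ν))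
      rw [hν, one_mul] at h3
      linarith [h3.1]
    have hhor : ‖z - (inner ℝ ν z) • ν‖ ≤ 1 / (L + 2) := by
      -- Since `ν` is vertical, `z` and `z - ν` have the same horizontal part; this is Pythagoras
      -- for `z - ν`.
      have h2 : ‖z - (inner ℝ ν z) • ν‖ ^ 2 = ‖z - ν‖ ^ 2 - (inner ℝ ν (z - ν)) ^ 2 := by
        rw [norm_sub_sq_real, norm_sub_sq_real, inner_sub_right, hνν, norm_smul, hν,
          inner_smul_right, real_inner_comm, mul_one, Real.norm_eq_abs, sq_abs]
        ring
      have h3 : ‖z - (inner ℝ ν z) • ν‖ ^ 2 ≤ ‖z - ν‖ ^ 2 := by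
        rw [h2]; nlinarith [sq_nonneg (inner ℝ ν (z - ν) : ℝ)]
      exact (abs_le_of_sq_le_sq' h3 (norm_nonneg _)).2.trans hz
    have hlip := hg.dist_le_mul (y + s • z - (inner ℝ ν (y + s • z)) • ν) (y - (inner ℝ ν y) • ν)
    rw [Real.dist_eq, dist_eq_norm] at hlip
    have h4 : (y + s • z - (inner ℝ ν (y + s • z)) • ν) - (y - (inner ℝ ν y) • ν)
        = s • (z - (inner ℝ ν z) • ν) := by
      rw [inner_add_right, inner_smul_right]; module
    rw [h4, norm_smul, Real.norm_of_nonneg hs0.le] at hlip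
    have h5 : (L : ℝ) * (s * ‖z - (inner ℝ ν z) • ν‖) ≤ L * (s * (1 / (L + 2))) := by gcongr
    have h6 : inner ℝ ν (y + s • z) = inner ℝ ν y + s * inner ℝ ν z := by
      rw [inner_add_right, inner_smul_right]
    have h7 : s * (1 - 1 / (L + 2)) ≤ s * inner ℝ ν z := by gcongr
    have h8 : (L : ℝ) * (s * (1 / (L + 2))) < s * (1 - 1 / (L + 2)) := by
      have : s * (1 - 1 / (L + 2)) - (L : ℝ) * (s * (1 / (L + 2))) = s * (1 / (L + 2)) := by
        field_simp; ring
      have : 0 < s * (1 / ((L : ℝ) + 2)) := by positivity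
      linarith
    have h9 := (abs_le.1 hlip).2
    rw [h6] at *
    linarith

/-- Compactness makes the height and the opening uniform. The bound `κ ≤ 1` later keeps the
directions in a cone of scale `r` below `2 * r` in norm. -/
theorem exists_interior_cones (hΩ : IsCompact Ω) (hΩL : HasLipschitzBoundary Ω) :
    ∃ r > 0, ∃ κ > 0, κ ≤ 1 ∧ HasInteriorCones Ω Ω r κ := by
  suffices h : ∃ r > 0, ∃ κ > 0, HasInteriorCones Ω (Ω ∩ Ω) r κ by
    obtain ⟨r, hr, κ, hκ, H⟩ := h
    rw [inter_self] at H
    exact ⟨r, hr, min κ 1, by positivity, min_le_right _ _, H.mono le_rfl (min_le_left _ _)⟩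
  refine hΩ.induction_on (p := fun S => ∃ r > 0, ∃ κ > 0, HasInteriorCones Ω (Ω ∩ S) r κ)
    ⟨1, one_pos, 1, one_pos, by simp [HasInteriorCones]⟩ ?_ ?_ ?_
  · rintro s t hst ⟨r, hr, κ, hκ, H⟩
    exact ⟨r, hr, κ, hκ, fun x hx => H x ⟨hx.1, hst hx.2⟩⟩
  · rintro s t ⟨r, hr, κ, hκ, H⟩ ⟨r', hr', κ', hκ', H'⟩
    refine ⟨min r r', by positivity, min κ κ', by positivity, ?_⟩
    rintro x ⟨hx, hx' | hx'⟩
    · exact H.mono (min_le_left _ _) (min_le_left _ _) x ⟨hx, hx'⟩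
    · exact H'.mono (min_le_right _ _) (min_le_right _ _) x ⟨hx, hx'⟩
  · intro x hx
    obtain ⟨δ, hδ, h⟩ := exists_local_cone hΩL hx
    exact ⟨Metric.ball x δ, mem_nhdsWithin_of_mem_nhds (Metric.ball_mem_nhds x hδ), h⟩

/-- This lets equalities that hold almost everywhere between continuous functions pass to all of
`Ω`. -/
theorem subset_closure_interior (hΩ : IsCompact Ω) (hΩL : HasLipschitzBoundary Ω) :
    Ω ⊆ closure (interior Ω) := by
  obtain ⟨r, hr, κ, hκ, -, H⟩ := exists_interior_cones hΩ hΩL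
  intro x hx
  obtain ⟨ν, -, hν⟩ := H x hx
  have ht : Filter.Tendsto (fun s : ℝ => x + s • ν) (nhdsWithin 0 (Ioi 0)) (nhds x) := by
    have : Continuous fun s : ℝ => x + s • ν := by fun_prop
    simpa using (this.tendsto 0).mono_left nhdsWithin_le_nhds
  refine mem_closure_of_tendsto ht ?_
  filter_upwards [Ioc_mem_nhdsGT hr] with s hs
  exact hν s hs ν (Metric.mem_closedBall_self hκ.le)

/-- Locally the frontier lies in a graph, so its translates by distinct multiples of the vertical
direction are disjoint. Infinitely many disjoint translates by a bounded set of vectors force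
measure zero. -/
theorem volume_frontier_eq_zero (hΩ : IsCompact Ω) (hΩL : HasLipschitzBoundary Ω) :
    volume (frontier Ω) = 0 := by
  refine measure_null_of_locally_null _ fun x hx => ?_
  obtain ⟨ν, g, L, r, hν, hg, hr, H⟩ := hΩL x hx
  refine ⟨Metric.ball x r ∩ frontier Ω, inter_comm _ (frontier Ω) ▸
    inter_mem_nhdsWithin _ (Metric.ball_mem_nhds x hr), ?_⟩
  have hνν : inner ℝ ν ν = (1 : ℝ) := by rw [real_inner_self_eq_norm_sq, hν]; norm_num
  have hgraph : ∀ y ∈ Metric.ball x r ∩ frontier Ω, g (y - (inner ℝ ν y) • ν) = inner ℝ ν y := by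
    rintro y ⟨hy, hy'⟩
    refine le_antisymm ((H y hy).1 (hΩ.isClosed.frontier_subset hy')) (not_lt.1 fun hlt => ?_)
    exact hy'.2 (mem_interior_of_graph_lt hg.continuous H hy hlt)
  refine Measure.addHaar_eq_zero_of_disjoint_translates volume (u := fun k : ℕ => (1 / ((k : ℝ) + 1)) • ν)
    ?_ ?_
    (Metric.isOpen_ball.measurableSet.inter isClosed_frontier.measurableSet)
  · refine (Metric.isBounded_closedBall (x := 0) (r := 1)).subset ?_
    rintro _ ⟨k, rfl⟩
    rw [mem_closedBall_zero_iff, norm_smul, hν, mul_one, Real.norm_of_nonneg (by positivity),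
      div_le_one (by positivity)]
    linarith [(Nat.cast_nonneg k : (0 : ℝ) ≤ k)]
  · intro j k hjk
    rw [Function.onFun, Set.disjoint_left]
    rintro z ⟨a, ha, y, hy, rfl⟩ ⟨b, hb, y', hy', he⟩
    rw [mem_singleton_iff] at ha hb
    subst ha hb
    simp only at he
    have e1 : y' = y + (1 / ((j : ℝ) + 1) - 1 / ((k : ℝ) + 1)) • ν := by
      rw [sub_smul, ← add_sub_assoc, add_comm y, ← he]; abel
    set c := 1 / ((j : ℝ) + 1) - 1 / ((k : ℝ) + 1)
    have e2 : y' - (inner ℝ ν y') • ν = y - (inner ℝ ν y) • ν := by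
      rw [e1, inner_add_right, inner_smul_right, hνν]; module
    have e3 := hgraph y' hy'
    rw [e2, hgraph y hy, e1, inner_add_right, inner_smul_right, hνν, mul_one] at e3
    have hc : c = 0 := by linarith
    apply hjk
    have h1 : ((j : ℝ) + 1) = (k : ℝ) + 1 := by
      have := sub_eq_zero.1 hc
      simpa using this
    exact_mod_cast add_right_cancel h1

theorem restrict_interior_eq (hΩ : IsCompact Ω) (hΩL : HasLipschitzBoundary Ω) :
    (volume : Measure (EuclideanSpace ℝ (Fin n))).restrict (interior Ω) = volume.restrict Ω :=
  Measure.restrict_congr_set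
    (interior_ae_eq_of_null_frontier (volume_frontier_eq_zero hΩ hΩL))

end Geometry

/-! ### Iterated directional derivatives -/

section DirDeriv

variable {E F G : Type*} [NormedAddCommGroup E] [NormedSpace ℝ E] [NormedAddCommGroup F]
  [NormedSpace ℝ F] [NormedAddCommGroup G] [NormedSpace ℝ G]

/-- The iterated directional derivative `∂_{v₁} ⋯ ∂_{vₖ} f` along the list `[v₁, …, vₖ]`. -/
def dirDeriv (l : List E) (f : E → F) : E → F := l.foldr (fun v g x => fderiv ℝ g x v) f

@[simp] theorem dirDeriv_nil (f : E → F) : dirDeriv [] f = f := rfl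

theorem dirDeriv_cons (v : E) (l : List E) (f : E → F) :
    dirDeriv (v :: l) f = fun x => fderiv ℝ (dirDeriv l f) x v := rfl

theorem dirDeriv_append (l l' : List E) (f : E → F) :
    dirDeriv (l ++ l') f = dirDeriv l (dirDeriv l' f) := by
  simp [dirDeriv, List.foldr_append]

theorem dirDeriv_congr {U : Set E} (hU : IsOpen U) {f g : E → F} (h : EqOn f g U) (l : List E) :
    EqOn (dirDeriv l f) (dirDeriv l g) U := by
  induction l with
  | nil => exact h
  | cons v l ih =>
    intro x hx
    simp only [dirDeriv_cons]
    rw [(ih.eventuallyEq_of_mem (hU.mem_nhds hx)).fderiv_eq]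

theorem contDiffOn_fderiv_apply {U : Set E} (hU : IsOpen U) {f : E → F} {k N : WithTop ℕ∞}
    (hf : ContDiffOn ℝ N f U) (hk : k + 1 ≤ N) (v : E) :
    ContDiffOn ℝ k (fun x => fderiv ℝ f x v) U :=
  (hf.fderiv_of_isOpen hU hk).clm_apply contDiffOn_const

theorem contDiffOn_dirDeriv {U : Set E} (hU : IsOpen U) {f : E → F} (l : List E)
    {k N : WithTop ℕ∞} (hf : ContDiffOn ℝ N f U) (hk : k + l.length ≤ N) :
    ContDiffOn ℝ k (dirDeriv l f) U := by
  induction l generalizing k with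
  | nil => exact hf.of_le (by simpa using hk)
  | cons v l ih =>
    refine contDiffOn_fderiv_apply hU (ih (k := k + 1) ?_) le_rfl v
    refine le_trans (le_of_eq ?_) hk
    push_cast [List.length_cons]
    rw [add_assoc, add_comm (1 : WithTop ℕ∞)]

theorem contDiff_dirDeriv_infty {f : E → F} (l : List E) (hf : ContDiff ℝ (⊤ : ℕ∞) f) :
    ContDiff ℝ (⊤ : ℕ∞) (dirDeriv l f) := by
  induction l with
  | nil => exact hf
  | cons v l ih =>
    exact (ih.fderiv_right (m := (⊤ : ℕ∞)) (by exact_mod_cast le_top)).clm_apply contDiff_const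

theorem tsupport_dirDeriv_subset (l : List E) (f : E → F) :
    tsupport (dirDeriv l f) ⊆ tsupport f := by
  induction l with
  | nil => exact subset_rfl
  | cons v l ih => exact (tsupport_fderiv_apply_subset ℝ v).trans ih

theorem differentiableAt_dirDeriv {U : Set E} (hU : IsOpen U) {f : E → F} (l : List E)
    {N : ℕ} (hf : ContDiffOn ℝ N f U) (hk : l.length < N) {x : E} (hx : x ∈ U) :
    DifferentiableAt ℝ (dirDeriv l f) x := by
  refine ((contDiffOn_dirDeriv hU l (k := 1) hf ?_).differentiableOn one_ne_zero).differentiableAt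
    (hU.mem_nhds hx)
  rw [add_comm]
  exact_mod_cast hk

theorem continuousOn_dirDeriv {U : Set E} (hU : IsOpen U) {f : E → F} (l : List E)
    {N : ℕ} (hf : ContDiffOn ℝ N f U) (hk : l.length ≤ N) :
    ContinuousOn (dirDeriv l f) U := by
  refine (contDiffOn_dirDeriv hU l (k := 0) hf ?_).continuousOn
  rw [zero_add]
  exact_mod_cast hk

/-- Adjacent swaps generate all permutations, and each swap is the symmetry of the second
derivative. -/
theorem dirDeriv_perm {U : Set E} (hU : IsOpen U) {f : E → F} {l l' : List E} (h : l.Perm l')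
    {N : ℕ} (hf : ContDiffOn ℝ N f U) (hN : l.length ≤ N) :
    EqOn (dirDeriv l f) (dirDeriv l' f) U := by
  induction h with
  | nil => exact fun _ _ => rfl
  | cons v _ ih =>
    exact dirDeriv_congr hU (ih (le_trans (by simp) hN)) [v]
  | swap v w l =>
    intro x hx
    have hg : ContDiffAt ℝ 2 (dirDeriv l f) x := by
      refine (contDiffOn_dirDeriv hU l hf ?_).contDiffAt (hU.mem_nhds hx)
      rw [add_comm]
      exact_mod_cast hN
    have hd : DifferentiableAt ℝ (fderiv ℝ (dirDeriv l f)) x :=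
      (hg.fderiv_right (m := 1) (by norm_num)).differentiableAt one_ne_zero
    have hs : IsSymmSndFDerivAt ℝ (dirDeriv l f) x := hg.isSymmSndFDerivAt (by simp)
    have key : ∀ a b : E, fderiv ℝ (fun y => fderiv ℝ (dirDeriv l f) y b) x a
        = fderiv ℝ (fderiv ℝ (dirDeriv l f)) x a b := by
      intro a b
      rw [fderiv_clm_apply hd (differentiableAt_const b)]
      simp
    simp only [dirDeriv_cons, key]
    exact hs _ _
  | trans h1 h2 ih1 ih2 =>
    exact (ih1 hN).trans (ih2 (h1.length_eq ▸ hN))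

/-- Each direction is traded for one more order of differentiation: evaluation at a vector of norm
at most one has operator norm at most one. -/
theorem norm_iteratedFDeriv_dirDeriv_le {U : Set E} (hU : IsOpen U) {f : E → F} (l : List E)
    {N : ℕ} (hf : ContDiffOn ℝ N f U) {x : E} (hx : x ∈ U) (hl : ∀ v ∈ l, ‖v‖ ≤ 1) (k : ℕ)
    (hk : k + l.length ≤ N) :
    ‖iteratedFDeriv ℝ k (dirDeriv l f) x‖ ≤ ‖iteratedFDeriv ℝ (k + l.length) f x‖ := by
  induction l generalizing k with
  | nil => exact le_rfl
  | cons v l ih =>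
    have hg : ContDiffAt ℝ k (fderiv ℝ (dirDeriv l f)) x := by
      have : ContDiffOn ℝ (k + 1) (dirDeriv l f) U := by
        refine contDiffOn_dirDeriv hU l hf ?_
        rw [List.length_cons] at hk
        exact_mod_cast (by omega : k + 1 + l.length ≤ N)
      exact (this.fderiv_of_isOpen hU le_rfl).contDiffAt (hU.mem_nhds hx)
    have h1 := (ContinuousLinearMap.apply ℝ F v).norm_iteratedFDeriv_comp_left hg
      (n := k) (by exact_mod_cast le_rfl)
    have h2 : ‖ContinuousLinearMap.apply ℝ F v‖ ≤ 1 := by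
      refine ContinuousLinearMap.opNorm_le_bound _ zero_le_one fun A => ?_
      rw [ContinuousLinearMap.apply_apply, one_mul]
      exact (A.le_opNorm v).trans (mul_le_of_le_one_right (norm_nonneg _) (hl v (by simp)))
    have h3 := ih (fun w hw => hl w (by simp [hw])) (k + 1) (by
      rw [List.length_cons] at hk; omega)
    rw [List.length_cons, show k + (l.length + 1) = k + 1 + l.length by omega]
    refine le_trans ?_ h3
    rw [← norm_iteratedFDeriv_fderiv]
    exact h1.trans (mul_le_of_le_one_left (norm_nonneg _) h2)

theorem norm_dirDeriv_le {U : Set E} (hU : IsOpen U) {f : E → F} (l : List E)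
    {N : ℕ} (hf : ContDiffOn ℝ N f U) {x : E} (hx : x ∈ U) (hl : ∀ v ∈ l, ‖v‖ ≤ 1)
    (hk : l.length ≤ N) :
    ‖dirDeriv l f x‖ ≤ ‖iteratedFDeriv ℝ l.length f x‖ := by
  have h := norm_iteratedFDeriv_dirDeriv_le hU l hf hx hl 0 (by simpa using hk)
  rwa [zero_add, norm_iteratedFDeriv_zero] at h

theorem dirDeriv_clm_comp {U : Set E} (hU : IsOpen U) {f : E → F} (A : F →L[ℝ] G) (l : List E)
    {N : ℕ} (hf : ContDiffOn ℝ N f U) (hN : l.length ≤ N) :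
    EqOn (dirDeriv l (fun x => A (f x))) (fun x => A (dirDeriv l f x)) U := by
  induction l with
  | nil => exact fun _ _ => rfl
  | cons v l ih =>
    intro x hx
    have h1 := dirDeriv_congr hU (ih (le_trans (by simp) hN)) [v] hx
    have hd : DifferentiableAt ℝ (dirDeriv l f) x := differentiableAt_dirDeriv hU l hf hN hx
    have h2 := A.hasFDerivAt.comp x hd.hasFDerivAt
    have h3 : fderiv ℝ (fun y => A (dirDeriv l f y)) x = A.comp (fderiv ℝ (dirDeriv l f) x) :=
      h2.fderiv
    simp only [dirDeriv_cons, dirDeriv_nil] at h1 ⊢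
    rw [h1, h3]
    rfl

end DirDeriv

/-! ### Multi-indices -/

section MultiIndex

variable {n : ℕ}

/-- The list of coordinate directions that corresponds to a multi-index. -/
def dirList (α : Fin n → ℕ) : List (EuclideanSpace ℝ (Fin n)) :=
  (List.finRange n).flatMap fun i => List.replicate (α i) (EuclideanSpace.single i 1)

theorem norm_le_one_of_mem_dirList {α : Fin n → ℕ} {v : EuclideanSpace ℝ (Fin n)}
    (hv : v ∈ dirList α) : ‖v‖ ≤ 1 := by
  simp only [dirList, List.mem_flatMap, List.mem_replicate] at hv
  obtain ⟨i, -, -, rfl⟩ := hv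
  simp

theorem length_dirList (α : Fin n → ℕ) : (dirList α).length = ∑ i, α i := by
  simp [dirList, List.length_flatMap, Fin.sum_univ_def]

theorem perm_dirList_add_single (α : Fin n → ℕ) (i : Fin n) :
    (EuclideanSpace.single i 1 :: dirList α).Perm (dirList (α + Pi.single i 1)) := by
  have key : ∀ J : List (Fin n), J.Nodup →
      (J.flatMap fun j => List.replicate ((α + Pi.single i 1 : Fin n → ℕ) j)
        (EuclideanSpace.single j (1 : ℝ))).Perm
      ((if i ∈ J then [EuclideanSpace.single i 1] else []) ++
        J.flatMap fun j => List.replicate (α j) (EuclideanSpace.single j 1)) := by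
    intro J hJ
    induction J with
    | nil => simp
    | cons j J ih =>
      rw [List.nodup_cons] at hJ
      have ih := ih hJ.2
      simp only [List.flatMap_cons]
      by_cases hij : i = j
      · subst hij
        simp only [hJ.1, if_false, List.nil_append] at ih
        simp only [Pi.add_apply, Pi.single_eq_same, List.replicate_succ, List.mem_cons, true_or,
          if_true, List.cons_append, List.nil_append, List.perm_cons]
        exact ih.append_left _
      · have : (α + Pi.single i 1 : Fin n → ℕ) j = α j := by simp [Pi.single_eq_of_ne (Ne.symm hij)]
        rw [this]
        refine (ih.append_left _).trans ?_
        simp only [List.mem_cons, hij, false_or]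
        rw [← List.append_assoc, ← List.append_assoc]
        exact List.perm_append_comm.append_right _
  simpa [dirList] using (key (List.finRange n) (List.nodup_finRange n)).symm

/-- The multi-index that counts the occurrences of the coordinates in a list. -/
def countIndex (J : List (Fin n)) : Fin n → ℕ := fun i => J.count i

theorem countIndex_cons (i : Fin n) (J : List (Fin n)) :
    countIndex (i :: J) = countIndex J + Pi.single i 1 := by
  ext j
  simp only [countIndex, List.count_cons, Pi.add_apply, Pi.single_apply, beq_iff_eq, @eq_comm _ i j]

theorem perm_dirList_countIndex (J : List (Fin n)) :
    (J.map fun i => EuclideanSpace.single i (1 : ℝ)).Perm (dirList (countIndex J)) := by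
  induction J with
  | nil =>
    have : dirList (countIndex ([] : List (Fin n))) = [] :=
      List.eq_nil_of_length_eq_zero (by simp [length_dirList, countIndex])
    rw [this, List.map_nil]
  | cons i J ih =>
    rw [countIndex_cons, List.map_cons]
    exact (ih.cons _).trans (perm_dirList_add_single _ i)

theorem sum_countIndex (J : List (Fin n)) : ∑ i, countIndex J i = J.length := by
  rw [← length_dirList, ← (perm_dirList_countIndex J).length_eq, List.length_map]

theorem countIndex_mem_multiIndices (J : List (Fin n)) :
    countIndex J ∈ multiIndices n J.length := by
  simp [multiIndices, sum_countIndex]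

theorem exists_countIndex (α : Fin n → ℕ) : ∃ J : List (Fin n), countIndex J = α ∧
    J.map (fun i => EuclideanSpace.single i (1 : ℝ)) = dirList α := by
  refine ⟨(List.finRange n).flatMap fun i => List.replicate (α i) i, ?_, ?_⟩
  · ext j
    simp only [countIndex, List.count_flatMap, List.count_replicate, Function.comp_def]
    rw [← Fin.sum_univ_def]
    simp
  · simp [dirList, List.map_flatMap]

/-- On an open subset of `Ω` the one-sided derivatives are ordinary ones. This is the passage from
the derivatives in the statement to `dirDeriv`; in `Ω` only the frontier, a null set, is missed. -/
theorem multiDeriv_eqOn {Ω U : Set (EuclideanSpace ℝ (Fin n))} (hU : IsOpen U) (hUΩ : U ⊆ Ω)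
    (α : Fin n → ℕ) (f : EuclideanSpace ℝ (Fin n) → ℝ) :
    EqOn (multiDeriv Ω α f) (dirDeriv (dirList α) f) U := by
  have step : ∀ (i : Fin n) (g h : EuclideanSpace ℝ (Fin n) → ℝ), EqOn g h U → ∀ k : ℕ,
      EqOn ((partialDeriv Ω i)^[k] g)
        (dirDeriv (List.replicate k (EuclideanSpace.single i 1)) h) U := by
    intro i g h hgh k
    induction k with
    | zero => exact hgh
    | succ k ih =>
      intro x hx
      rw [Function.iterate_succ_apply', List.replicate_succ, dirDeriv_cons]
      simp only [partialDeriv]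
      rw [fderivWithin_of_mem_nhds (Filter.mem_of_superset (hU.mem_nhds hx) hUΩ),
        (ih.eventuallyEq_of_mem (hU.mem_nhds hx)).fderiv_eq]
  unfold multiDeriv dirList
  induction List.finRange n with
  | nil => exact fun _ _ => rfl
  | cons i J ih =>
    rw [List.foldr_cons, List.flatMap_cons, dirDeriv_append]
    exact step i _ _ ih _

/-- The combinatorial step of Leibniz' rule: one more derivative in the coordinate `i` falls on
either factor, and Pascal's rule recombines the coefficients. `T β γ` stands for the product with
orders `β` and `γ`. -/
theorem sum_choose_add_single (α : Fin n → ℕ) (i : Fin n)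
    (T : (Fin n → ℕ) → (Fin n → ℕ) → ℝ) :
    ∑ β ∈ Finset.Iic (α + Pi.single i 1),
        ((∏ j, ((α + Pi.single i 1 : Fin n → ℕ) j).choose (β j) : ℕ) : ℝ) * T β (α + Pi.single i 1 - β) =
      ∑ β ∈ Finset.Iic α, ((∏ j, (α j).choose (β j) : ℕ) : ℝ) *
        (T (β + Pi.single i 1) (α - β) + T β (α - β + Pi.single i 1)) := by
  -- The case split is needed because `β - Pi.single i 1` is truncated when `β i = 0`.
  have pascal : ∀ β : Fin n → ℕ, (∏ j, ((α + Pi.single i 1 : Fin n → ℕ) j).choose (β j) : ℕ) =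
      (if 1 ≤ β i then ∏ j, (α j).choose ((β - Pi.single i 1 : Fin n → ℕ) j) else 0) +
        ∏ j, (α j).choose (β j) := by
    intro β
    have hprod : ∀ g : Fin n → ℕ, ∏ j, g j = g i * ∏ j ∈ Finset.univ.erase i, g j := fun g =>
      (Finset.mul_prod_erase _ _ (Finset.mem_univ i)).symm
    have h1 : ∏ j ∈ Finset.univ.erase i, ((α + Pi.single i 1 : Fin n → ℕ) j).choose (β j) =
        ∏ j ∈ Finset.univ.erase i, (α j).choose (β j) :=
      Finset.prod_congr rfl fun j hj => by
        simp [Pi.single_eq_of_ne (Finset.ne_of_mem_erase hj)]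
    have h2 : ∏ j ∈ Finset.univ.erase i, (α j).choose ((β - Pi.single i 1 : Fin n → ℕ) j) =
        ∏ j ∈ Finset.univ.erase i, (α j).choose (β j) :=
      Finset.prod_congr rfl fun j hj => by
        simp [Pi.single_eq_of_ne (Finset.ne_of_mem_erase hj)]
    rw [hprod, hprod fun j => (α j).choose (β j), h1]
    by_cases hβ : 1 ≤ β i
    swap
    · simp [Nat.lt_one_iff.1 (not_le.1 hβ)]
    have h3 : ∏ j, (α j).choose ((β - Pi.single i 1 : Fin n → ℕ) j) =
        (α i).choose ((β - Pi.single i 1 : Fin n → ℕ) i) *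
          ∏ j ∈ Finset.univ.erase i, (α j).choose ((β - Pi.single i 1 : Fin n → ℕ) j) := hprod _
    rw [if_pos hβ, h3, h2]
    simp only [Pi.add_apply, Pi.single_eq_same, Pi.sub_apply]
    obtain ⟨b, hb⟩ := Nat.exists_eq_add_of_le' hβ
    simp [hb, Nat.choose_succ_succ, add_mul]
  simp only [pascal, Nat.cast_add, add_mul, Finset.sum_add_distrib, mul_add]
  congr 1
  · simp only [Nat.cast_ite, Nat.cast_zero, ite_mul, zero_mul]
    rw [← Finset.sum_filter]
    symm
    refine Finset.sum_nbij' (fun β => β + Pi.single i 1) (fun β => β - Pi.single i 1)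
      ?_ ?_ ?_ ?_ ?_
    · intro β hβ
      simp only [Finset.mem_Iic, Finset.mem_filter] at hβ ⊢
      exact ⟨add_le_add_left hβ _, by simp⟩
    · intro β hβ
      simp only [Finset.mem_Iic, Finset.mem_filter] at hβ ⊢
      exact tsub_le_iff_right.2 hβ.1
    · intro β _
      exact add_tsub_cancel_right _ _
    · intro β hβ
      simp only [Finset.mem_Iic, Finset.mem_filter] at hβ
      refine tsub_add_cancel_of_le fun j => ?_
      by_cases hj : j = i
      · subst hj; simpa using hβ.2
      · simp [Pi.single_eq_of_ne hj]
    · intro β _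
      rw [add_tsub_cancel_right, add_tsub_add_eq_tsub_right]
  · symm
    -- The extra indices are not below `α`, so one of their binomial coefficients vanishes.
    refine Finset.sum_subset_zero_on_sdiff (Finset.Iic_subset_Iic.2 (by simp)) ?_ ?_
    · intro β hβ
      simp only [Finset.mem_sdiff, Finset.mem_Iic, Pi.le_def, not_forall, not_le] at hβ
      obtain ⟨-, j, hj⟩ := hβ
      rw [Finset.prod_eq_zero (Finset.mem_univ j) (Nat.choose_eq_zero_of_lt hj)]
      simp
    · intro β hβ
      rw [tsub_add_eq_add_tsub (Finset.mem_Iic.1 hβ)]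

variable {H : Type*} [NormedAddCommGroup H] [InnerProductSpace ℝ H]

/-- The Leibniz rule for inner products. -/
theorem dirDeriv_inner {U : Set (EuclideanSpace ℝ (Fin n))} (hU : IsOpen U)
    {f g : EuclideanSpace ℝ (Fin n) → H} {N : ℕ} (hf : ContDiffOn ℝ N f U)
    (hg : ContDiffOn ℝ N g U) (α : Fin n → ℕ) (hα : ∑ i, α i ≤ N) :
    EqOn (dirDeriv (dirList α) fun x => (inner ℝ (f x) (g x) : ℝ))
      (fun x => ∑ β ∈ Finset.Iic α, ((∏ j, (α j).choose (β j) : ℕ) : ℝ) *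
        inner ℝ (dirDeriv (dirList β) f x) (dirDeriv (dirList (α - β)) g x)) U := by
  -- The induction runs over a list of coordinates that realises `α`, so that one derivative is
  -- added at a time.
  obtain ⟨J, rfl, hJ⟩ := exists_countIndex α
  rw [sum_countIndex] at hα
  rw [← hJ]
  clear hJ
  induction J with
  | nil =>
    intro x _
    have h0 : countIndex ([] : List (Fin n)) = 0 := by ext; simp [countIndex]
    have h1 : dirList (0 : Fin n → ℕ) = [] :=
      List.eq_nil_of_length_eq_zero (by simp [length_dirList])
    have h2 : Finset.Iic (0 : Fin n → ℕ) = {0} := by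
      ext β; simp [← bot_eq_zero]
    simp [h0, h2, h1]
  | cons i J ih =>
    intro x hx
    rw [List.length_cons] at hα
    have h1 := dirDeriv_congr hU (ih (by omega)) [EuclideanSpace.single i 1] hx
    simp only [List.map_cons, dirDeriv_cons, dirDeriv_nil] at h1 ⊢
    rw [h1, countIndex_cons, sum_choose_add_single (countIndex J) i
      (fun β γ => inner ℝ (dirDeriv (dirList β) f x) (dirDeriv (dirList γ) g x))]
    have hlen : ∀ β ∈ Finset.Iic (countIndex J), (dirList β).length < N ∧
        (dirList (countIndex J - β)).length < N := by
      intro β hβ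
      rw [Finset.mem_Iic] at hβ
      have h2 : ∑ j, β j ≤ ∑ j, countIndex J j := Finset.sum_le_sum fun j _ => hβ j
      have h3 : ∑ j, (countIndex J - β) j ≤ ∑ j, countIndex J j :=
        Finset.sum_le_sum fun j _ => by simp
      rw [sum_countIndex] at h2 h3
      rw [length_dirList, length_dirList]
      omega
    have hd : ∀ β ∈ Finset.Iic (countIndex J), HasFDerivAt (fun y =>
        ((∏ j, (countIndex J j).choose (β j) : ℕ) : ℝ) *
        inner ℝ (dirDeriv (dirList β) f y) (dirDeriv (dirList (countIndex J - β)) g y)) _ x :=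
      fun β hβ => ((differentiableAt_dirDeriv hU _ hf (hlen β hβ).1 hx).hasFDerivAt.inner ℝ
        (differentiableAt_dirDeriv hU _ hg (hlen β hβ).2 hx).hasFDerivAt).const_mul _
    rw [(HasFDerivAt.fun_sum hd).fderiv, sum_apply]
    refine Finset.sum_congr rfl fun β hβ => ?_
    have hp1 := dirDeriv_perm hU (perm_dirList_add_single β i) hf
      (by rw [List.length_cons]; exact (hlen β hβ).1) hx
    have hp2 := dirDeriv_perm hU (perm_dirList_add_single (countIndex J - β) i) hg
      (by rw [List.length_cons]; exact (hlen β hβ).2) hx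
    rw [dirDeriv_cons] at hp1 hp2
    simp only [← hp1, ← hp2]
    simp only [smul_apply, ContinuousLinearMap.comp_apply,
      ContinuousLinearMap.prod_apply, fderivInnerCLM_apply, smul_eq_mul]
    ring

end MultiIndex

/-! ### Integration by parts -/

section Parts

variable {E : Type*} [NormedAddCommGroup E] [NormedSpace ℝ E] [FiniteDimensional ℝ E]
  [MeasurableSpace E] [BorelSpace E] (μ : Measure E) [μ.IsAddHaarMeasure]

/-- `f` is smooth on `U` only, but its products with `η` and with the derivative of `η` are
supported inside `U`. They are therefore continuous and integrable on the whole space, where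
integration by parts applies. -/
theorem setIntegral_mul_fderiv {U : Set E} (hU : IsOpen U) {f η : E → ℝ}
    (hf : ContDiffOn ℝ 1 f U) (hη : ContDiff ℝ 1 η) (hc : HasCompactSupport η)
    (hs : tsupport η ⊆ U) (v : E) :
    ∫ x in U, f x * fderiv ℝ η x v ∂μ = - ∫ x in U, fderiv ℝ f x v * η x ∂μ := by
  have hη0 : ∀ x ∉ U, η x = 0 := fun x hx => image_eq_zero_of_notMem_tsupport fun h => hx (hs h)
  have hη1 : ∀ x ∉ U, fderiv ℝ η x v = 0 := fun x hx =>
    image_eq_zero_of_notMem_tsupport (f := fun x => fderiv ℝ η x v)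
      fun h => hx (hs (tsupport_fderiv_apply_subset ℝ v h))
  have hc1 : HasCompactSupport fun x => f x * fderiv ℝ η x v :=
    (hc.fderiv_apply (𝕜 := ℝ) v).mul_left
  have hc2 : HasCompactSupport fun x => fderiv ℝ f x v * η x := hc.mul_left
  have hi1 : Integrable (fun x => f x * fderiv ℝ η x v) μ := by
    refine Continuous.integrable_of_hasCompactSupport ?_ hc1
    refine continuous_of_tsupport fun x hx => ?_
    have hxU : x ∈ U := hs (tsupport_fderiv_apply_subset ℝ v
      (closure_mono (Function.support_mul_subset_right _ _) hx))
    exact (hf.continuousOn.continuousAt (hU.mem_nhds hxU)).mul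
      ((hη.continuous_fderiv one_ne_zero).clm_apply continuous_const).continuousAt
  have hi2 : Integrable (fun x => fderiv ℝ f x v * η x) μ := by
    refine Continuous.integrable_of_hasCompactSupport ?_ hc2
    refine continuous_of_tsupport fun x hx => ?_
    have hxU : x ∈ U := hs (closure_mono (Function.support_mul_subset_right _ _) hx)
    exact ((contDiffOn_fderiv_apply hU hf (k := 0) (by simp) v).continuousOn.continuousAt
      (hU.mem_nhds hxU)).mul hη.continuous.continuousAt
  have hi : Integrable (fun x => f x * η x) μ := by
    refine Continuous.integrable_of_hasCompactSupport ?_ hc.mul_left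
    refine continuous_of_tsupport fun x hx => ?_
    have hxU : x ∈ U := hs (closure_mono (Function.support_mul_subset_right _ _) hx)
    exact (hf.continuousOn.continuousAt (hU.mem_nhds hxU)).mul hη.continuous.continuousAt
  rw [setIntegral_eq_integral_of_forall_compl_eq_zero (fun x hx => by rw [hη1 x hx, mul_zero]),
    setIntegral_eq_integral_of_forall_compl_eq_zero (fun x hx => by rw [hη0 x hx, mul_zero])]
  exact integral_mul_fderiv_eq_neg_fderiv_mul_of_integrable hi2 hi1 hi
    (fun x hx => (hf.differentiableOn one_ne_zero).differentiableAt (hU.mem_nhds (hs hx)))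
    (fun x _ => hη.differentiable one_ne_zero x)

/-- Each step takes the outermost derivative off `η` and makes it the innermost one on `f`, hence
the reversed list. -/
theorem setIntegral_mul_dirDeriv {U : Set E} (hU : IsOpen U) {η : E → ℝ} {N : ℕ}
    (hη : ContDiff ℝ (⊤ : ℕ∞) η) (hc : HasCompactSupport η)
    (hs : tsupport η ⊆ U) (l : List E) {f : E → ℝ} (hf : ContDiffOn ℝ N f U)
    (hl : l.length ≤ N) :
    ∫ x in U, f x * dirDeriv l η x ∂μ =
      (-1) ^ l.length * ∫ x in U, dirDeriv l.reverse f x * η x ∂μ := by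
  induction l generalizing f N with
  | nil => simp
  | cons v l ih =>
    rw [List.length_cons] at hl
    have hs' := tsupport_dirDeriv_subset l η
    rw [dirDeriv_cons, setIntegral_mul_fderiv μ hU (hf.of_le (by exact_mod_cast (by omega : 1 ≤ N)))
      ((contDiff_dirDeriv_infty l hη).of_le (by exact_mod_cast le_top))
      (hc.mono' (subset_closure.trans hs')) (hs'.trans hs),
      ih (N := N - 1) (f := fun x => fderiv ℝ f x v)
        (contDiffOn_fderiv_apply hU hf (by exact_mod_cast (by omega : N - 1 + 1 ≤ N)) v) (by omega),
      List.reverse_cons, dirDeriv_append, List.length_cons, pow_succ]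
    simp only [dirDeriv_cons, dirDeriv_nil]
    ring

end Parts

/-! ### Finite differences along rays -/

section Rays

theorem enorm_sub_le_lintegral_deriv {f : ℝ → ℝ} (hf : ContDiff ℝ 1 f) (t : ℝ) :
    ‖f (t + 1) - f t‖ₑ ≤ ∫⁻ s in Ioc 0 1, ‖deriv f (t + s)‖ₑ := by
  have h1 : ∫ s in (0 : ℝ)..1, deriv f (t + s) = f (t + 1) - f t := by
    have h := intervalIntegral.integral_eq_sub_of_hasDerivAt (a := 0) (b := 1)
      (f := fun s => f (t + s)) (f' := fun s => deriv f (t + s)) ?_ ?_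
    · simpa using h
    · intro s _
      exact ((hf.differentiable one_ne_zero (t + s)).hasDerivAt).comp_const_add t s
    · exact ((hf.continuous_deriv le_rfl).comp (continuous_const.add continuous_id)).intervalIntegrable _ _
  rw [← h1, intervalIntegral.integral_of_le zero_le_one]
  exact enorm_integral_le_lintegral_enorm _

/-- The difference of order `k + 1` is the integral of `f^(k+1)` against a B-spline supported in
`[0, k + 1]`, and the crude bound `s ^ k` for the spline suffices. This weight later compensates the
singularity `s ^ (-n/p)` at the apex of the cone. -/
theorem enorm_fwdDiff_iter_le (k : ℕ) {f : ℝ → ℝ} (hf : ContDiff ℝ (⊤ : ℕ∞) f) (t : ℝ) :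
    ‖(fwdDiff 1)^[k + 1] f t‖ₑ ≤
      ∫⁻ s in Ioc 0 ((k : ℝ) + 1), ENNReal.ofReal (s ^ k) * ‖iteratedDeriv (k + 1) f (t + s)‖ₑ := by
  induction k generalizing f t with
  | zero =>
    simpa [fwdDiff, iteratedDeriv_one] using enorm_sub_le_lintegral_deriv (hf.of_le (by simp)) t
  | succ k ih =>
    have hg : ContDiff ℝ (⊤ : ℕ∞) (fwdDiff 1 f) :=
      (hf.comp (contDiff_id.add contDiff_const)).sub hf
    have hD : ContDiff ℝ 1 (iteratedDeriv (k + 1) f) := by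
      rw [iteratedDeriv_eq_iterate]
      exact ContDiff.iterate_deriv' 1 (k + 1) (hf.of_le (by exact_mod_cast le_top))
    have hDc : Continuous (iteratedDeriv (k + 2) f) := 
      hf.continuous_iteratedDeriv _ (WithTop.coe_le_coe.2 (le_top : ((k + 2 : ℕ) : ℕ∞) ≤ ⊤))
    have hder : ∀ y, iteratedDeriv (k + 1) (fwdDiff 1 f) y =
        iteratedDeriv (k + 1) f (y + 1) - iteratedDeriv (k + 1) f y := by
      intro y
      have h1 := congrFun (iteratedDeriv_comp_add_const (k + 1) f 1) y
      rw [← h1, ← iteratedDeriv_fun_sub]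
      · rfl
      · exact (hf.comp (contDiff_id.add contDiff_const)).contDiffAt.of_le (by exact_mod_cast le_top)
      · exact hf.contDiffAt.of_le (by exact_mod_cast le_top)
    rw [Function.iterate_succ_apply]
    refine (ih hg t).trans ?_
    -- `S` contains every pair with `0 < s ≤ k + 1` and `s < τ ≤ s + 1`, and `s ^ k ≤ τ ^ k` on it.
    -- After the integrals are swapped, the section at `τ` has length at most `τ`, which supplies
    -- the extra power.
    set S : Set (ℝ × ℝ) := {p | 0 < p.1 ∧ p.1 ≤ p.2 ∧ p.2 ≤ (k : ℝ) + 1 + 1} with hS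
    have hSm : MeasurableSet S :=
      (measurableSet_lt measurable_const measurable_fst).inter
        ((measurableSet_le measurable_fst measurable_snd).inter
          (measurableSet_le measurable_snd measurable_const))
    set T : ℝ × ℝ → ℝ≥0∞ := S.indicator fun p =>
      ENNReal.ofReal (p.2 ^ k) * ‖iteratedDeriv (k + 2) f (t + p.2)‖ₑ with hT
    have hTm : Measurable T := by
      refine Measurable.indicator ?_ hSm
      exact (by fun_prop : Continuous fun p : ℝ × ℝ => p.2 ^ k).measurable.ennreal_ofReal.mul
        (by fun_prop : Continuous fun p : ℝ × ℝ => iteratedDeriv (k + 2) f (t + p.2)).measurable.enorm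
    calc ∫⁻ s in Ioc 0 ((k : ℝ) + 1), ENNReal.ofReal (s ^ k) *
            ‖iteratedDeriv (k + 1) (fwdDiff 1 f) (t + s)‖ₑ
        ≤ ∫⁻ s in Ioc 0 ((k : ℝ) + 1), ∫⁻ τ, T (s, τ) := by
          refine setLIntegral_mono' measurableSet_Ioc fun s hs => ?_
          have h1 : ‖iteratedDeriv (k + 1) (fwdDiff 1 f) (t + s)‖ₑ ≤
              ∫⁻ σ in Ioc 0 1, ‖iteratedDeriv (k + 2) f (t + s + σ)‖ₑ := by
            rw [hder, iteratedDeriv_succ (n := k + 1)]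
            exact enorm_sub_le_lintegral_deriv hD (t + s)
          have h2 : ∫⁻ σ in Ioc 0 1, ‖iteratedDeriv (k + 2) f (t + s + σ)‖ₑ =
              ∫⁻ τ, (Ioc s (s + 1)).indicator
                (fun τ => ‖iteratedDeriv (k + 2) f (t + τ)‖ₑ) τ := by
            rw [← lintegral_add_left_eq_self ((Ioc s (s + 1)).indicator _) s,
              ← lintegral_indicator measurableSet_Ioc]
            refine lintegral_congr fun σ => ?_
            simp only [indicator, mem_Ioc, add_le_add_iff_left, lt_add_iff_pos_right, add_assoc]
          refine (mul_le_mul_right h1 _).trans ?_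
          rw [h2, ← lintegral_const_mul' _ _ ENNReal.ofReal_ne_top]
          refine lintegral_mono fun τ => ?_
          by_cases hτ : τ ∈ Ioc s (s + 1)
          · have hmem : (s, τ) ∈ S := ⟨hs.1, hτ.1.le, hτ.2.trans (by linarith [hs.2])⟩
            rw [indicator_of_mem hτ, hT, indicator_of_mem hmem]
            have := hs.1
            have := hτ.1
            gcongr
          · rw [indicator_of_notMem hτ, mul_zero]
            exact zero_le
      _ ≤ ∫⁻ s, ∫⁻ τ, T (s, τ) := setLIntegral_le_lintegral _ _
      _ = ∫⁻ τ, ∫⁻ s, T (s, τ) := lintegral_lintegral_swap hTm.aemeasurable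
      _ ≤ ∫⁻ τ, (Ioc 0 ((k : ℝ) + 1 + 1)).indicator
            (fun τ => ENNReal.ofReal (τ ^ (k + 1)) * ‖iteratedDeriv (k + 2) f (t + τ)‖ₑ) τ := by
          refine lintegral_mono fun τ => ?_
          by_cases hτ : τ ∈ Ioc 0 ((k : ℝ) + 1 + 1)
          · rw [indicator_of_mem hτ]
            calc ∫⁻ s, T (s, τ) ≤ ∫⁻ s, (Ioc 0 τ).indicator (fun _ =>
                  ENNReal.ofReal (τ ^ k) * ‖iteratedDeriv (k + 2) f (t + τ)‖ₑ) s := by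
                  refine lintegral_mono fun s => ?_
                  by_cases hs : (s, τ) ∈ S
                  · rw [hT, indicator_of_mem hs,
                      indicator_of_mem (show s ∈ Ioc 0 τ from ⟨hs.1, hs.2.1⟩)]
                  · rw [hT, indicator_of_notMem hs]
                    exact zero_le
              _ = _ := by
                  rw [lintegral_indicator measurableSet_Ioc, setLIntegral_const, Real.volume_Ioc,
                    sub_zero, mul_right_comm, ← ENNReal.ofReal_mul (pow_nonneg hτ.1.le _), pow_succ]
          · rw [indicator_of_notMem hτ, nonpos_iff_eq_zero, ← lintegral_zero (μ := (volume : Measure ℝ))]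
            refine lintegral_congr fun s => ?_
            rw [hT, indicator_of_notMem]
            rintro ⟨h1, h2, h3⟩
            exact hτ ⟨h1.trans_le h2, h3⟩
      _ = _ := by
          rw [lintegral_indicator measurableSet_Ioc]
          push_cast
          rfl

/-- Expand the `m`-th forward difference at `0` and solve for the term `f 0`, whose coefficient is
`±1`. -/
theorem enorm_le_sum_add_lintegral {m : ℕ} (hm : 0 < m) {f : ℝ → ℝ}
    (hf : ContDiff ℝ (⊤ : ℕ∞) f) :
    ‖f 0‖ₑ ≤ ∑ j ∈ Finset.Icc 1 m, (m.choose j : ℝ≥0∞) * ‖f j‖ₑ +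
      ∫⁻ s in Ioc 0 (m : ℝ), ENNReal.ofReal (s ^ (m - 1)) * ‖iteratedDeriv m f s‖ₑ := by
  obtain ⟨k, rfl⟩ := Nat.exists_eq_add_of_le' hm
  have h1 := enorm_fwdDiff_iter_le k hf 0
  rw [fwdDiff_iter_eq_sum_shift, Finset.sum_range_succ'] at h1
  simp only [zero_add, Nat.sub_zero, Nat.choose_zero_right, zero_smul, nsmul_eq_mul, mul_one] at h1
  set A := ∑ j ∈ Finset.range (k + 1),
    (((-1) ^ (k + 1 - (j + 1)) * ((k + 1).choose (j + 1) : ℤ)) : ℤ) • f ((j + 1 : ℕ) : ℝ) with hA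
  set B := (((-1) ^ (k + 1) * ((1 : ℕ) : ℤ)) : ℤ) • f 0 with hB
  have hB' : ‖B‖ₑ = ‖f 0‖ₑ := by
    rw [hB]
    rcases neg_one_pow_eq_or ℤ (k + 1) with h | h <;> simp [h]
  have hA' : ‖A‖ₑ ≤ ∑ j ∈ Finset.Icc 1 (k + 1), ((k + 1).choose j : ℝ≥0∞) * ‖f j‖ₑ := by
    rw [hA]
    refine (enorm_sum_le _ _).trans ?_
    have hIcc : Finset.Icc 1 (k + 1) = Finset.Ico (0 + 1) (k + 1 + 1) := by ext; simp
    rw [hIcc, ← Finset.sum_Ico_add' (fun j => ((k + 1).choose j : ℝ≥0∞) * ‖f (j : ℝ)‖ₑ),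
      Finset.range_eq_Ico]
    refine le_of_eq (Finset.sum_congr rfl fun j _ => ?_)
    rw [mul_smul]
    have : ∀ y : ℝ, ‖((-1) ^ (k + 1 - (j + 1)) : ℤ) • y‖ₑ = ‖y‖ₑ := fun y => by
      rcases neg_one_pow_eq_or ℤ (k + 1 - (j + 1)) with h | h <;> rw [h] <;> simp
    rw [this, zsmul_eq_mul, enorm_mul]
    simp
  have hle : ‖B‖ₑ ≤ ‖A‖ₑ + ‖A + B‖ₑ := by
    calc ‖B‖ₑ = ‖(A + B) - A‖ₑ := by simp
      _ ≤ ‖A + B‖ₑ + ‖A‖ₑ := enorm_sub_le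
      _ = _ := add_comm _ _
  rw [hB'] at hle
  refine hle.trans (add_le_add hA' ?_)
  simpa using h1

variable {E : Type*} [NormedAddCommGroup E] [NormedSpace ℝ E]

theorem iteratedDeriv_comp_ray {w : E → ℝ} (hw : ContDiff ℝ (⊤ : ℕ∞) w) (x z : E) (k : ℕ) :
    iteratedDeriv k (fun s : ℝ => w (x + s • z)) =
      fun s => dirDeriv (List.replicate k z) w (x + s • z) := by
  induction k with
  | zero => ext; simp
  | succ k ih =>
    ext s
    rw [iteratedDeriv_succ, ih, List.replicate_succ, dirDeriv_cons]
    have h1 : HasDerivAt (fun s : ℝ => x + s • z) z s := by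
      simpa using ((hasDerivAt_id s).smul_const z).const_add x
    have h2 := (contDiff_dirDeriv_infty (List.replicate k z) hw).differentiable (by simp)
      (x + s • z)
    exact (h2.hasFDerivAt.comp_hasDerivAt s h1).deriv

variable {n : ℕ}

theorem dirDeriv_replicate_eq_sum {w : EuclideanSpace ℝ (Fin n) → ℝ}
    (hw : ContDiff ℝ (⊤ : ℕ∞) w) (z : EuclideanSpace ℝ (Fin n)) (k : ℕ) :
    dirDeriv (List.replicate k z) w = fun y => ∑ J : Fin k → Fin n, (∏ i, z (J i)) *
      dirDeriv ((List.ofFn J).map fun i => EuclideanSpace.single i (1 : ℝ)) w y := by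
  induction k with
  | zero => ext; simp
  | succ k ih =>
    ext y
    rw [List.replicate_succ, dirDeriv_cons, ih]
    have hd : ∀ J ∈ (Finset.univ : Finset (Fin k → Fin n)), HasFDerivAt (fun y => (∏ i, z (J i)) *
        dirDeriv ((List.ofFn J).map fun i => EuclideanSpace.single i (1 : ℝ)) w y) _ y :=
      fun J _ => (((contDiff_dirDeriv_infty _ hw).differentiable (by simp) y).hasFDerivAt).const_mul _
    simp only [(HasFDerivAt.fun_sum hd).fderiv]
    rw [← (Fin.consEquiv fun _ => Fin n).sum_comp, Fintype.sum_prod_type, Finset.sum_comm,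
      sum_apply]
    refine Finset.sum_congr rfl fun J _ => ?_
    have hz : z = ∑ i, z i • EuclideanSpace.single i (1 : ℝ) := by
      ext j
      simp [Pi.single_apply]
    have key : ∀ A : EuclideanSpace ℝ (Fin n) →L[ℝ] ℝ,
        A z = ∑ i, z i * A (EuclideanSpace.single i 1) := fun A => by
      conv_lhs => rw [hz]
      simp
    rw [smul_apply, key, smul_eq_mul, Finset.mul_sum]
    refine Finset.sum_congr rfl fun i _ => ?_
    change _ = (∏ i', z ((Fin.cons i J : Fin (k + 1) → Fin n) i')) *
      dirDeriv ((List.ofFn (Fin.cons i J : Fin (k + 1) → Fin n)).map _) w y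
    rw [Fin.prod_univ_succ, List.ofFn_cons, List.map_cons, dirDeriv_cons]
    simp only [Fin.cons_zero, Fin.cons_succ]
    ring

/-- Expanding `z` in coordinates leaves only partial derivatives `∂^α` with `|α| = k`, which are the
ones that weak derivatives control. -/
theorem enorm_dirDeriv_replicate_le {w : EuclideanSpace ℝ (Fin n) → ℝ}
    (hw : ContDiff ℝ (⊤ : ℕ∞) w) (z : EuclideanSpace ℝ (Fin n)) (k : ℕ)
    (y : EuclideanSpace ℝ (Fin n)) :
    ‖dirDeriv (List.replicate k z) w y‖ₑ ≤ ‖z‖ₑ ^ k * ∑ J : Fin k → Fin n,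
      ‖dirDeriv (dirList (countIndex (List.ofFn J))) w y‖ₑ := by
  rw [dirDeriv_replicate_eq_sum hw, Finset.mul_sum]
  refine (enorm_sum_le _ _).trans (Finset.sum_le_sum fun J _ => ?_)
  have hp := dirDeriv_perm isOpen_univ (perm_dirList_countIndex (List.ofFn J))
    (N := k) ((hw.of_le (by exact_mod_cast le_top)).contDiffOn) (by simp) (mem_univ y)
  rw [← hp, enorm_mul]
  gcongr
  rw [← ofReal_norm, ← ofReal_norm, ← ENNReal.ofReal_pow (norm_nonneg _), norm_prod]
  refine ENNReal.ofReal_le_ofReal ?_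
  refine (Finset.prod_le_prod (fun _ _ => norm_nonneg _)
    (fun i _ => PiLp.norm_apply_le z (J i))).trans ?_
  simp

end Rays

/-! ### Mollification -/

section Mollify

variable {n : ℕ}

/-- The mollification of `g` by the normalised bump function `ρ`. -/
def mollify (ρ : ContDiffBump (0 : EuclideanSpace ℝ (Fin n))) (g : EuclideanSpace ℝ (Fin n) → ℝ) :
    EuclideanSpace ℝ (Fin n) → ℝ :=
  convolution (ρ.normed volume) g (ContinuousLinearMap.lsmul ℝ ℝ) volume

theorem contDiff_mollify (ρ : ContDiffBump (0 : EuclideanSpace ℝ (Fin n)))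
    {g : EuclideanSpace ℝ (Fin n) → ℝ} (hg : LocallyIntegrable g) :
    ContDiff ℝ (⊤ : ℕ∞) (mollify ρ g) :=
  HasCompactSupport.contDiff_convolution_left _ ρ.hasCompactSupport_normed ρ.contDiff_normed hg

theorem dirDeriv_convolution {f g : EuclideanSpace ℝ (Fin n) → ℝ} (hg : LocallyIntegrable g)
    (hf : ContDiff ℝ (⊤ : ℕ∞) f) (hc : HasCompactSupport f)
    (l : List (EuclideanSpace ℝ (Fin n))) :
    dirDeriv l (convolution f g (ContinuousLinearMap.lsmul ℝ ℝ) volume) =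
      convolution (dirDeriv l f) g (ContinuousLinearMap.lsmul ℝ ℝ) volume := by
  induction l with
  | nil => rfl
  | cons v l ih =>
    have hf' := contDiff_dirDeriv_infty l hf
    have hc' : HasCompactSupport (dirDeriv l f) :=
      hc.mono' (subset_closure.trans (tsupport_dirDeriv_subset l f))
    ext x
    rw [dirDeriv_cons, ih, dirDeriv_cons]
    beta_reduce
    rw [(hc'.hasFDerivAt_convolution_left (ContinuousLinearMap.lsmul ℝ ℝ)
      (hf'.of_le (by simp)) hg x).fderiv]
    have hi := (hc'.fderiv (𝕜 := ℝ)).convolutionExists_left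
      (ContinuousLinearMap.precompL (EuclideanSpace ℝ (Fin n)) (ContinuousLinearMap.lsmul ℝ ℝ))
      (hf'.continuous_fderiv (by simp)) hg x
    rw [convolution, ContinuousLinearMap.integral_apply hi]
    rfl

theorem dirDeriv_comp_const_sub {f : EuclideanSpace ℝ (Fin n) → ℝ}
    (hf : ContDiff ℝ (⊤ : ℕ∞) f) (y : EuclideanSpace ℝ (Fin n))
    (l : List (EuclideanSpace ℝ (Fin n))) :
    dirDeriv l (fun t => f (y - t)) = fun t => (-1) ^ l.length * dirDeriv l f (y - t) := by
  induction l with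
  | nil => simp
  | cons v l ih =>
    ext t
    rw [dirDeriv_cons, ih]
    have h1 : HasFDerivAt (fun t => y - t) (-ContinuousLinearMap.id ℝ (EuclideanSpace ℝ (Fin n))) t :=
      (hasFDerivAt_id t).const_sub y
    have h2 := ((contDiff_dirDeriv_infty l hf).differentiable (by simp) (y - t)).hasFDerivAt
    have h3 := (h2.comp t h1).const_mul ((-1 : ℝ) ^ l.length)
    have h4 : fderiv ℝ (fun t => (-1 : ℝ) ^ l.length * dirDeriv l f (y - t)) t = _ := h3.fderiv
    beta_reduce
    rw [h4, List.length_cons, pow_succ, dirDeriv_cons]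
    simp

/-- The reflected bump `t ↦ ρ (y - t)` is an admissible test function when its support ball lies in
the interior. The sign from the reflection cancels the sign in the weak derivative. -/
theorem dirDeriv_mollify_of_isWeakDeriv {Ω : Set (EuclideanSpace ℝ (Fin n))} {α : Fin n → ℕ}
    {u v : EuclideanSpace ℝ (Fin n) → ℝ} (h : IsWeakDeriv Ω α u v)
    (hu : LocallyIntegrable ((interior Ω).indicator u))
    (ρ : ContDiffBump (0 : EuclideanSpace ℝ (Fin n))) {y : EuclideanSpace ℝ (Fin n)}
    (hy : Metric.closedBall y ρ.rOut ⊆ interior Ω) :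
    dirDeriv (dirList α) (mollify ρ ((interior Ω).indicator u)) y =
      mollify ρ ((interior Ω).indicator v) y := by
  have hρ : ContDiff ℝ (⊤ : ℕ∞) (ρ.normed volume) := ρ.contDiff_normed
  have hη : ContDiff ℝ (⊤ : ℕ∞) fun t => ρ.normed volume (y - t) :=
    hρ.comp (contDiff_const.sub contDiff_id)
  have hηs : tsupport (fun t => ρ.normed volume (y - t)) ⊆ Metric.closedBall y ρ.rOut := by
    refine closure_minimal ?_ Metric.isClosed_closedBall
    intro t ht
    have : y - t ∈ Function.support (ρ.normed volume) := ht
    rw [ρ.support_normed_eq, mem_ball_zero_iff] at this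
    rw [Metric.mem_closedBall, dist_comm, dist_eq_norm]
    exact this.le
  have hηc : HasCompactSupport fun t => ρ.normed volume (y - t) :=
    (isCompact_closedBall y ρ.rOut).of_isClosed_subset (isClosed_tsupport _) hηs
  have key := h _ hη hηc (hηs.trans hy)
  rw [mollify, dirDeriv_convolution hu hρ ρ.hasCompactSupport_normed, convolution_eq_swap,
    mollify, convolution_eq_swap]
  have e1 : ∀ x ∈ interior Ω, u x * multiDeriv univ α (fun t => ρ.normed volume (y - t)) x =
      (-1) ^ (∑ i, α i) * (dirDeriv (dirList α) (ρ.normed volume) (y - x) * u x) := by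
    intro x _
    rw [multiDeriv_eqOn isOpen_univ subset_rfl _ _ (mem_univ x), dirDeriv_comp_const_sub hρ,
      length_dirList]
    ring
  rw [setIntegral_congr_fun isOpen_interior.measurableSet e1, integral_const_mul] at key
  have key' := mul_left_cancel₀ (pow_ne_zero _ (by norm_num : (-1 : ℝ) ≠ 0)) key
  have e2 : ∀ (a b : EuclideanSpace ℝ (Fin n) → ℝ),
      ∫ t, (ContinuousLinearMap.lsmul ℝ ℝ (a t)) ((interior Ω).indicator b t) =
        ∫ t in interior Ω, a t * b t := by
    intro a b
    rw [← integral_indicator isOpen_interior.measurableSet]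
    refine integral_congr_ae (Filter.Eventually.of_forall fun t => ?_)
    by_cases ht : t ∈ interior Ω <;> simp [ht]
  rw [e2, e2, key']
  simp only [mul_comm]

theorem enorm_mollify_le (ρ : ContDiffBump (0 : EuclideanSpace ℝ (Fin n)))
    (g : EuclideanSpace ℝ (Fin n) → ℝ) (y : EuclideanSpace ℝ (Fin n)) :
    ‖mollify ρ g y‖ₑ ≤ ∫⁻ t, ‖ρ.normed volume t‖ₑ * ‖g (y - t)‖ₑ := by
  refine (enorm_integral_le_lintegral_enorm _).trans (le_of_eq (lintegral_congr fun t => ?_))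
  simp [enorm_mul]

theorem lintegral_enorm_normed (ρ : ContDiffBump (0 : EuclideanSpace ℝ (Fin n))) :
    ∫⁻ t, ‖ρ.normed volume t‖ₑ = 1 := by
  have h1 : ∀ t, ‖ρ.normed volume t‖ₑ = ENNReal.ofReal (ρ.normed volume t) := fun t => by
    rw [← ofReal_norm, Real.norm_of_nonneg (ρ.nonneg_normed t)]
  simp only [h1]
  rw [← ofReal_integral_eq_lintegral_ofReal ρ.integrable_normed
    (Filter.Eventually.of_forall fun t => ρ.nonneg_normed t), ρ.integral_normed,
    ENNReal.ofReal_one]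

/-- A mollification is an average of translates, so a bound that is uniform in the translation `c`
is inherited. -/
theorem setLIntegral_enorm_mollify_le (ρ : ContDiffBump (0 : EuclideanSpace ℝ (Fin n)))
    {g : EuclideanSpace ℝ (Fin n) → ℝ} (hg : Measurable g) {B : ℝ≥0∞} (s : ℝ)
    {S : Set (EuclideanSpace ℝ (Fin n))} (x : EuclideanSpace ℝ (Fin n))
    (hB : ∀ c, ∫⁻ z in S, ‖g (c + s • z)‖ₑ ≤ B) :
    ∫⁻ z in S, ‖mollify ρ g (x + s • z)‖ₑ ≤ B := by
  have hm : Measurable fun q : EuclideanSpace ℝ (Fin n) × EuclideanSpace ℝ (Fin n) =>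
      ‖ρ.normed volume q.2‖ₑ * ‖g (x + s • q.1 - q.2)‖ₑ := by
    have h1 : Measurable (ρ.normed volume) := ρ.continuous_normed.measurable
    exact (h1.comp measurable_snd).enorm.mul (hg.comp (by fun_prop)).enorm
  calc ∫⁻ z in S, ‖mollify ρ g (x + s • z)‖ₑ
      ≤ ∫⁻ z in S, ∫⁻ t, ‖ρ.normed volume t‖ₑ * ‖g (x + s • z - t)‖ₑ :=
        lintegral_mono fun z => enorm_mollify_le ρ g _
    _ = ∫⁻ t, ∫⁻ z in S, ‖ρ.normed volume t‖ₑ * ‖g (x + s • z - t)‖ₑ :=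
        lintegral_lintegral_swap hm.aemeasurable
    _ ≤ ∫⁻ t, ‖ρ.normed volume t‖ₑ * B := by
        refine lintegral_mono fun t => ?_
        rw [lintegral_const_mul' _ _ enorm_ne_top]
        refine mul_le_mul_right ?_ _
        refine le_trans (le_of_eq (lintegral_congr fun z => ?_)) (hB (x - t))
        rw [sub_add_eq_add_sub]
    _ = B := by
        rw [lintegral_mul_const _ ρ.continuous_normed.measurable.enorm, lintegral_enorm_normed,
          one_mul]

/-- Hölder's inequality on `S` and the change of variables `z ↦ c + s • z`, whose Jacobian
contributes `s ^ (-n/p)`. -/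
theorem setLIntegral_enorm_comp_affine_le {g : EuclideanSpace ℝ (Fin n) → ℝ} (hg : Measurable g)
    {p : ℝ≥0∞} (hp : 1 ≤ p) {s : ℝ} (hs : 0 < s) (S : Set (EuclideanSpace ℝ (Fin n)))
    (c : EuclideanSpace ℝ (Fin n)) :
    ∫⁻ z in S, ‖g (c + s • z)‖ₑ ≤
      ENNReal.ofReal (s ^ (-(n * (p⁻¹).toReal))) * eLpNorm g p volume *
        volume S ^ (1 - (p⁻¹).toReal) := by
  have hmeas : Measurable fun z : EuclideanSpace ℝ (Fin n) => c + s • z := by fun_prop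
  have hmap : Measure.map (fun z : EuclideanSpace ℝ (Fin n) => c + s • z) volume =
      ENNReal.ofReal ((s ^ n)⁻¹) • volume := by
    have h1 : (fun z : EuclideanSpace ℝ (Fin n) => c + s • z) = (fun z => c + z) ∘ fun z => s • z :=
      rfl
    rw [h1, ← Measure.map_map (by fun_prop) (by fun_prop), Measure.map_addHaar_smul _ hs.ne',
      Measure.map_smul, map_add_left_eq_self, finrank_euclideanSpace_fin,
      abs_of_pos (by positivity)]
  have h2 := eLpNorm_le_eLpNorm_mul_rpow_measure_univ (μ := volume.restrict S) hp
    (hg.comp hmeas).aestronglyMeasurable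
  rw [eLpNorm_one_eq_lintegral_enorm, Measure.restrict_apply_univ] at h2
  refine h2.trans ?_
  have h3 : eLpNorm (g ∘ fun z => c + s • z) p (volume.restrict S) ≤
      ENNReal.ofReal (s ^ (-(n * (p⁻¹).toReal))) * eLpNorm g p volume := by
    refine (eLpNorm_mono_measure _ Measure.restrict_le_self).trans (le_of_eq ?_)
    rw [← eLpNorm_map_measure hg.aestronglyMeasurable hmeas.aemeasurable, hmap,
      eLpNorm_smul_measure_of_ne_zero (ENNReal.ofReal_pos.2 (by positivity)).ne', smul_eq_mul,
      one_div, ENNReal.ofReal_rpow_of_pos (by positivity), ← Real.rpow_natCast, ← Real.rpow_neg hs.le,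
      ← Real.rpow_mul hs.le, neg_mul]
  refine mul_le_mul' h3 (le_of_eq ?_)
  simp [ENNReal.toReal_inv]

/-- Pointwise interpolation bound for mollified Sobolev functions on a cone. -/
theorem exists_enorm_mollify_le {m : ℕ} (hm : 0 < m) {p : ℝ≥0∞} (hp : 1 ≤ p)
    (hpn : (n : ℝ) * (p⁻¹).toReal < m) {κ : ℝ} (hκ : 0 < κ) (hκ1 : κ ≤ 1) :
    ∃ C : ℝ≥0∞, C ≠ ∞ ∧ ∀ (Ω : Set (EuclideanSpace ℝ (Fin n)))
      (u : EuclideanSpace ℝ (Fin n) → ℝ) (v : (Fin n → ℕ) → EuclideanSpace ℝ (Fin n) → ℝ)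
      (V : ℝ≥0∞) (ρ : ContDiffBump (0 : EuclideanSpace ℝ (Fin n)))
      (x ν : EuclideanSpace ℝ (Fin n)) (r : ℝ), Measurable u → (∀ α, Measurable (v α)) →
      Integrable ((interior Ω).indicator u) →
      (∀ α ∈ multiIndices n m, IsWeakDeriv Ω α u (v α)) →
      (∀ α ∈ multiIndices n m, eLpNorm (v α) p (volume.restrict (interior Ω)) ≤ V) →
      0 < r → ‖ν‖ ≤ 1 →
      (∀ s ∈ Ioc 0 (m : ℝ), ∀ z ∈ Metric.closedBall (r • ν) (r * κ),
        Metric.closedBall (x + s • z) ρ.rOut ⊆ interior Ω) →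
      ‖mollify ρ ((interior Ω).indicator u) x‖ₑ ≤
        C * (ENNReal.ofReal (r ^ (-(n : ℝ))) * eLpNorm u 1 (volume.restrict (interior Ω)) +
          ENNReal.ofReal (r ^ ((m : ℝ) - n * (p⁻¹).toReal)) * V) := by
  set q : ℝ := (p⁻¹).toReal with hq
  have hq1 : q ≤ 1 := by
    rw [hq]
    exact ENNReal.toReal_le_of_le_ofReal zero_le_one (by simpa using hp)
  -- Finite because `n/p < m` puts the exponent above `-1`.
  set I : ℝ≥0∞ := ∫⁻ s in Ioc 0 (m : ℝ), ENNReal.ofReal (s ^ ((m : ℝ) - 1 - n * q)) with hI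
  have hIfin : I ≠ ∞ := by
    have h1 := (intervalIntegral.intervalIntegrable_rpow' (a := 0) (b := m)
      (r := (m : ℝ) - 1 - n * q) (by linarith)).1
    refine ne_of_lt (lt_of_le_of_lt (lintegral_mono fun s => ?_) h1.2)
    rw [← ofReal_norm]
    exact ENNReal.ofReal_le_ofReal (le_abs_self _)
  set k₀ : ℝ≥0∞ := ENNReal.ofReal (κ ^ n) *
    volume (Metric.ball (0 : EuclideanSpace ℝ (Fin n)) 1) with hk₀
  have hk0 : k₀ ≠ 0 := mul_ne_zero (ENNReal.ofReal_pos.2 (by positivity)).ne'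
    (Metric.measure_ball_pos _ _ one_pos).ne'
  have hkt : k₀ ≠ ∞ := ENNReal.mul_ne_top ENNReal.ofReal_ne_top measure_ball_lt_top.ne
  set b : ℝ≥0∞ := ∑ j ∈ Finset.Icc 1 m, (m.choose j : ℝ≥0∞) with hb
  set N : ℝ≥0∞ := (Fintype.card (Fin m → Fin n) : ℝ≥0∞) with hN
  have hkq : k₀ ^ (-q) ≠ ∞ := ENNReal.rpow_ne_top_of_ne_zero hk0 hkt
  -- The first summand comes from the values at `x + j • z`, the second from the derivatives. `k₀`
  -- is the volume of a ball of radius `κ`, `2 ^ m` comes from `‖z‖ ≤ 2 * r`, and `N` counts the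
  -- coordinate lists of length `m`.
  refine ⟨b * k₀⁻¹ + ENNReal.ofReal (2 ^ m) * N * I * k₀ ^ (-q), ?_, ?_⟩
  · refine ENNReal.add_ne_top.2 ⟨ENNReal.mul_ne_top ?_ (ENNReal.inv_ne_top.2 hk0),
      ENNReal.mul_ne_top (ENNReal.mul_ne_top (ENNReal.mul_ne_top ENNReal.ofReal_ne_top ?_) hIfin)
        hkq⟩
    · exact ENNReal.sum_ne_top.2 fun _ _ => ENNReal.natCast_ne_top _
    · exact ENNReal.natCast_ne_top _
  intro Ω u v V ρ x ν r hu hv hint hweak hV hr hν hcone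
  have hU : MeasurableSet (interior Ω) := isOpen_interior.measurableSet
  set w := mollify ρ ((interior Ω).indicator u) with hw
  have hws : ContDiff ℝ (⊤ : ℕ∞) w := contDiff_mollify ρ hint.locallyIntegrable
  set S := Metric.closedBall (r • ν) (r * κ) with hS
  have hSm : MeasurableSet S := Metric.isClosed_closedBall.measurableSet
  have hSvol : volume S = ENNReal.ofReal (r ^ (n : ℝ)) * k₀ := by
    rw [hS, Measure.addHaar_closedBall _ _ (by positivity), finrank_euclideanSpace_fin, mul_pow,
      ENNReal.ofReal_mul (by positivity), mul_assoc, Real.rpow_natCast]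
  have hrn : ENNReal.ofReal (r ^ (n : ℝ)) ≠ 0 := (ENNReal.ofReal_pos.2 (by positivity)).ne'
  have hS0 : volume S ≠ 0 := by rw [hSvol]; exact mul_ne_zero hrn hk0
  have hSt : volume S ≠ ∞ := by rw [hSvol]; exact ENNReal.mul_ne_top ENNReal.ofReal_ne_top hkt
  set U1 := eLpNorm u 1 (volume.restrict (interior Ω)) with hU1
  have hz : ∀ z ∈ S, ‖z‖ ≤ 2 * r := by
    intro z hz
    rw [hS, mem_closedBall_iff_norm] at hz
    have h1 : ‖r • ν‖ ≤ r := by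
      rw [norm_smul, Real.norm_of_nonneg hr.le]; nlinarith
    calc ‖z‖ = ‖(z - r • ν) + r • ν‖ := by simp
      _ ≤ ‖z - r • ν‖ + ‖r • ν‖ := norm_add_le _ _
      _ ≤ 2 * r := by nlinarith
  set D : (Fin m → Fin n) → EuclideanSpace ℝ (Fin n) → ℝ := fun J =>
    dirDeriv (dirList (countIndex (List.ofFn J))) w with hD
  have hDc : ∀ J, Continuous (D J) := fun J => (contDiff_dirDeriv_infty _ hws).continuous
  -- The one-dimensional estimate on the ray from `x` in the direction `z`. Integrating it over `z ∈
  -- S` turns point values of `w` and its derivatives into norms.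
  have hpt : ∀ z ∈ S, ‖w x‖ₑ ≤ ∑ j ∈ Finset.Icc 1 m, (m.choose j : ℝ≥0∞) * ‖w (x + (j : ℝ) • z)‖ₑ +
      ∫⁻ s in Ioc 0 (m : ℝ), ENNReal.ofReal (s ^ (m - 1)) * (ENNReal.ofReal ((2 * r) ^ m) *
        ∑ J, ‖D J (x + s • z)‖ₑ) := by
    intro z hzS
    have h1 := enorm_le_sum_add_lintegral hm (f := fun s : ℝ => w (x + s • z))
      (hws.comp (contDiff_const.add (contDiff_id.smul contDiff_const)))
    rw [iteratedDeriv_comp_ray hws] at h1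
    simp only [zero_smul, add_zero] at h1
    refine h1.trans (add_le_add le_rfl (lintegral_mono fun s => ?_))
    refine mul_le_mul_right ((enorm_dirDeriv_replicate_le hws z m _).trans ?_) _
    refine mul_le_mul_left ?_ _
    rw [← ofReal_norm, ← ENNReal.ofReal_pow (norm_nonneg _)]
    exact ENNReal.ofReal_le_ofReal (pow_le_pow_left₀ (norm_nonneg _) (hz z hzS) m)
  -- Since `j ≥ 1`, the dilation by `j` does not increase the `L₁` norm.
  have hfirst : ∀ j ∈ Finset.Icc 1 m, ∫⁻ z in S, ‖w (x + (j : ℝ) • z)‖ₑ ≤ U1 := by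
    intro j hj
    have hj1 : (1 : ℝ) ≤ j := by exact_mod_cast (Finset.mem_Icc.1 hj).1
    refine setLIntegral_enorm_mollify_le ρ (hu.indicator hU) j x fun c => ?_
    refine (setLIntegral_enorm_comp_affine_le (hu.indicator hU) le_rfl (by linarith) S c).trans ?_
    rw [inv_one, ENNReal.toReal_one, sub_self, ENNReal.rpow_zero, mul_one,
      eLpNorm_indicator_eq_eLpNorm_restrict hU]
    refine mul_le_of_le_one_left zero_le ?_
    rw [ENNReal.ofReal_le_one]
    exact Real.rpow_le_one_of_one_le_of_nonpos hj1 (by simp)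
  have hsecond : ∀ s ∈ Ioc 0 (m : ℝ), ∀ J, ∫⁻ z in S, ‖D J (x + s • z)‖ₑ ≤
      ENNReal.ofReal (s ^ (-(n * q))) * V * volume S ^ (1 - q) := by
    intro s hs J
    have hα : countIndex (List.ofFn J) ∈ multiIndices n m := by
      simpa using countIndex_mem_multiIndices (List.ofFn J)
    have h1 : ∫⁻ z in S, ‖D J (x + s • z)‖ₑ =
        ∫⁻ z in S, ‖mollify ρ ((interior Ω).indicator (v (countIndex (List.ofFn J))))
          (x + s • z)‖ₑ := by
      refine setLIntegral_congr_fun hSm fun z hzS => ?_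
      simp only [hD]
      rw [dirDeriv_mollify_of_isWeakDeriv (hweak _ hα) hint.locallyIntegrable ρ (hcone s hs z hzS)]
    rw [h1]
    refine setLIntegral_enorm_mollify_le ρ ((hv _).indicator hU) s x fun c => ?_
    refine (setLIntegral_enorm_comp_affine_le ((hv _).indicator hU) hp hs.1 S c).trans ?_
    rw [eLpNorm_indicator_eq_eLpNorm_restrict hU]
    exact mul_le_mul_left (mul_le_mul_right (hV _ hα) _) _
  have hmain : volume S * ‖w x‖ₑ ≤ b * U1 +
      ENNReal.ofReal ((2 * r) ^ m) * N * I * V * volume S ^ (1 - q) := by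
    have hmeas : Measurable fun a : EuclideanSpace ℝ (Fin n) × ℝ =>
        ENNReal.ofReal (a.2 ^ (m - 1)) * (ENNReal.ofReal ((2 * r) ^ m) *
          ∑ J, ‖D J (x + a.2 • a.1)‖ₑ) := by
      refine Measurable.mul (by fun_prop) (Measurable.const_mul ?_ _)
      refine Finset.measurable_sum _ fun J _ => Measurable.enorm ?_
      exact ((hDc J).comp (by fun_prop)).measurable
    calc volume S * ‖w x‖ₑ = ∫⁻ z in S, ‖w x‖ₑ := by rw [setLIntegral_const, mul_comm]
      _ ≤ ∫⁻ z in S, (∑ j ∈ Finset.Icc 1 m, (m.choose j : ℝ≥0∞) * ‖w (x + (j : ℝ) • z)‖ₑ +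
            ∫⁻ s in Ioc 0 (m : ℝ), ENNReal.ofReal (s ^ (m - 1)) *
              (ENNReal.ofReal ((2 * r) ^ m) * ∑ J, ‖D J (x + s • z)‖ₑ)) :=
          setLIntegral_mono' hSm hpt
      _ = (∑ j ∈ Finset.Icc 1 m, (m.choose j : ℝ≥0∞) * (∫⁻ z in S, ‖w (x + (j : ℝ) • z)‖ₑ)) +
            ∫⁻ s in Ioc 0 (m : ℝ), ENNReal.ofReal (s ^ (m - 1)) *
              (ENNReal.ofReal ((2 * r) ^ m) * ∑ J, ∫⁻ z in S, ‖D J (x + s • z)‖ₑ) := by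
          have hwm : ∀ j : ℕ, Measurable fun z => ‖w (x + (j : ℝ) • z)‖ₑ := fun j =>
            (hws.continuous.comp (by fun_prop)).measurable.enorm
          have hDm : ∀ (s : ℝ) J, Measurable fun z => ‖D J (x + s • z)‖ₑ := fun s J =>
            ((hDc J).comp (by fun_prop)).measurable.enorm
          rw [lintegral_add_left (Finset.measurable_sum _ fun j _ => (hwm j).const_mul _),
            lintegral_finsetSum _ fun j _ => (hwm j).const_mul _]
          congr 1
          · exact Finset.sum_congr rfl fun j _ => lintegral_const_mul _ (hwm j)
          · rw [lintegral_lintegral_swap hmeas.aemeasurable]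
            refine lintegral_congr fun s => ?_
            rw [lintegral_const_mul' _ _ ENNReal.ofReal_ne_top,
              lintegral_const_mul' _ _ ENNReal.ofReal_ne_top,
              lintegral_finsetSum _ fun J _ => hDm s J]
      _ ≤ ∑ j ∈ Finset.Icc 1 m, (m.choose j : ℝ≥0∞) * U1 +
            ∫⁻ s in Ioc 0 (m : ℝ), ENNReal.ofReal (s ^ ((m : ℝ) - 1 - n * q)) *
              (ENNReal.ofReal ((2 * r) ^ m) * N * V * volume S ^ (1 - q)) := by
          refine add_le_add (Finset.sum_le_sum fun j hj => mul_le_mul_right (hfirst j hj) _) ?_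
          refine setLIntegral_mono' measurableSet_Ioc fun s hs => ?_
          have h1 : ∑ J, ∫⁻ z in S, ‖D J (x + s • z)‖ₑ ≤
              N * (ENNReal.ofReal (s ^ (-(n * q))) * V * volume S ^ (1 - q)) := by
            refine (Finset.sum_le_sum fun J _ => hsecond s hs J).trans (le_of_eq ?_)
            rw [Finset.sum_const, nsmul_eq_mul, hN, Finset.card_univ]
          have h2 : ENNReal.ofReal (s ^ ((m : ℝ) - 1 - n * q)) =
              ENNReal.ofReal (s ^ (m - 1)) * ENNReal.ofReal (s ^ (-(n * q))) := by
            rw [← ENNReal.ofReal_mul (by have := hs.1; positivity), ← Real.rpow_natCast,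
              ← Real.rpow_add hs.1, Nat.cast_sub hm, Nat.cast_one, sub_eq_add_neg _ ((n : ℝ) * q)]
          rw [h2]
          calc _ ≤ ENNReal.ofReal (s ^ (m - 1)) * (ENNReal.ofReal ((2 * r) ^ m) *
                (N * (ENNReal.ofReal (s ^ (-(n * q))) * V * volume S ^ (1 - q)))) := by gcongr
            _ = _ := by ring
      _ = _ := by
          rw [lintegral_mul_const _ (by fun_prop), ← Finset.sum_mul]
          ring
  have hdiv : ‖w x‖ₑ ≤ (volume S)⁻¹ * (b * U1 +
      ENNReal.ofReal ((2 * r) ^ m) * N * I * V * volume S ^ (1 - q)) := by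
    rw [← ENNReal.mul_le_iff_le_inv hS0 hSt]
    exact hmain
  refine hdiv.trans ?_
  have e1 : (volume S)⁻¹ = ENNReal.ofReal (r ^ (-(n : ℝ))) * k₀⁻¹ := by
    rw [hSvol, ENNReal.mul_inv (Or.inl hrn) (Or.inr hk0), ← ENNReal.ofReal_inv_of_pos (by positivity),
      Real.rpow_neg hr.le]
  have e2 : (volume S)⁻¹ * volume S ^ (1 - q) = ENNReal.ofReal (r ^ (-(n * q))) * k₀ ^ (-q) := by
    rw [← ENNReal.rpow_neg_one, ← ENNReal.rpow_add _ _ hS0 hSt, hSvol,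
      show -1 + (1 - q) = -q by ring,
      ENNReal.mul_rpow_of_ne_top ENNReal.ofReal_ne_top hkt, ENNReal.ofReal_rpow_of_pos (by positivity),
      ← Real.rpow_mul hr.le, mul_neg]
  have e3 : ENNReal.ofReal ((2 * r) ^ m) * ENNReal.ofReal (r ^ (-(n * q))) =
      ENNReal.ofReal (2 ^ m) * ENNReal.ofReal (r ^ ((m : ℝ) - n * q)) := by
    rw [mul_pow, ENNReal.ofReal_mul (by positivity), mul_assoc, ← ENNReal.ofReal_mul (by positivity),
      ← Real.rpow_natCast r, ← Real.rpow_add hr, sub_eq_add_neg]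
  calc (volume S)⁻¹ * (b * U1 + ENNReal.ofReal ((2 * r) ^ m) * N * I * V * volume S ^ (1 - q))
      = (volume S)⁻¹ * (b * U1) + ENNReal.ofReal ((2 * r) ^ m) * N * I * V *
          ((volume S)⁻¹ * volume S ^ (1 - q)) := by ring
    _ = b * k₀⁻¹ * (ENNReal.ofReal (r ^ (-(n : ℝ))) * U1) +
          (ENNReal.ofReal ((2 * r) ^ m) * ENNReal.ofReal (r ^ (-(n * q)))) * N * I * V *
            k₀ ^ (-q) := by rw [e2, e1]; ring
    _ = b * k₀⁻¹ * (ENNReal.ofReal (r ^ (-(n : ℝ))) * U1) +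
          (ENNReal.ofReal (2 ^ m) * N * I * k₀ ^ (-q)) *
            (ENNReal.ofReal (r ^ ((m : ℝ) - n * q)) * V) := by rw [e3]; ring
    _ ≤ _ := by
        rw [mul_add]
        refine add_le_add ?_ ?_
        · exact mul_le_mul_left le_self_add _
        · exact mul_le_mul_left le_add_self _

end Mollify

/-! ### The Gagliardo–Nirenberg inequality -/

section GagliardoNirenberg

variable {n m : ℕ}

theorem mul_toReal_inv_lt (hn : 0 < n) (hm : 0 < m) {p : ℝ≥0∞} (hpn : (n : ℝ≥0∞) / m < p) :
    (n : ℝ) * (p⁻¹).toReal < m := by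
  have hn0 : (n : ℝ≥0∞) ≠ 0 := by exact_mod_cast hn.ne'
  have hm0 : (m : ℝ≥0∞) ≠ 0 := by exact_mod_cast hm.ne'
  rw [ENNReal.div_lt_iff (Or.inl hm0) (Or.inl (ENNReal.natCast_ne_top m)), mul_comm,
    ← ENNReal.div_lt_iff (Or.inr hn0) (Or.inr (ENNReal.natCast_ne_top n)), div_eq_mul_inv] at hpn
  have h := (ENNReal.toReal_lt_toReal (hpn.trans (ENNReal.natCast_lt_top m)).ne
    (ENNReal.natCast_ne_top m)).2 hpn
  simpa using h

/-- With `a = n` and `b = m - n/p` this is `a / (a + b)`, the exponent that comes out of balancing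
`r ^ (-a)` against `r ^ b`. -/
theorem gnTheta_eq (hn : 0 < n) (p : ℝ≥0∞) :
    gnTheta n m p = n / (n + ((m : ℝ) - n * (p⁻¹).toReal)) := by
  have : (n : ℝ) ≠ 0 := by exact_mod_cast hn.ne'
  rw [gnTheta, show 1 + (m : ℝ) / n - (p⁻¹).toReal = (n + ((m : ℝ) - n * (p⁻¹).toReal)) / n by
    field_simp; ring, inv_div]

theorem gnTheta_mem_Ioo (hn : 0 < n) (hm : 0 < m) {p : ℝ≥0∞} (hpn : (n : ℝ≥0∞) / m < p) :
    gnTheta n m p ∈ Ioo (0 : ℝ) 1 := by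
  have h := mul_toReal_inv_lt hn hm hpn
  have hn' : (0 : ℝ) < n := by exact_mod_cast hn
  rw [gnTheta_eq hn]
  constructor
  · apply div_pos hn'; linarith
  · rw [div_lt_one] <;> linarith

/-- Optimising a two-term bound over the length scale. -/
theorem le_of_forall_scale_le {X C A B : ℝ≥0∞} {a b R : ℝ} (ha : 0 < a) (hb : 0 < b) (hR : 0 < R)
    (hA0 : A ≠ 0) (hAt : A ≠ ∞) (hBt : B ≠ ∞)
    (h : ∀ r ∈ Ioc 0 R, X ≤ C * (ENNReal.ofReal (r ^ (-a)) * A + ENNReal.ofReal (r ^ b) * B)) :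
    X ≤ C * (2 + 2 * ENNReal.ofReal (R ^ (-a))) *
      (A ^ (1 - a / (a + b)) * B ^ (a / (a + b)) + A) := by
  -- If the balancing scale is not below `R`, then `r = R` is used, and the `B` term is dominated by
  -- the `A` term there.
  by_cases hcase : ENNReal.ofReal (R ^ (a + b)) * B ≤ A
  · have e : ENNReal.ofReal (R ^ b) * B ≤ ENNReal.ofReal (R ^ (-a)) * A := by
      have : ENNReal.ofReal (R ^ b) = ENNReal.ofReal (R ^ (-a)) * ENNReal.ofReal (R ^ (a + b)) := by
        rw [← ENNReal.ofReal_mul (by positivity), ← Real.rpow_add hR]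
        congr 2; ring
      rw [this, mul_assoc]
      gcongr
    calc X ≤ C * (ENNReal.ofReal (R ^ (-a)) * A + ENNReal.ofReal (R ^ b) * B) :=
          h R ⟨hR, le_rfl⟩
      _ ≤ C * (ENNReal.ofReal (R ^ (-a)) * A + ENNReal.ofReal (R ^ (-a)) * A) := by gcongr
      _ = C * (2 * ENNReal.ofReal (R ^ (-a))) * A := by ring
      _ ≤ _ := by
          gcongr
          · exact le_add_self
          · exact le_add_self
  · rw [not_le] at hcase
    have hB0 : B ≠ 0 := by
      rintro rfl
      simp at hcase
    set A' := A.toReal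
    set B' := B.toReal
    have hA' : 0 < A' := ENNReal.toReal_pos hA0 hAt
    have hB' : 0 < B' := ENNReal.toReal_pos hB0 hBt
    have hAe : A = ENNReal.ofReal A' := (ENNReal.ofReal_toReal hAt).symm
    have hBe : B = ENNReal.ofReal B' := (ENNReal.ofReal_toReal hBt).symm
    have hlt : A' < R ^ (a + b) * B' := by
      rw [hAe, hBe, ← ENNReal.ofReal_mul (by positivity)] at hcase
      exact (ENNReal.ofReal_lt_ofReal_iff (by positivity)).1 hcase
    have hab : 0 < a + b := by positivity
    -- The scale at which both terms are equal.
    set r := (A' / B') ^ (1 / (a + b)) with hr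
    have hr0 : 0 < r := by positivity
    have hrR : r ≤ R := by
      have h1 : A' / B' ≤ R ^ (a + b) := by rw [div_le_iff₀ hB']; exact hlt.le
      calc r ≤ (R ^ (a + b)) ^ (1 / (a + b)) := Real.rpow_le_rpow (by positivity) h1 (by positivity)
        _ = R := by rw [← Real.rpow_mul hR.le, mul_one_div_cancel hab.ne', Real.rpow_one]
    have e1 : r ^ (-a) * A' = A' ^ (1 - a / (a + b)) * B' ^ (a / (a + b)) := by
      rw [hr, ← Real.rpow_mul (by positivity), Real.div_rpow hA'.le hB'.le,
        show 1 / (a + b) * -a = -(a / (a + b)) by ring, Real.rpow_neg hB'.le, div_inv_eq_mul,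
        Real.rpow_sub hA', Real.rpow_one, Real.rpow_neg hA'.le]
      ring
    have e2 : r ^ b * B' = A' ^ (1 - a / (a + b)) * B' ^ (a / (a + b)) := by
      have e3 : 1 / (a + b) * b = 1 - a / (a + b) := by field_simp; ring
      rw [hr, ← Real.rpow_mul (by positivity), Real.div_rpow hA'.le hB'.le, e3,
        div_mul_eq_mul_div, mul_div_assoc]
      congr 1
      rw [div_eq_iff (by positivity), ← Real.rpow_add hB', add_sub_cancel, Real.rpow_one]
    have h1 := h r ⟨hr0, hrR⟩
    have e4 : A ^ (1 - a / (a + b)) * B ^ (a / (a + b)) =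
        ENNReal.ofReal (A' ^ (1 - a / (a + b)) * B' ^ (a / (a + b))) := by
      rw [hAe, hBe, ENNReal.ofReal_rpow_of_pos hA', ENNReal.ofReal_rpow_of_pos hB',
        ← ENNReal.ofReal_mul (by positivity)]
    have e5 : ENNReal.ofReal (r ^ (-a)) * A = A ^ (1 - a / (a + b)) * B ^ (a / (a + b)) := by
      rw [e4, ← e1, ENNReal.ofReal_mul (by positivity), ← hAe]
    have e6 : ENNReal.ofReal (r ^ b) * B = A ^ (1 - a / (a + b)) * B ^ (a / (a + b)) := by
      rw [e4, ← e2, ENNReal.ofReal_mul (by positivity), ← hBe]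
    rw [e5, e6] at h1
    calc X ≤ _ := h1
      _ = C * 2 * (A ^ (1 - a / (a + b)) * B ^ (a / (a + b))) := by ring
      _ ≤ _ := by
          gcongr
          · exact le_self_add
          · exact le_self_add

variable {Ω : Set (EuclideanSpace ℝ (Fin n))}

theorem IsWeakDeriv.congr_ae {α : Fin n → ℕ} {u v u' v' : EuclideanSpace ℝ (Fin n) → ℝ}
    (h : IsWeakDeriv Ω α u v) (hu : u =ᵐ[volume.restrict (interior Ω)] u')
    (hv : v =ᵐ[volume.restrict (interior Ω)] v') : IsWeakDeriv Ω α u' v' := by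
  intro η h1 h2 h3
  have e1 : ∫ x in interior Ω, u' x * multiDeriv univ α η x =
      ∫ x in interior Ω, u x * multiDeriv univ α η x :=
    integral_congr_ae (hu.mono fun x hx => by simp only [hx])
  have e2 : ∫ x in interior Ω, v' x * η x = ∫ x in interior Ω, v x * η x :=
    integral_congr_ae (hv.mono fun x hx => by simp only [hx])
  rw [e1, e2]
  exact h η h1 h2 h3

/-- The apex is an interior point, so the truncated cone together with its apex is a compact subset
of the interior and has a neighbourhood of some radius `δ` inside it. Mollification at radii below
`δ` then sees only values in `Ω`. -/
theorem exists_closedBall_subset_of_cone {x ν : EuclideanSpace ℝ (Fin n)} {r₀ κ r : ℝ}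
    (hx : x ∈ interior Ω)
    (hcone : ∀ s ∈ Ioc 0 r₀, ∀ z ∈ Metric.closedBall ν κ, x + s • z ∈ interior Ω)
    (hr : 0 < r) (hrm : m * r ≤ r₀) :
    ∃ δ > 0, ∀ s ∈ Ioc 0 (m : ℝ), ∀ z ∈ Metric.closedBall (r • ν) (r * κ),
      Metric.closedBall (x + s • z) δ ⊆ interior Ω := by
  set 𝒦 : Set (EuclideanSpace ℝ (Fin n)) := (fun a : ℝ × EuclideanSpace ℝ (Fin n) => x + a.1 • a.2) ''
    (Icc 0 (m : ℝ) ×ˢ Metric.closedBall (r • ν) (r * κ)) with h𝒦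
  have hc : IsCompact 𝒦 :=
    (isCompact_Icc.prod (isCompact_closedBall _ _)).image (by fun_prop)
  have hsub : 𝒦 ⊆ interior Ω := by
    rintro _ ⟨⟨s, z⟩, ⟨hs, hz⟩, rfl⟩
    rcases hs.1.eq_or_lt with h0 | h0
    · simp only at h0
      simpa [← h0] using hx
    · have hz' : r⁻¹ • z ∈ Metric.closedBall ν κ := by
        rw [mem_closedBall_iff_norm] at hz ⊢
        have : r⁻¹ • z - ν = r⁻¹ • (z - r • ν) := by
          rw [smul_sub, smul_smul, inv_mul_cancel₀ hr.ne', one_smul]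
        rw [this, norm_smul, norm_inv, Real.norm_of_nonneg hr.le, inv_mul_le_iff₀ hr]
        exact hz
      have := hcone (s * r) ⟨mul_pos h0 hr, le_trans (by gcongr; exact hs.2) hrm⟩ _ hz'
      simpa [smul_smul, mul_assoc, hr.ne'] using this
  obtain ⟨δ, hδ, h⟩ := hc.exists_cthickening_subset_open isOpen_interior hsub
  refine ⟨δ, hδ, fun s hs z hz => ?_⟩
  have hmem : x + s • z ∈ 𝒦 := ⟨(s, z), ⟨⟨hs.1.le, hs.2⟩, hz⟩, rfl⟩
  exact (Metric.closedBall_subset_cthickening hmem δ).trans h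

/-- The cone estimate does not depend on the mollification radius, so it passes to the limit at
almost every point, for every scale up to `r₀ / m`; the factor `m` is there because the rays run
over `s ∈ (0, m]`. -/
theorem gnConst_lt_top (hn : 0 < n) (hm : 0 < m) (hΩ : IsCompact Ω)
    (hΩL : HasLipschitzBoundary Ω) {p : ℝ≥0∞} (hp : 1 ≤ p) (hpn : (n : ℝ≥0∞) / m < p) :
    gnConst Ω m p < ∞ := by
  obtain ⟨r₀, hr₀, κ, hκ, hκ1, hcone⟩ := exists_interior_cones hΩ hΩL
  have hnq := mul_toReal_inv_lt hn hm hpn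
  have hm' : (0 : ℝ) < m := by exact_mod_cast hm
  have hn' : (0 : ℝ) < n := by exact_mod_cast hn
  obtain ⟨C, hC, H⟩ := exists_enorm_mollify_le (n := n) hm hp hnq hκ hκ1
  set q := (p⁻¹).toReal
  set R := r₀ / m with hRdef
  have hR : 0 < R := by positivity
  have hCfin : C * (2 + 2 * ENNReal.ofReal (R ^ (-(n : ℝ)))) < ∞ := by finiteness
  refine lt_of_le_of_lt (iSup_le fun u => iSup_le fun v => iSup_le fun hadm => ?_) hCfin
  have hrestr := restrict_interior_eq hΩ hΩL
  have hsup : (multiIndices n m).sup (fun α => eLpNorm (v α) p (volume.restrict Ω)) < ∞ :=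
    (Finset.sup_lt_iff (by simp)).2 fun α hα => (hadm.deriv_memLp α hα).2
  set V := (multiIndices n m).sup fun α => eLpNorm (v α) p (volume.restrict Ω) with hV
  refine ENNReal.div_le_of_le_mul ?_
  rw [gnTheta_eq hn]
  have hu1 := hadm.memL1
  have hvm := hadm.deriv_memLp
  rw [← hrestr] at hu1 hvm
  set u' := hu1.1.mk u with hu'
  have huu' : u =ᵐ[volume.restrict (interior Ω)] u' := hu1.1.ae_eq_mk
  classical
  -- Measurable representatives; the value `0` at the other multi-indices only keeps the whole
  -- family measurable.
  set v' : (Fin n → ℕ) → EuclideanSpace ℝ (Fin n) → ℝ := fun α =>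
    if h : α ∈ multiIndices n m then (hvm α h).1.mk (v α) else 0 with hv'
  have hvv' : ∀ α ∈ multiIndices n m, v α =ᵐ[volume.restrict (interior Ω)] v' α := fun α hα => by
    simp only [hv', hα, dif_pos]
    exact (hvm α hα).1.ae_eq_mk
  have hu'm : Measurable u' := hu1.1.stronglyMeasurable_mk.measurable
  have hv'm : ∀ α, Measurable (v' α) := fun α => by
    by_cases hα : α ∈ multiIndices n m
    · simp only [hv', hα, dif_pos]
      exact (hvm α hα).1.stronglyMeasurable_mk.measurable
    · simp only [hv', hα, dif_neg, not_false_eq_true]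
      exact measurable_const
  have hint : Integrable ((interior Ω).indicator u') := by
    rw [integrable_indicator_iff isOpen_interior.measurableSet]
    exact (memLp_one_iff_integrable.1 hu1).congr huu'
  -- The fixed ratio `2` of outer to inner radius is what the differentiation theorem for
  -- convolutions requires.
  set ρ : ℕ → ContDiffBump (0 : EuclideanSpace ℝ (Fin n)) := fun k =>
    ⟨1 / ((k : ℝ) + 1), 2 / ((k : ℝ) + 1), by positivity, by gcongr; norm_num⟩ with hρ
  have hρ0 : Filter.Tendsto (fun k => (ρ k).rOut) Filter.atTop (nhds 0) := by
    have := (tendsto_one_div_add_atTop_nhds_zero_nat (𝕜 := ℝ)).const_mul 2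
    simpa [hρ, div_eq_mul_inv] using this
  have hconv := ContDiffBump.ae_convolution_tendsto_right_of_locallyIntegrable (μ := volume)
    (φ := ρ) (K := 2) hρ0 (Filter.Eventually.of_forall fun k => by simp [hρ, div_eq_mul_inv])
    hint.locallyIntegrable
  have hA : eLpNorm u' 1 (volume.restrict (interior Ω)) = eLpNorm u 1 (volume.restrict Ω) := by
    rw [← hrestr]; exact eLpNorm_congr_ae huu'.symm
  have hae : ∀ᵐ x ∂(volume.restrict (interior Ω)), ‖u x‖ₑ ≤
      C * (2 + 2 * ENNReal.ofReal (R ^ (-(n : ℝ)))) *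
        (eLpNorm u 1 (volume.restrict Ω) ^ (1 - n / (n + ((m : ℝ) - n * q))) *
          V ^ (n / (n + ((m : ℝ) - n * q))) + eLpNorm u 1 (volume.restrict Ω)) := by
    filter_upwards [huu', ae_restrict_of_ae hconv,
      ae_restrict_mem isOpen_interior.measurableSet] with x hx hxc hxU
    rw [hx]
    refine le_of_forall_scale_le hn' (by linarith) hR ?_ hadm.memL1.2.ne hsup.ne ?_
    · rw [Ne, eLpNorm_eq_zero_iff hadm.memL1.1 one_ne_zero]
      exact hadm.ne_zero
    · intro r hr
      obtain ⟨ν, hν, hνcone⟩ := hcone x (interior_subset hxU)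
      obtain ⟨δ, hδ, hδsub⟩ := exists_closedBall_subset_of_cone (m := m) hxU hνcone hr.1
        (by have := hr.2; rw [hRdef, le_div_iff₀ hm'] at this; linarith)
      have hlim : Filter.Tendsto (fun k => ‖mollify (ρ k) ((interior Ω).indicator u') x‖ₑ)
          Filter.atTop (nhds ‖u' x‖ₑ) := by
        have := (continuous_enorm.tendsto _).comp hxc
        rwa [indicator_of_mem hxU] at this
      refine le_of_tendsto hlim ?_
      filter_upwards [hρ0.eventually (gt_mem_nhds hδ)] with k hk
      rw [← hA]
      refine H Ω u' v' V (ρ k) x ν r hu'm hv'm hint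
        (fun α hα => (hadm.weakDeriv α hα).congr_ae huu' (hvv' α hα)) ?_ hr.1 hν ?_
      · intro α hα
        rw [← eLpNorm_congr_ae (hvv' α hα), hrestr]
        exact Finset.le_sup (f := fun α => eLpNorm (v α) p (volume.restrict Ω)) hα
      · intro s hs z hz
        exact (Metric.closedBall_subset_closedBall hk.le).trans (hδsub s hs z hz)
  rw [eLpNorm_exponent_top, ← hrestr]
  rw [← hrestr] at hae
  exact essSup_le_of_ae_le _ hae

end GagliardoNirenberg

/-! ### Smoothness of feature maps -/

section FeatureMap

variable {E H : Type*} [NormedAddCommGroup E] [NormedSpace ℝ E] [NormedAddCommGroup H]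
  [InnerProductSpace ℝ H]

/-- A map whose Gram kernel is bilinear up to a small error is differentiable at the origin. -/
theorem exists_hasFDerivAt_of_inner_sub_le [FiniteDimensional ℝ E] [CompleteSpace H] {f : E → H}
    (B : E →L[ℝ] E →L[ℝ] ℝ)
    (h : ∀ ε > 0, ∃ δ > 0, ∀ v w : E, ‖v‖ < δ → ‖w‖ < δ →
      |inner ℝ (f v) (f w) - B v w| ≤ ε * (‖v‖ * ‖w‖)) :
    ∃ A : E →L[ℝ] H, HasFDerivAt f A 0 := by
  have hf0 : f 0 = 0 := by
    obtain ⟨δ, hδ, hh⟩ := h 1 one_pos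
    have := hh 0 0 (by simpa using hδ) (by simpa using hδ)
    simpa using this
  have hsmall : ∀ (v : E) {δ : ℝ}, 0 < δ → ∀ᶠ t : ℝ in nhdsWithin 0 {0}ᶜ, ‖t • v‖ < δ := by
    intro v δ hδ
    have hc : Continuous fun t : ℝ => ‖t • v‖ := by fun_prop
    have := hc.tendsto 0
    simp only [zero_smul, norm_zero] at this
    exact (this.eventually (gt_mem_nhds hδ)).filter_mono nhdsWithin_le_nhds
  have hin : ∀ v w : E, Filter.Tendsto
      (fun p : ℝ × ℝ => inner ℝ (p.1⁻¹ • f (p.1 • v)) (p.2⁻¹ • f (p.2 • w)))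
      (nhdsWithin 0 {0}ᶜ ×ˢ nhdsWithin 0 {0}ᶜ) (nhds (B v w)) := by
    intro v w
    rw [Metric.tendsto_nhds]
    intro ε hε
    obtain ⟨δ, hδ, hh⟩ := h (ε / (2 * (‖v‖ * ‖w‖ + 1))) (by positivity)
    filter_upwards [((hsmall v hδ).and self_mem_nhdsWithin).prod_mk
      ((hsmall w hδ).and self_mem_nhdsWithin)] with p hp
    obtain ⟨⟨h1, h10⟩, h2, h20⟩ := hp
    have h10 : p.1 ≠ 0 := h10
    have h20 : p.2 ≠ 0 := h20
    have h3 := hh _ _ h1 h2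
    rw [Real.dist_eq]
    have e1 : inner ℝ (p.1⁻¹ • f (p.1 • v)) (p.2⁻¹ • f (p.2 • w)) - B v w =
        p.1⁻¹ * p.2⁻¹ * (inner ℝ (f (p.1 • v)) (f (p.2 • w)) - B (p.1 • v) (p.2 • w)) := by
      rw [inner_smul_left, inner_smul_right, map_smul, map_smul, smul_apply]
      simp only [conj_trivial, smul_eq_mul]
      field_simp
    rw [e1, abs_mul]
    calc _ ≤ |p.1⁻¹ * p.2⁻¹| * (ε / (2 * (‖v‖ * ‖w‖ + 1)) * (‖p.1 • v‖ * ‖p.2 • w‖)) := by gcongr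
      _ = ε / (2 * (‖v‖ * ‖w‖ + 1)) * (‖v‖ * ‖w‖) := by
          rw [norm_smul, norm_smul, abs_mul, abs_inv, abs_inv, Real.norm_eq_abs, Real.norm_eq_abs]
          have := abs_pos.2 h10
          have := abs_pos.2 h20
          field_simp
      _ < ε := by
          rw [div_mul_eq_mul_div, div_lt_iff₀ (by positivity)]
          nlinarith [norm_nonneg v, norm_nonneg w, mul_nonneg (norm_nonneg v) (norm_nonneg w)]
  -- Difference quotients are Cauchy: all three inner products in the expansion of `‖a - b‖ ^ 2` are
  -- close to `B v v`, so they cancel up to `4 * (ε ^ 2 / 8)`.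
  have hex : ∀ v : E, ∃ a : H, Filter.Tendsto (fun t : ℝ => t⁻¹ • f (t • v))
      (nhdsWithin 0 {0}ᶜ) (nhds a) := by
    intro v
    refine CompleteSpace.complete ?_
    rw [Metric.cauchy_iff]
    refine ⟨by infer_instance, fun ε hε => ?_⟩
    have h1 := Metric.tendsto_nhds.1 (hin v v) (ε ^ 2 / 8) (by positivity)
    obtain ⟨S, hS, T, hT, hST⟩ := Filter.mem_prod_iff.1 h1
    refine ⟨(fun t : ℝ => t⁻¹ • f (t • v)) '' (S ∩ T), Filter.image_mem_map (Filter.inter_mem hS hT), ?_⟩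
    rintro _ ⟨s, hs, rfl⟩ _ ⟨t, ht, rfl⟩
    have h2 := hST (show (s, t) ∈ S ×ˢ T from ⟨hs.1, ht.2⟩)
    have h3 := hST (show (s, s) ∈ S ×ˢ T from ⟨hs.1, hs.2⟩)
    have h4 := hST (show (t, t) ∈ S ×ˢ T from ⟨ht.1, ht.2⟩)
    simp only [mem_ofPred_eq, Real.dist_eq, abs_lt] at h2 h3 h4
    rw [dist_eq_norm]
    refine lt_of_pow_lt_pow_left₀ 2 hε.le ?_
    rw [norm_sub_sq_real, ← real_inner_self_eq_norm_sq, ← real_inner_self_eq_norm_sq]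
    nlinarith [h2.1, h3.2, h4.2, sq_pos_of_pos hε]
  choose A hA using hex
  have hAB : ∀ v w : E, inner ℝ (A v) (A w) = B v w := fun v w =>
    tendsto_nhds_unique (((hA v).comp Filter.tendsto_fst).inner ((hA w).comp Filter.tendsto_snd))
      (hin v w)
  -- Linearity of the limit follows from `hAB`: the defect has norm zero because `B` is bilinear.
  have hadd : ∀ v w, A (v + w) = A v + A w := by
    intro v w
    rw [← sub_eq_zero, ← inner_self_eq_zero (𝕜 := ℝ)]
    simp only [inner_sub_left, inner_sub_right, inner_add_left, inner_add_right, hAB, map_add,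
      add_apply]
    ring
  have hsmul : ∀ (c : ℝ) v, A (c • v) = c • A v := by
    intro c v
    rw [← sub_eq_zero, ← inner_self_eq_zero (𝕜 := ℝ)]
    simp only [inner_sub_left, inner_sub_right, inner_smul_left, inner_smul_right, hAB, map_smul,
      smul_apply, smul_eq_mul, conj_trivial]
    ring
  refine ⟨LinearMap.toContinuousLinearMap ⟨⟨A, hadd⟩, hsmul⟩, ?_⟩
  rw [hasFDerivAt_iff_isLittleO_nhds_zero, Asymptotics.isLittleO_iff]
  intro c hc
  -- The three inner products in `‖f v - t⁻¹ • f (t • v)‖ ^ 2` enter with weights `1`, `2`, `1`, so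
  -- the total error is at most `c ^ 2 * ‖v‖ ^ 2`.
  obtain ⟨δ, hδ, hh⟩ := h (c ^ 2 / 4) (by positivity)
  filter_upwards [Metric.ball_mem_nhds (0 : E) hδ] with v hv
  rw [mem_ball_zero_iff] at hv
  simp only [zero_add, hf0, sub_zero]
  change ‖f v - A v‖ ≤ c * ‖v‖
  have hlim : Filter.Tendsto (fun t : ℝ => ‖f v - t⁻¹ • f (t • v)‖) (nhdsWithin 0 {0}ᶜ)
      (nhds ‖f v - A v‖) := (tendsto_const_nhds.sub (hA v)).norm
  refine le_of_tendsto hlim ?_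
  filter_upwards [hsmall v hδ, self_mem_nhdsWithin] with t ht ht0
  have ht0 : t ≠ 0 := ht0
  refine le_of_sq_le_sq ?_ (by positivity)
  have h1 := abs_le.1 (hh v v hv hv)
  have h2 := abs_le.1 (hh v (t • v) hv ht)
  have h3 := abs_le.1 (hh (t • v) (t • v) ht ht)
  rw [norm_sub_sq_real, ← real_inner_self_eq_norm_sq, ← real_inner_self_eq_norm_sq,
    inner_smul_right, inner_smul_left, inner_smul_right, conj_trivial]
  simp only [map_smul, smul_apply, smul_eq_mul, norm_smul, Real.norm_eq_abs] at h2 h3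
  have e2 : |t⁻¹ * inner ℝ (f v) (f (t • v)) - B v v| ≤ c ^ 2 / 4 * (‖v‖ * ‖v‖) := by
    have : t⁻¹ * inner ℝ (f v) (f (t • v)) - B v v =
        t⁻¹ * (inner ℝ (f v) (f (t • v)) - t * B v v) := by field_simp
    rw [this, abs_mul, abs_inv, inv_mul_le_iff₀ (abs_pos.2 ht0)]
    calc _ ≤ c ^ 2 / 4 * (‖v‖ * (|t| * ‖v‖)) := abs_le.2 h2
      _ = _ := by ring
  have e3 : |t⁻¹ * (t⁻¹ * inner ℝ (f (t • v)) (f (t • v))) - B v v| ≤ c ^ 2 / 4 * (‖v‖ * ‖v‖) := by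
    have : t⁻¹ * (t⁻¹ * inner ℝ (f (t • v)) (f (t • v))) - B v v =
        t⁻¹ * (t⁻¹ * (inner ℝ (f (t • v)) (f (t • v)) - t * (t * B v v))) := by field_simp
    rw [this, abs_mul, abs_mul, abs_inv, inv_mul_le_iff₀ (abs_pos.2 ht0),
      inv_mul_le_iff₀ (abs_pos.2 ht0)]
    calc _ ≤ c ^ 2 / 4 * ((|t| * ‖v‖) * (|t| * ‖v‖)) := abs_le.2 h3
      _ = _ := by ring
  have e2 := abs_le.1 e2
  have e3 := abs_le.1 e3
  nlinarith [e2.1, e3.2, h1.2]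

/-- The mean value inequality is applied once in each variable, after subtracting a linear function
of slope `b`. -/
theorem abs_second_difference_sub_le {g gs gst : ℝ → ℝ → ℝ} {b C : ℝ}
    (h1 : ∀ s ∈ Icc (0 : ℝ) 1, ∀ t ∈ Icc (0 : ℝ) 1, HasDerivAt (fun s => g s t) (gs s t) s)
    (h2 : ∀ s ∈ Icc (0 : ℝ) 1, ∀ t ∈ Icc (0 : ℝ) 1, HasDerivAt (gs s) (gst s t) t)
    (h3 : ∀ s ∈ Icc (0 : ℝ) 1, ∀ t ∈ Icc (0 : ℝ) 1, |gst s t - b| ≤ C) :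
    |g 1 1 - g 1 0 - g 0 1 + g 0 0 - b| ≤ C := by
  have hone : (1 : ℝ) ∈ Icc (0 : ℝ) 1 := ⟨zero_le_one, le_rfl⟩
  have hzero : (0 : ℝ) ∈ Icc (0 : ℝ) 1 := ⟨le_rfl, zero_le_one⟩
  have hinner : ∀ s ∈ Icc (0 : ℝ) 1, ‖gs s 1 - gs s 0 - b‖ ≤ C := by
    intro s hs
    have h := norm_image_sub_le_of_norm_deriv_le_segment_01' (f := fun t => gs s t - t * b) (C := C)
      (fun t ht => ((h2 s hs t ht).sub (by simpa using (hasDerivAt_id t).mul_const b :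
        HasDerivAt (fun t => t * b) b t)).hasDerivWithinAt)
      (fun t ht => h3 s hs t ⟨ht.1, ht.2.le⟩)
    simp only [one_mul, zero_mul, sub_zero] at h
    refine le_trans (le_of_eq ?_) h
    congr 1
    ring
  have h := norm_image_sub_le_of_norm_deriv_le_segment_01' (f := fun s => g s 1 - g s 0 - s * b)
    (C := C) (fun s hs => (((h1 s hs 1 hone).sub (h1 s hs 0 hzero)).sub
      (by simpa using (hasDerivAt_id s).mul_const b :
        HasDerivAt (fun t => t * b) b s)).hasDerivWithinAt)
    (fun s hs => hinner s ⟨hs.1, hs.2.le⟩)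
  simp only [one_mul, zero_mul, sub_zero] at h
  refine le_trans (le_of_eq ?_) h
  rw [Real.norm_eq_abs]
  congr 1
  ring

/-- A second-order mean value estimate for the mixed second difference of a `C²` function. -/
theorem exists_second_difference_le {G : E × E → ℝ} {x y : E} (hG : ContDiffAt ℝ 2 G (x, y))
    {ε : ℝ} (hε : 0 < ε) : ∃ δ > 0, ∀ v w : E, ‖v‖ < δ → ‖w‖ < δ →
      |G (x + v, y + w) - G (x + v, y) - G (x, y + w) + G (x, y) -
        fderiv ℝ (fderiv ℝ G) (x, y) (0, w) (v, 0)| ≤ ε * (‖v‖ * ‖w‖) := by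
  have hev : ∀ᶠ z in nhds (x, y), ContDiffAt ℝ 2 G z := hG.eventually (by simp)
  have hcont := ((hG.fderiv_right (m := 1) (by norm_num)).fderiv_right (m := 0)
    (by norm_num)).continuousAt
  have hev2 : ∀ᶠ z in nhds (x, y),
      ‖fderiv ℝ (fderiv ℝ G) z - fderiv ℝ (fderiv ℝ G) (x, y)‖ < ε := by
    have h := (hcont.sub (continuousAt_const (y := fderiv ℝ (fderiv ℝ G) (x, y)))).norm
    simp only [ContinuousAt, Pi.sub_apply, sub_self, norm_zero] at h
    exact h.eventually (gt_mem_nhds hε)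
  obtain ⟨δ, hδ, hball⟩ := Metric.eventually_nhds_iff_ball.1 (hev.and hev2)
  refine ⟨δ, hδ, fun v w hv hw => ?_⟩
  have hmem : ∀ s ∈ Icc (0 : ℝ) 1, ∀ t ∈ Icc (0 : ℝ) 1,
      (x + s • v, y + t • w) ∈ Metric.ball (x, y) δ := by
    intro s hs t ht
    rw [Metric.mem_ball, Prod.dist_eq, dist_eq_norm, dist_eq_norm]
    simp only [add_sub_cancel_left, norm_smul, Real.norm_of_nonneg hs.1, Real.norm_of_nonneg ht.1]
    refine max_lt (lt_of_le_of_lt ?_ hv) (lt_of_le_of_lt ?_ hw)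
    · exact mul_le_of_le_one_left (norm_nonneg _) hs.2
    · exact mul_le_of_le_one_left (norm_nonneg _) ht.2
  have hder : ∀ z ∈ Metric.ball (x, y) δ, HasFDerivAt (fun z => fderiv ℝ G z (v, 0))
      ((fderiv ℝ (fderiv ℝ G) z).flip (v, 0)) z := by
    intro z hz
    have h2 : DifferentiableAt ℝ (fderiv ℝ G) z :=
      ((hball z hz).1.fderiv_right (m := 1) (by norm_num)).differentiableAt one_ne_zero
    have h3 := h2.hasFDerivAt.clm_apply (hasFDerivAt_const ((v, 0) : E × E) z)
    simpa using h3
  have h := abs_second_difference_sub_le (g := fun s t => G (x + s • v, y + t • w))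
    (gs := fun s t => fderiv ℝ G (x + s • v, y + t • w) (v, 0))
    (gst := fun s t => fderiv ℝ (fderiv ℝ G) (x + s • v, y + t • w) (0, w) (v, 0))
    (b := fderiv ℝ (fderiv ℝ G) (x, y) (0, w) (v, 0)) (C := ε * (‖v‖ * ‖w‖)) ?_ ?_ ?_
  · simpa using h
  · intro s hs t ht
    have h1 : HasDerivAt (fun s : ℝ => (x + s • v, y + t • w)) (v, (0 : E)) s := by
      have := ((hasDerivAt_id s).smul_const v).const_add x
      simpa using this.prodMk (hasDerivAt_const s (y + t • w))
    have h2 : DifferentiableAt ℝ G (x + s • v, y + t • w) :=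
      (hball _ (hmem s hs t ht)).1.differentiableAt two_ne_zero
    exact h2.hasFDerivAt.comp_hasDerivAt s h1
  · intro s hs t ht
    have h1 : HasDerivAt (fun t : ℝ => (x + s • v, y + t • w)) ((0 : E), w) t := by
      have := ((hasDerivAt_id t).smul_const w).const_add y
      simpa using (hasDerivAt_const t (x + s • v)).prodMk this
    exact (hder _ (hmem s hs t ht)).comp_hasDerivAt t h1
  · intro s hs t ht
    have h6 := (hball _ (hmem s hs t ht)).2
    have e : fderiv ℝ (fderiv ℝ G) (x + s • v, y + t • w) (0, w) (v, 0) -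
        fderiv ℝ (fderiv ℝ G) (x, y) (0, w) (v, 0) =
        (fderiv ℝ (fderiv ℝ G) (x + s • v, y + t • w) - fderiv ℝ (fderiv ℝ G) (x, y)) (0, w) (v, 0) :=
      rfl
    rw [e, ← Real.norm_eq_abs]
    refine (ContinuousLinearMap.le_of_opNorm₂_le_of_le _ h6.le le_rfl le_rfl).trans (le_of_eq ?_)
    simp [Prod.norm_def]
    ring

/-- The Gram kernel of `v ↦ Φ (x + v) - Φ x` is the mixed second difference of the kernel at `(x,
x)`, which is bilinear up to a small error when the kernel is `C²`. -/
theorem exists_hasFDerivAt_of_kernel [FiniteDimensional ℝ E] [CompleteSpace H] {Φ : E → H} {x : E}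
    (hG : ContDiffAt ℝ 2 (fun z : E × E => (inner ℝ (Φ z.1) (Φ z.2) : ℝ)) (x, x)) :
    ∃ A : E →L[ℝ] H, HasFDerivAt Φ A x := by
  set G : E × E → ℝ := fun z => inner ℝ (Φ z.1) (Φ z.2)
  set B : E →L[ℝ] E →L[ℝ] ℝ :=
    ((fderiv ℝ (fderiv ℝ G) (x, x)).comp (ContinuousLinearMap.inr ℝ E E)).flip.comp
      (ContinuousLinearMap.inl ℝ E E)
  obtain ⟨A, hA⟩ := exists_hasFDerivAt_of_inner_sub_le (f := fun v => Φ (x + v) - Φ x) B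
    fun ε hε => by
      obtain ⟨δ, hδ, h⟩ := exists_second_difference_le hG hε
      refine ⟨δ, hδ, fun v w hv hw => le_trans (le_of_eq ?_) (h v w hv hw)⟩
      congr 1
      simp only [G, B, inner_sub_left, inner_sub_right, ContinuousLinearMap.comp_apply,
        ContinuousLinearMap.flip_apply, ContinuousLinearMap.inl_apply, ContinuousLinearMap.inr_apply]
      ring
  refine ⟨A, ?_⟩
  rw [hasFDerivAt_iff_isLittleO_nhds_zero] at hA ⊢
  simpa using hA

theorem fderiv_prod_left {h : E × E → ℝ} {x y : E} (hd : DifferentiableAt ℝ h (x, y)) (v : E) :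
    fderiv ℝ h (x, y) (v, 0) = fderiv ℝ (fun x' => h (x', y)) x v := by
  have h1 : HasFDerivAt (fun x' : E => (x', y)) (ContinuousLinearMap.inl ℝ E E) x :=
    hasFDerivAt_prodMk_left x y
  have h2 : fderiv ℝ (fun x' => h (x', y)) x = _ := (hd.hasFDerivAt.comp x h1).fderiv
  rw [h2]
  simp

theorem fderiv_prod_right {h : E × E → ℝ} {x y : E} (hd : DifferentiableAt ℝ h (x, y)) (w : E) :
    fderiv ℝ h (x, y) (0, w) = fderiv ℝ (fun y' => h (x, y')) y w := by
  have h1 : HasFDerivAt (fun y' : E => (x, y')) (ContinuousLinearMap.inr ℝ E E) y :=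
    hasFDerivAt_prodMk_right x y
  have h2 : fderiv ℝ (fun y' => h (x, y')) y = _ := (hd.hasFDerivAt.comp y h1).fderiv
  rw [h2]
  simp

/-- Derivatives of the kernel of a feature map in terms of derivatives of the feature map. -/
theorem dirDeriv_kernel {U : Set E} (hU : IsOpen U) {Φ : E → H} {N M : ℕ}
    (hG : ContDiffOn ℝ M (fun z : E × E => (inner ℝ (Φ z.1) (Φ z.2) : ℝ)) (U ×ˢ U))
    (hΦ : ∀ k : List E, k.length < N → ∀ x ∈ U, DifferentiableAt ℝ (dirDeriv k Φ) x)
    (l l' : List E) (hl : l.length ≤ N) (hl' : l'.length ≤ N) (hM : l.length + l'.length ≤ M) :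
    EqOn (dirDeriv (l.map (fun v => (v, (0 : E))) ++ l'.map fun w => ((0 : E), w))
        fun z : E × E => (inner ℝ (Φ z.1) (Φ z.2) : ℝ))
      (fun z => inner ℝ (dirDeriv l Φ z.1) (dirDeriv l' Φ z.2)) (U ×ˢ U) := by
  have hUU := hU.prod hU
  -- The derivatives in the second variable act first, so the base case is itself an induction on
  -- `l'`.
  induction l with
  | nil =>
    simp only [List.map_nil, List.nil_append]
    induction l' with
    | nil => exact fun _ _ => rfl
    | cons w l' ih =>
      simp only [List.length_nil, List.length_cons, zero_add] at hM hl' ih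
      have ih := ih (by omega) (by omega)
      rintro ⟨x, y⟩ ⟨hx, hy⟩
      have d := differentiableAt_dirDeriv hUU (l'.map fun w => ((0 : E), w)) hG
        (by rw [List.length_map]; omega) (mk_mem_prod hx hy)
      have d2 : DifferentiableAt ℝ (dirDeriv l' Φ) y := hΦ l' (by omega) y hy
      simp only [List.map_cons, dirDeriv_cons, dirDeriv_nil]
      rw [fderiv_prod_right d]
      have e : (fun y' => dirDeriv (l'.map fun w => ((0 : E), w))
          (fun z : E × E => (inner ℝ (Φ z.1) (Φ z.2) : ℝ)) (x, y')) =ᶠ[nhds y]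
          fun y' => inner ℝ (Φ x) (dirDeriv l' Φ y') := by
        filter_upwards [hU.mem_nhds hy] with y' hy'
        exact ih (mk_mem_prod hx hy')
      rw [e.fderiv_eq, ((hasFDerivAt_const (Φ x) y).inner ℝ d2.hasFDerivAt).fderiv]
      simp [fderivInnerCLM_apply]
  | cons v l ih =>
    simp only [List.length_cons] at hM hl
    have ih := ih (by omega) (by omega)
    rintro ⟨x, y⟩ ⟨hx, hy⟩
    have d := differentiableAt_dirDeriv hUU
      (l.map (fun v => (v, (0 : E))) ++ l'.map fun w => ((0 : E), w)) hG
      (by simp only [List.length_append, List.length_map]; omega) (mk_mem_prod hx hy)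
    have d1 : DifferentiableAt ℝ (dirDeriv l Φ) x := hΦ l (by omega) x hx
    simp only [List.map_cons, List.cons_append, dirDeriv_cons]
    rw [fderiv_prod_left d]
    have e : (fun x' => dirDeriv (l.map (fun v => (v, (0 : E))) ++ l'.map fun w => ((0 : E), w))
        (fun z : E × E => (inner ℝ (Φ z.1) (Φ z.2) : ℝ)) (x', y)) =ᶠ[nhds x]
        fun x' => inner ℝ (dirDeriv l Φ x') (dirDeriv l' Φ y) := by
      filter_upwards [hU.mem_nhds hx] with x' hx'
      exact ih (mk_mem_prod hx' hy)
    rw [e.fderiv_eq, (d1.hasFDerivAt.inner ℝ (hasFDerivAt_const _ x)).fderiv]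
    simp [fderivInnerCLM_apply]

/-- `‖Φ y - Φ x‖ ^ 2` is a combination of the kernel values at `(y, y)`, `(y, x)` and `(x, x)`. -/
theorem continuousOn_of_kernel {X : Type*} [TopologicalSpace X] {S : Set X} {Φ : X → H}
    (hc : ContinuousOn (fun z : X × X => (inner ℝ (Φ z.1) (Φ z.2) : ℝ)) (S ×ˢ S)) :
    ContinuousOn Φ S := by
  intro x hx
  rw [ContinuousWithinAt, tendsto_iff_norm_sub_tendsto_zero]
  have h1 : ContinuousOn (fun y => ‖Φ y - Φ x‖ ^ 2) S := by
    have e : (fun y => ‖Φ y - Φ x‖ ^ 2) = fun y => (inner ℝ (Φ y) (Φ y) : ℝ) -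
        2 * inner ℝ (Φ y) (Φ x) + inner ℝ (Φ x) (Φ x) := by
      ext y
      rw [norm_sub_sq_real, real_inner_self_eq_norm_sq, real_inner_self_eq_norm_sq]
    rw [e]
    have c1 : ContinuousOn (fun y => (inner ℝ (Φ y) (Φ y) : ℝ)) S :=
      hc.comp (f := fun y => (y, y)) (by fun_prop) fun y hy => ⟨hy, hy⟩
    have c2 : ContinuousOn (fun y => (inner ℝ (Φ y) (Φ x) : ℝ)) S :=
      hc.comp (f := fun y => (y, x)) (by fun_prop) fun y hy => ⟨hy, hx⟩
    exact (c1.sub (continuousOn_const.mul c2)).add continuousOn_const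
  have h2 := (h1 x hx).tendsto.sqrt
  simpa [Real.sqrt_sq] using h2

/-- One derivative of `Φ` costs two of the kernel: the Gram kernel of `∂_v Φ` is the mixed
derivative `∂_(v,0) ∂_(0,v)` of the Gram kernel of `Φ`, to which the induction hypothesis applies.
-/
theorem contDiffOn_of_kernel [FiniteDimensional ℝ E] [CompleteSpace H] {U : Set E} (hU : IsOpen U)
    (m : ℕ) {Φ : E → H}
    (hG : ContDiffOn ℝ ((2 * m : ℕ) : WithTop ℕ∞)
      (fun z : E × E => (inner ℝ (Φ z.1) (Φ z.2) : ℝ)) (U ×ˢ U)) :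
    ContDiffOn ℝ m Φ U := by
  have hUU := hU.prod hU
  induction m generalizing Φ with
  | zero =>
    rw [Nat.cast_zero, contDiffOn_zero]
    exact continuousOn_of_kernel hG.continuousOn
  | succ m ih =>
    have hd : ∀ x ∈ U, DifferentiableAt ℝ Φ x := fun x hx => by
      obtain ⟨A, hA⟩ := exists_hasFDerivAt_of_kernel
        ((hG.contDiffAt (hUU.mem_nhds (mk_mem_prod hx hx))).of_le (by
          exact_mod_cast (by omega : 2 ≤ 2 * (m + 1))))
      exact hA.differentiableAt
    have hcd : ∀ v, ContDiffOn ℝ m (fun x => fderiv ℝ Φ x v) U := by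
      intro v
      refine ih ?_
      have h1 := contDiffOn_dirDeriv hUU [(v, (0 : E)), ((0 : E), v)] (k := ((2 * m : ℕ) : WithTop ℕ∞))
        hG (by exact_mod_cast (by simp; omega))
      refine h1.congr ?_
      intro z hz
      have h2 := dirDeriv_kernel hU (N := 1) hG (fun k hk x hx => by
        rw [Nat.lt_one_iff, List.length_eq_zero_iff] at hk
        subst hk
        exact hd x hx) [v] [v] (by simp) (by simp) (by simp [mul_add]) hz
      exact h2.symm
    push_cast
    rw [contDiffOn_succ_iff_fderiv_of_isOpen hU]
    refine ⟨fun x hx => (hd x hx).differentiableWithinAt, by simp, ?_⟩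
    exact contDiffOn_clm_apply.2 hcd

/-- Near each point of `S`, smoothness within `S` provides a Taylor series that is continuous up to
the boundary. On the open set `W` its coefficients are the genuine derivatives, and compactness
makes the local bounds uniform. -/
theorem exists_norm_iteratedFDeriv_le {F : Type*} [NormedAddCommGroup F] [NormedSpace ℝ F]
    {f : E → F} {S W : Set E} (hS : IsCompact S) (hW : IsOpen W) (hWS : W ⊆ S) {k : ℕ}
    (hf : ContDiffOn ℝ k f S) : ∃ C : ℝ, ∀ x ∈ W, ‖iteratedFDeriv ℝ k f x‖ ≤ C := by
  suffices h : ∃ C : ℝ, ∀ x ∈ W ∩ S, ‖iteratedFDeriv ℝ k f x‖ ≤ C by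
    obtain ⟨C, hC⟩ := h
    exact ⟨C, fun x hx => hC x ⟨hx, hWS hx⟩⟩
  refine hS.induction_on (p := fun T => ∃ C : ℝ, ∀ x ∈ W ∩ T, ‖iteratedFDeriv ℝ k f x‖ ≤ C)
    ⟨0, by simp⟩ ?_ ?_ ?_
  · rintro s t hst ⟨C, hC⟩
    exact ⟨C, fun x hx => hC x ⟨hx.1, hst hx.2⟩⟩
  · rintro s t ⟨C, hC⟩ ⟨C', hC'⟩
    refine ⟨max C C', ?_⟩
    rintro x ⟨hx, hx' | hx'⟩
    · exact (hC x ⟨hx, hx'⟩).trans (le_max_left _ _)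
    · exact (hC' x ⟨hx, hx'⟩).trans (le_max_right _ _)
  · intro x hx
    obtain ⟨u, hu, p, hp⟩ := contDiffWithinAt_nat.1 (hf x hx)
    rw [insert_eq_of_mem hx] at hu
    have hxu : x ∈ u := mem_of_mem_nhdsWithin hx hu
    obtain ⟨o, ho, hxo, hou⟩ := mem_nhdsWithin.1 hu
    have hc : ContinuousWithinAt (fun y => p y k) u x := hp.cont k le_rfl x hxu
    have hev : ∀ᶠ y in nhdsWithin x u, ‖p y k‖ < ‖p x k‖ + 1 :=
      hc.norm.eventually (gt_mem_nhds (by linarith))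
    rw [eventually_nhdsWithin_iff] at hev
    refine ⟨o ∩ {y | y ∈ u → ‖p y k‖ < ‖p x k‖ + 1},
      mem_nhdsWithin_of_mem_nhds (Filter.inter_mem (ho.mem_nhds hxo) hev), ‖p x k‖ + 1, ?_⟩
    rintro y ⟨hyW, hyo, hy⟩
    have hopen : IsOpen (o ∩ W) := ho.inter hW
    have hsub : o ∩ W ⊆ u := fun z hz => hou ⟨hz.1, hWS hz.2⟩
    have e1 := (hp.mono hsub).eq_iteratedFDerivWithin_of_uniqueDiffOn le_rfl hopen.uniqueDiffOn
      (show y ∈ o ∩ W from ⟨hyo, hyW⟩)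
    rw [iteratedFDerivWithin_of_isOpen k hopen ⟨hyo, hyW⟩] at e1
    rw [← e1]
    exact (hy (hsub ⟨hyo, hyW⟩)).le

end FeatureMap

/-! ### Mercer's theorem -/

section Mercer

/-- Every positive semidefinite kernel has a total feature map into a Hilbert space. -/
theorem exists_feature_map {X : Type} {k : X → X → ℝ} (hk : (Matrix.of k).PosSemidef) :
    ∃ (H : Type) (_ : NormedAddCommGroup H) (_ : InnerProductSpace ℝ H) (_ : CompleteSpace H)
      (Φ : X → H), (∀ x y, inner ℝ (Φ x) (Φ y) = k x y) ∧
        ∀ h : H, (∀ x, inner ℝ (Φ x) h = 0) → h = 0 := by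
  have hsymm : ∀ x y, k x y = k y x := fun x y => by simpa using (hk.1.apply x y).symm
  -- The scalar kernel is viewed as one with values in the operators on `ℝ`; its reproducing kernel
  -- Hilbert space is the feature space.
  set M : Matrix X X (ℝ →L[ℝ] ℝ) := Matrix.of fun x y => k x y • ContinuousLinearMap.id ℝ ℝ with hM
  have hMps : M.PosSemidef := by
    have h0 := (RKHS.posSemidef_tfae (K := M)).out 2 0
    refine h0.1 ⟨?_, fun c => ?_⟩
    · ext x y
      have h1 : star (ContinuousLinearMap.id ℝ ℝ) = ContinuousLinearMap.id ℝ ℝ :=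
        star_one (ℝ →L[ℝ] ℝ)
      simp [hM, hsymm x y, h1]
    · have h := hk.2 c
      refine h.trans (le_of_eq ?_)
      simp only [RCLike.re_to_real]
      refine Finsupp.sum_congr fun x _ => Finsupp.sum_congr fun y _ => ?_
      simp [hM, hsymm x y]
      ring
  have : Fact M.PosSemidef := ⟨hMps⟩
  refine ⟨RKHS.OfKernel M, inferInstance, inferInstance, inferInstance,
    fun x => RKHS.kerFun (RKHS.OfKernel M) x (1 : ℝ), ?_, ?_⟩
  · intro x y
    rw [← RKHS.kernel_inner, RKHS.OfKernel.kernel_ofKernel]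
    simp [hM, hsymm x y]
  · intro h hh
    ext x
    have := hh x
    rw [RKHS.kerFun_inner] at this
    simpa using this

variable {n : ℕ} {Ω : Set (EuclideanSpace ℝ (Fin n))}
  {K : EuclideanSpace ℝ (Fin n) → EuclideanSpace ℝ (Fin n) → ℝ}
  {lam : ℕ → ℝ} {φ : ℕ → EuclideanSpace ℝ (Fin n) → ℝ}

theorem IsMercerKernel.exists_feature_map (hK : IsMercerKernel Ω K) :
    ∃ (H : Type) (_ : NormedAddCommGroup H) (_ : InnerProductSpace ℝ H) (_ : CompleteSpace H)
      (Φ : EuclideanSpace ℝ (Fin n) → H),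
        (∀ x ∈ Ω, ∀ y ∈ Ω, inner ℝ (Φ x) (Φ y) = K x y) ∧
        (∀ h : H, (∀ x ∈ Ω, inner ℝ (Φ x) h = 0) → h = 0) ∧ ContinuousOn Φ Ω := by
  obtain ⟨H, i1, i2, i3, Φ, h1, h2⟩ := MercerGN.exists_feature_map hK.2
  classical
  set Ψ : EuclideanSpace ℝ (Fin n) → H := fun x => if h : x ∈ Ω then Φ ⟨x, h⟩ else 0 with hΨ
  have hΨx : ∀ x (hx : x ∈ Ω), Ψ x = Φ ⟨x, hx⟩ := fun x hx => by simp [hΨ, hx]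
  have hin : ∀ x ∈ Ω, ∀ y ∈ Ω, inner ℝ (Ψ x) (Ψ y) = K x y := fun x hx y hy => by
    rw [hΨx x hx, hΨx y hy, h1]
  refine ⟨H, i1, i2, i3, Ψ, hin, fun h hh => h2 h fun x => ?_, ?_⟩
  · rw [← hΨx x.1 x.2]
    exact hh x.1 x.2
  · refine continuousOn_of_kernel (hK.1.congr ?_)
    rintro ⟨x, y⟩ ⟨hx, hy⟩
    exact hin x hx y hy

/-- The eigenfunctions of a Mercer kernel in terms of an orthonormal system in feature space. -/
theorem IsMercerSystem.exists_orthonormal {H : Type*} [NormedAddCommGroup H]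
    [InnerProductSpace ℝ H] [CompleteSpace H] {Φ : EuclideanSpace ℝ (Fin n) → H}
    (hsys : IsMercerSystem Ω K lam φ) (hΩ : IsCompact Ω) (hcl : Ω ⊆ closure (interior Ω))
    (hΦK : ∀ x ∈ Ω, ∀ y ∈ Ω, inner ℝ (Φ x) (Φ y) = K x y)
    (htot : ∀ h : H, (∀ x ∈ Ω, inner ℝ (Φ x) h = 0) → h = 0) (hΦc : ContinuousOn Φ Ω) :
    (∀ j, 0 ≤ lam j) ∧
    (∀ j, lam j ≠ 0 → ContinuousOn (φ j) Ω ∧ ∫⁻ x in Ω, ENNReal.ofReal (φ j x ^ 2) = 1) ∧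
    ∃ e : ℕ → H, (∀ j, ∀ x ∈ Ω, inner ℝ (e j) (Φ x) = √(lam j) * φ j x) ∧
      (∀ j k, inner ℝ (e j) (e k) = if j = k ∧ lam j ≠ 0 then (1 : ℝ) else 0) ∧
      ∀ h, (∀ j, inner ℝ (e j) h = 0) → h = 0 := by
  obtain ⟨ψ, ev, hev, hφ, hlam⟩ := hsys
  have : IsFiniteMeasure (volume.restrict Ω) :=
    ⟨by rw [Measure.restrict_apply_univ]; exact hΩ.measure_lt_top⟩
  have hΩm : MeasurableSet Ω := hΩ.isClosed.measurableSet
  obtain ⟨C, hC⟩ := hΩ.exists_bound_of_continuousOn hΦc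
  have hΦm : AEStronglyMeasurable Φ (volume.restrict Ω) := hΦc.aestronglyMeasurable hΩm
  have hΦb : ∀ᵐ x ∂volume.restrict Ω, ‖Φ x‖ ≤ C := (ae_restrict_mem hΩm).mono hC
  have hψi : ∀ i, Integrable (ψ i) (volume.restrict Ω) := fun i =>
    (Lp.memLp (ψ i)).integrable (by norm_num)
  have hint : ∀ i, Integrable (fun x => ψ i x • Φ x) (volume.restrict Ω) := fun i => (hψi i).smul_bdd C hΦm hΦb
  -- `t i` represents `O_K ψ_i` in feature space. Its Gram matrix is diagonal with entries `ev i`,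
  -- so the eigenvalues are nonnegative and normalising the nonzero `t i` gives an orthonormal
  -- system.
  set t : ℕ → H := fun i => ∫ x, ψ i x • Φ x ∂volume.restrict Ω with ht
  have htin : ∀ i (h : H), inner ℝ h (t i) = ∫ x, ψ i x * inner ℝ h (Φ x) ∂volume.restrict Ω := fun i h => by
    rw [ht, ← integral_inner (hint i)]
    simp only [inner_smul_right]
  have htΦ : ∀ i, ∀ x ∈ Ω, inner ℝ (Φ x) (t i) = kernelOp Ω K (ψ i) x := fun i x hx => by
    rw [htin, kernelOp]
    refine setIntegral_congr_fun hΩm fun y hy => ?_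
    simp only [hΦK x hx y hy]
    ring
  have htae : ∀ i, (fun x => (inner ℝ (Φ x) (t i) : ℝ)) =ᵐ[volume.restrict Ω] fun x => ev i * ψ i x := fun i => by
    filter_upwards [hev i, ae_restrict_mem hΩm] with x hx hxΩ
    rw [htΦ i x hxΩ, hx]
  have hψorth : ∀ i j, ∫ x, ψ i x * ψ j x ∂volume.restrict Ω = if i = j then (1 : ℝ) else 0 := fun i j => by
    have h := orthonormal_iff_ite.1 ψ.orthonormal i j
    rw [L2.inner_def] at h
    rw [← h]
    refine integral_congr_ae (Filter.Eventually.of_forall fun x => ?_)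
    simp [mul_comm]
  have htt : ∀ i j, inner ℝ (t i) (t j) = if i = j then ev i else 0 := fun i j => by
    rw [htin]
    have : ∫ x, ψ j x * inner ℝ (t i) (Φ x) ∂volume.restrict Ω = ∫ x, ev i * (ψ i x * ψ j x) ∂volume.restrict Ω := by
      refine integral_congr_ae ?_
      filter_upwards [htae i] with x hx
      rw [real_inner_comm, hx]
      ring
    rw [this, integral_const_mul, hψorth]
    simp
  have hev0 : ∀ i, 0 ≤ ev i := fun i => by
    have := htt i i
    rw [if_pos rfl] at this
    rw [← this]
    exact real_inner_self_nonneg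
  set I : Set ℕ := {i | 0 < ev i} with hI
  set σ : ℕ → ℕ := Nat.nth fun i => 0 < ev i with hσ
  have hfin : ∀ {j : ℕ}, (j : ℕ∞) < I.encard → ∀ hf : I.Finite, j < hf.toFinset.card :=
    fun {j} hj hf => by
      rw [hf.encard_eq_coe_toFinset_card] at hj
      exact_mod_cast hj
  have hσpos : ∀ {j : ℕ}, (j : ℕ∞) < I.encard → 0 < ev (σ j) := fun {j} hj =>
    Nat.nth_mem (p := fun i => 0 < ev i) j (hfin hj)
  have hσinj : ∀ {j k : ℕ}, (j : ℕ∞) < I.encard → (k : ℕ∞) < I.encard → σ j = σ k → j = k := by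
    intro j k hj hk hjk
    rcases I.finite_or_infinite with hf | hf
    · exact Nat.nth_injOn hf (hfin hj hf) (hfin hk hf) hjk
    · exact Nat.nth_injective hf hjk
  have hσsurj : ∀ i, 0 < ev i → ∃ j : ℕ, (j : ℕ∞) < I.encard ∧ σ j = i := by
    intro i hi
    classical
    refine ⟨Nat.count (fun i => 0 < ev i) i, ?_, Nat.nth_count hi⟩
    rcases I.finite_or_infinite with hf | hf
    · rw [hf.encard_eq_coe_toFinset_card]
      exact_mod_cast Nat.count_lt_card hf hi
    · rw [hf.encard_eq]
      exact ENat.natCast_lt_top _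
  have hlampos : ∀ j, lam j ≠ 0 ↔ (j : ℕ∞) < I.encard := fun j => by
    constructor
    · intro h
      by_contra hj
      exact h (hlam j (not_lt.1 hj))
    · intro h
      rw [(hφ j h).1]
      exact (hσpos h).ne'
  have hφeq : ∀ j : ℕ, (j : ℕ∞) < I.encard → ∀ x ∈ Ω,
      inner ℝ (Φ x) (t (σ j)) = lam j * φ j x := by
    intro j hj
    obtain ⟨h1, h2, h3⟩ := hφ j hj
    -- Both sides are continuous on `Ω`, so the eigenvalue equation holds at every point and not
    -- just almost everywhere.
    refine Measure.eqOn_of_ae_eq (μ := volume) ?_ (hΦc.inner continuousOn_const)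
      (continuousOn_const.mul h2) hcl
    filter_upwards [htae (σ j), h3] with x hx hx3
    rw [hx, h1, hx3]
  refine ⟨fun j => ?_, fun j hj => ?_, ?_⟩
  · by_cases hj : (j : ℕ∞) < I.encard
    · rw [(hφ j hj).1]; exact hev0 _
    · exact (hlam j (not_lt.1 hj)).ge
  · obtain ⟨h1, h2, h3⟩ := hφ j ((hlampos j).1 hj)
    refine ⟨h2, ?_⟩
    have h4 : ∫ x, ψ (σ j) x * ψ (σ j) x ∂volume.restrict Ω = 1 := by rw [hψorth, if_pos rfl]
    have h5 : Integrable (fun x => ψ (σ j) x * ψ (σ j) x) (volume.restrict Ω) := by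
      have := (Lp.memLp (ψ (σ j))).integrable_sq
      simpa [sq] using this
    have h6 := ofReal_integral_eq_lintegral_ofReal h5
      (Filter.Eventually.of_forall fun x => mul_self_nonneg _)
    rw [h4, ENNReal.ofReal_one] at h6
    rw [h6]
    refine lintegral_congr_ae ?_
    filter_upwards [h3] with x hx
    rw [hx, sq]
  classical
  -- Once the positive eigenvalues are exhausted `e j` is `0`, whatever `φ j` is.
  set e : ℕ → H := fun j => if (j : ℕ∞) < I.encard then (√(lam j))⁻¹ • t (σ j) else 0 with he
  have hepos : ∀ {j : ℕ}, (j : ℕ∞) < I.encard → e j = (√(lam j))⁻¹ • t (σ j) := fun {j} hj => by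
    simp only [he, if_pos hj]
  have heneg : ∀ {j : ℕ}, ¬ (j : ℕ∞) < I.encard → e j = 0 := fun {j} hj => by
    simp only [he, if_neg hj]
  have hsq : ∀ {j : ℕ}, (j : ℕ∞) < I.encard → 0 < √(lam j) := fun {j} hj => by
    rw [(hφ j hj).1]
    exact Real.sqrt_pos.2 (hσpos hj)
  have hsqm : ∀ {j : ℕ}, (j : ℕ∞) < I.encard → lam j = √(lam j) * √(lam j) := fun {j} hj => by
    rw [Real.mul_self_sqrt]
    rw [(hφ j hj).1]
    exact hev0 _
  refine ⟨e, fun j x hx => ?_, fun j k => ?_, fun h hh => ?_⟩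
  · by_cases hj : (j : ℕ∞) < I.encard
    · rw [hepos hj, inner_smul_left, real_inner_comm, hφeq j hj x hx, conj_trivial]
      have := hsq hj
      rw [inv_mul_eq_iff_eq_mul₀ this.ne', ← mul_assoc, ← hsqm hj]
    · rw [heneg hj, inner_zero_left, hlam j (not_lt.1 hj)]
      simp
  · by_cases hj : (j : ℕ∞) < I.encard
    · by_cases hk : (k : ℕ∞) < I.encard
      · rw [hepos hj, hepos hk, inner_smul_left, inner_smul_right, htt, conj_trivial]
        by_cases hjk : j = k
        · subst hjk
          rw [if_pos rfl, if_pos ⟨rfl, (hlampos j).2 hj⟩, ← (hφ j hj).1]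
          have := hsq hj
          rw [inv_mul_eq_iff_eq_mul₀ this.ne', inv_mul_eq_iff_eq_mul₀ this.ne', mul_one]
          exact hsqm hj
        · rw [if_neg fun h => hjk (hσinj hj hk h), if_neg fun h => hjk h.1]
          simp
      · rw [heneg hk, inner_zero_right, if_neg]
        rintro ⟨rfl, -⟩
        exact hk hj
    · rw [heneg hj, inner_zero_left, if_neg]
      rintro ⟨-, h⟩
      exact hj ((hlampos j).1 h)
  -- Totality: `h` is orthogonal to every `t i`, as those with eigenvalue `0` vanish. Hence `⟪h, Φ
  -- ·⟫` is orthogonal to the whole basis `ψ`, so it is zero in `L₂`, then on `Ω` by continuity.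
  · have hth : ∀ i, inner ℝ h (t i) = 0 := by
      intro i
      rcases (hev0 i).eq_or_lt with h0 | h0
      · have : t i = 0 := by
          rw [← inner_self_eq_zero (𝕜 := ℝ), htt, if_pos rfl, ← h0]
        rw [this, inner_zero_right]
      · obtain ⟨j, hj, rfl⟩ := hσsurj i h0
        have h1 := hh j
        rw [hepos hj, inner_smul_left, conj_trivial, mul_eq_zero] at h1
        rcases h1 with h1 | h1
        · exact absurd h1 (inv_ne_zero (hsq hj).ne')
        · rw [real_inner_comm]; exact h1
    have hFm : MemLp (fun x => (inner ℝ h (Φ x) : ℝ)) 2 (volume.restrict Ω) := by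
      refine MemLp.of_bound ((continuousOn_const.inner hΦc).aestronglyMeasurable hΩm) (‖h‖ * C) ?_
      filter_upwards [hΦb] with x hx
      exact (norm_inner_le_norm _ _).trans (by gcongr)
    have hF0 : hFm.toLp _ = 0 := by
      refine ψ.repr.injective ?_
      rw [map_zero]
      ext i
      rw [ψ.repr_apply_apply, L2.inner_def]
      have h2 : ∫ x, inner ℝ (ψ i x) (hFm.toLp _ x) ∂volume.restrict Ω = ∫ x, ψ i x * inner ℝ h (Φ x) ∂volume.restrict Ω := by
        refine integral_congr_ae ?_
        filter_upwards [hFm.coeFn_toLp] with x hx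
        rw [hx]
        simp [mul_comm]
      rw [h2, ← htin, hth]
      rfl
    refine htot h fun x hx => ?_
    have h3 : EqOn (fun x => (inner ℝ h (Φ x) : ℝ)) (fun _ => 0) Ω := by
      refine Measure.eqOn_of_ae_eq (μ := volume) ?_ (continuousOn_const.inner hΦc)
        continuousOn_const hcl
      have h4 := hFm.coeFn_toLp
      rw [hF0] at h4
      exact h4.symm.trans (Lp.coeFn_zero _ _ _)
    rw [real_inner_comm]
    exact h3 hx

/-- Parseval's identity for a total system of orthogonal vectors of norm `1` or `0`. -/
theorem hasSum_inner_sq {H : Type*} [NormedAddCommGroup H] [InnerProductSpace ℝ H]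
    [CompleteSpace H] {e : ℕ → H} {P : ℕ → Prop} [DecidablePred P]
    (he : ∀ j k, inner ℝ (e j) (e k) = if j = k ∧ P j then (1 : ℝ) else 0)
    (htot : ∀ h, (∀ j, inner ℝ (e j) h = 0) → h = 0) (h : H) :
    HasSum (fun j => (inner ℝ (e j) h : ℝ) ^ 2) (‖h‖ ^ 2) := by
  have hzero : ∀ j, ¬ P j → e j = 0 := fun j hj => by
    rw [← inner_self_eq_zero (𝕜 := ℝ), he, if_neg fun h => hj h.2]
  have ho : Orthonormal ℝ fun j : {j // P j} => e j := by
    classical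
    rw [orthonormal_iff_ite]
    rintro ⟨j, hj⟩ ⟨k, hk⟩
    rw [he]
    simp [hj]
  have hspan : (Submodule.span ℝ (range fun j : {j // P j} => e j))ᗮ = ⊥ := by
    rw [Submodule.eq_bot_iff]
    intro g hg
    refine htot g fun j => ?_
    by_cases hj : P j
    · exact hg _ (Submodule.subset_span ⟨⟨j, hj⟩, rfl⟩)
    · rw [hzero j hj, inner_zero_left]
  have h1 := (HilbertBasis.mkOfOrthogonalEqBot ho hspan).hasSum_inner_mul_inner h h
  rw [HilbertBasis.coe_mkOfOrthogonalEqBot, real_inner_self_eq_norm_sq] at h1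
  have h2 : HasSum ((fun j => (inner ℝ (e j) h : ℝ) ^ 2) ∘ ((↑) : {j | P j} → ℕ)) (‖h‖ ^ 2) := by
    refine h1.congr_fun fun j => ?_
    rw [Function.comp_apply, real_inner_comm, sq]
  refine (hasSum_subtype_iff_of_support_subset fun j hj => ?_).1 h2
  by_contra hP
  have hP : ¬ P j := hP
  simp [hzero j hP] at hj

end Mercer

/-! ### Truncation of the feature map -/

section Truncation

variable {n : ℕ} {Ω : Set (EuclideanSpace ℝ (Fin n))}

/-- `Q` is the orthogonal projection off `e 0, …, e (N - 1)`, some of which may be zero; hence `⟪Q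
h, Q g⟫ = ⟪Q h, g⟫`. -/
theorem exists_truncation {H : Type*} [NormedAddCommGroup H] [InnerProductSpace ℝ H]
    {e : ℕ → H} {P : ℕ → Prop} [DecidablePred P]
    (he : ∀ j k, inner ℝ (e j) (e k) = if j = k ∧ P j then (1 : ℝ) else 0)
    (N : ℕ) :
    ∃ Q : H →L[ℝ] H, ∀ h g, inner ℝ (Q h) (Q g) =
      inner ℝ h g - ∑ j ∈ Finset.range N, (inner ℝ (e j) h * inner ℝ (e j) g : ℝ) := by
  set Q : H →L[ℝ] H := ContinuousLinearMap.id ℝ H -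
    ∑ j ∈ Finset.range N, (innerSL ℝ (e j)).smulRight (e j) with hQ
  have hQa : ∀ h, Q h = h - ∑ j ∈ Finset.range N, (inner ℝ (e j) h : ℝ) • e j := fun h => by
    simp [hQ]
  have hzero : ∀ j, ¬ P j → e j = 0 := fun j hj => by
    rw [← inner_self_eq_zero (𝕜 := ℝ), he, if_neg fun h => hj h.2]
  have horth : ∀ h, ∀ j ∈ Finset.range N, inner ℝ (e j) (Q h) = (0 : ℝ) := fun h j hj => by
    by_cases hP : P j
    · rw [hQa, inner_sub_right, inner_sum, Finset.sum_eq_single j]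
      · rw [inner_smul_right, he, if_pos ⟨rfl, hP⟩]
        ring
      · intro k _ hkj
        rw [inner_smul_right, he, if_neg fun h => hkj h.1.symm, mul_zero]
      · exact fun h => absurd hj h
    · rw [hzero j hP, inner_zero_left]
  refine ⟨Q, fun h g => ?_⟩
  have h1 : inner ℝ (Q h) (Q g) = (inner ℝ (Q h) g : ℝ) := by
    conv_lhs => rw [hQa g]
    rw [inner_sub_right, inner_sum, Finset.sum_eq_zero, sub_zero]
    intro j hj
    rw [inner_smul_right, real_inner_comm (e j) (Q h), horth h j hj, mul_zero]
  rw [h1, hQa, inner_sub_left, sum_inner]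
  simp only [real_inner_smul_left]

theorem enorm_le_eLpNorm_top {f : EuclideanSpace ℝ (Fin n) → ℝ} (hf : ContinuousOn f Ω)
    (hcl : Ω ⊆ closure (interior Ω)) {x : EuclideanSpace ℝ (Fin n)} (hx : x ∈ Ω) :
    ‖f x‖ₑ ≤ eLpNorm f ∞ (volume.restrict Ω) := by
  rcases eq_or_ne (eLpNorm f ∞ (volume.restrict Ω)) ∞ with h | h
  · rw [h]; exact le_top
  set c := eLpNorm f ∞ (volume.restrict Ω) with hc
  have h1 : ∀ᵐ y ∂volume.restrict Ω, ‖f y‖ ≤ c.toReal := by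
    have := ae_le_eLpNormEssSup (f := f) (μ := volume.restrict Ω)
    filter_upwards [this] with y hy
    rw [← eLpNorm_exponent_top, ← hc] at hy
    rw [← toReal_enorm]
    exact ENNReal.toReal_mono h hy
  -- The maximum encodes an inequality as an equality of continuous functions, so that it extends
  -- from almost every point to all of `Ω`.
  have h2 : EqOn (fun y => max ‖f y‖ c.toReal) (fun _ => c.toReal) Ω := by
    refine Measure.eqOn_of_ae_eq (μ := volume) ?_ (ContinuousOn.sup hf.norm continuousOn_const)
      continuousOn_const hcl
    filter_upwards [h1] with y hy
    exact max_eq_right hy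
  have h3 : ‖f x‖ ≤ c.toReal := by
    have := h2 hx
    simp only at this
    rw [← this]
    exact le_max_left _ _
  rw [← ofReal_norm]
  exact (ENNReal.ofReal_le_iff_le_toReal h).2 h3

end Truncation

/-! ### Derivatives on the diagonal -/

section Diagonal

variable {n m : ℕ} {Ω : Set (EuclideanSpace ℝ (Fin n))}
  {K : EuclideanSpace ℝ (Fin n) → EuclideanSpace ℝ (Fin n) → ℝ}
  {H : Type*} [NormedAddCommGroup H] [InnerProductSpace ℝ H]
  {Φ : EuclideanSpace ℝ (Fin n) → H}

/-- The derivatives in `y` and then in `x` pass through the continuous functionals `⟪Φ x', ·⟫` and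
`⟪∂^β Φ x, ·⟫`. -/
theorem diagDeriv_eq (hΦK : ∀ x ∈ Ω, ∀ y ∈ Ω, inner ℝ (Φ x) (Φ y) = K x y)
    (hΦ : ContDiffOn ℝ m Φ (interior Ω)) {β : Fin n → ℕ} (hβ : ∑ i, β i ≤ m)
    {x : EuclideanSpace ℝ (Fin n)} (hx : x ∈ interior Ω) :
    diagDeriv Ω K β x = ‖dirDeriv (dirList β) Φ x‖ ^ 2 := by
  have hU := isOpen_interior (s := Ω)
  have hsub : interior Ω ⊆ Ω := interior_subset
  have hl : (dirList β).length ≤ m := by rwa [length_dirList]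
  have h1 : EqOn (fun x' => multiDeriv Ω β (fun y' => K x' y') x)
      (fun x' => innerSL ℝ (dirDeriv (dirList β) Φ x) (Φ x')) (interior Ω) := by
    intro x' hx'
    simp only
    rw [multiDeriv_eqOn hU hsub β _ hx, innerSL_apply_apply, real_inner_comm]
    have h2 : EqOn (fun y' => K x' y') (fun y' => innerSL ℝ (Φ x') (Φ y')) (interior Ω) :=
      fun y' hy' => (hΦK x' (hsub hx') y' (hsub hy')).symm
    rw [dirDeriv_congr hU h2 _ hx, dirDeriv_clm_comp hU (innerSL ℝ (Φ x')) _ hΦ hl hx]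
    rfl
  rw [diagDeriv, multiDeriv_eqOn hU hsub β _ hx, dirDeriv_congr hU h1 _ hx,
    dirDeriv_clm_comp hU _ _ hΦ hl hx]
  exact real_inner_self_eq_norm_sq _

/-- `‖∂^β Φ‖ ^ 2` is a derivative of `K` of order `2|β| ≤ 2m` on the diagonal, and such derivatives
are bounded on the interior. -/
theorem exists_norm_dirDeriv_le (hΩ : IsCompact Ω)
    (hΦK : ∀ x ∈ Ω, ∀ y ∈ Ω, inner ℝ (Φ x) (Φ y) = K x y)
    (hKm : ContDiffOn ℝ ((2 * m : ℕ) : WithTop ℕ∞)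
      (fun z : EuclideanSpace ℝ (Fin n) × EuclideanSpace ℝ (Fin n) => K z.1 z.2) (Ω ×ˢ Ω))
    (hΦ : ContDiffOn ℝ m Φ (interior Ω)) {β : Fin n → ℕ} (hβ : ∑ i, β i ≤ m) :
    ∃ C, ∀ x ∈ interior Ω, ‖dirDeriv (dirList β) Φ x‖ ≤ C := by
  have hU := isOpen_interior (s := Ω)
  have hsub : interior Ω ×ˢ interior Ω ⊆ Ω ×ˢ Ω := prod_mono interior_subset interior_subset
  have hG : ContDiffOn ℝ ((2 * m : ℕ) : WithTop ℕ∞)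
      (fun z : EuclideanSpace ℝ (Fin n) × EuclideanSpace ℝ (Fin n) =>
        (inner ℝ (Φ z.1) (Φ z.2) : ℝ)) (Ω ×ˢ Ω) :=
    hKm.congr fun z hz => hΦK z.1 hz.1 z.2 hz.2
  have hl : (dirList β).length ≤ m := by rwa [length_dirList]
  set L := (dirList β).map (fun v => (v, (0 : EuclideanSpace ℝ (Fin n)))) ++
    (dirList β).map (fun w => ((0 : EuclideanSpace ℝ (Fin n)), w)) with hL
  have hLl : L.length ≤ 2 * m := by
    rw [hL, List.length_append, List.length_map, List.length_map]
    omega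
  have hLn : ∀ v ∈ L, ‖v‖ ≤ 1 := by
    intro v hv
    rw [hL, List.mem_append, List.mem_map, List.mem_map] at hv
    rcases hv with ⟨w, hw, rfl⟩ | ⟨w, hw, rfl⟩ <;>
      simpa [Prod.norm_def] using norm_le_one_of_mem_dirList hw
  obtain ⟨C, hC⟩ := exists_norm_iteratedFDeriv_le (hΩ.prod hΩ) (hU.prod hU) hsub
    (hG.of_le (by exact_mod_cast hLl) : ContDiffOn ℝ (L.length : WithTop ℕ∞) _ _)
  refine ⟨√C, fun x hx => Real.le_sqrt_of_sq_le ?_⟩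
  have h1 := dirDeriv_kernel hU (N := m) (hG.mono hsub)
    (fun k hk x hx => differentiableAt_dirDeriv hU k hΦ hk hx) (dirList β) (dirList β) hl hl
    (by omega) (mk_mem_prod hx hx)
  simp only at h1
  have h2 := norm_dirDeriv_le (hU.prod hU) L (hG.mono hsub) (mk_mem_prod hx hx) hLn hLl
  rw [hL, h1, real_inner_self_eq_norm_sq, ← hL, Real.norm_of_nonneg (sq_nonneg _)] at h2
  exact h2.trans (hC _ (mk_mem_prod hx hx))

theorem mem_multiIndices {α : Fin n → ℕ} : α ∈ multiIndices n m ↔ ∑ i, α i = m := by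
  simp [multiIndices, Finset.mem_piAntidiag]

theorem memLp_of_continuousOn_interior {F : Type*} [NormedAddCommGroup F] (hΩ : IsCompact Ω)
    (hΩL : HasLipschitzBoundary Ω) {f : EuclideanSpace ℝ (Fin n) → F}
    (hf : ContinuousOn f (interior Ω)) {C : ℝ} (hC : ∀ x ∈ interior Ω, ‖f x‖ ≤ C) (p : ℝ≥0∞) :
    MemLp f p (volume.restrict Ω) := by
  have : IsFiniteMeasure (volume.restrict Ω) :=
    ⟨by rw [Measure.restrict_apply_univ]; exact hΩ.measure_lt_top⟩
  rw [← restrict_interior_eq hΩ hΩL] at this ⊢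
  exact MemLp.of_bound (hf.aestronglyMeasurable isOpen_interior.measurableSet) C
    ((ae_restrict_mem isOpen_interior.measurableSet).mono hC)

theorem sqrt_diagDeriv_ae_eq (hΩ : IsCompact Ω) (hΩL : HasLipschitzBoundary Ω)
    (hΦK : ∀ x ∈ Ω, ∀ y ∈ Ω, inner ℝ (Φ x) (Φ y) = K x y)
    (hΦ : ContDiffOn ℝ m Φ (interior Ω)) {β γ : Fin n → ℕ} (hβ : ∑ i, β i ≤ m) (hγ : ∑ i, γ i ≤ m) :
    (fun x => √(diagDeriv Ω K β x * diagDeriv Ω K γ x)) =ᵐ[volume.restrict Ω]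
      fun x => ‖dirDeriv (dirList β) Φ x‖ * ‖dirDeriv (dirList γ) Φ x‖ := by
  rw [← restrict_interior_eq hΩ hΩL]
  filter_upwards [ae_restrict_mem isOpen_interior.measurableSet] with x hx
  rw [diagDeriv_eq hΦK hΦ hβ hx, diagDeriv_eq hΦK hΦ hγ hx, ← mul_pow,
    Real.sqrt_sq (by positivity)]

theorem memLp_norm_mul_norm (hΩ : IsCompact Ω) (hΩL : HasLipschitzBoundary Ω)
    (hΦK : ∀ x ∈ Ω, ∀ y ∈ Ω, inner ℝ (Φ x) (Φ y) = K x y)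
    (hKm : ContDiffOn ℝ ((2 * m : ℕ) : WithTop ℕ∞)
      (fun z : EuclideanSpace ℝ (Fin n) × EuclideanSpace ℝ (Fin n) => K z.1 z.2) (Ω ×ˢ Ω))
    (hΦ : ContDiffOn ℝ m Φ (interior Ω)) {β γ : Fin n → ℕ} (hβ : ∑ i, β i ≤ m) (hγ : ∑ i, γ i ≤ m)
    (p : ℝ≥0∞) :
    MemLp (fun x => ‖dirDeriv (dirList β) Φ x‖ * ‖dirDeriv (dirList γ) Φ x‖) p
      (volume.restrict Ω) := by
  obtain ⟨C, hC⟩ := exists_norm_dirDeriv_le hΩ hΦK hKm hΦ hβ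
  obtain ⟨D, hD⟩ := exists_norm_dirDeriv_le hΩ hΦK hKm hΦ hγ
  have hc : ∀ {δ : Fin n → ℕ}, ∑ i, δ i ≤ m →
      ContinuousOn (dirDeriv (dirList δ) Φ) (interior Ω) := fun hδ =>
    continuousOn_dirDeriv isOpen_interior _ hΦ (by rwa [length_dirList])
  refine memLp_of_continuousOn_interior hΩ hΩL ((hc hβ).norm.mul (hc hγ).norm) (C := C * D)
    (fun x hx => ?_) p
  rw [Pi.mul_apply, norm_mul, norm_norm, norm_norm]
  exact mul_le_mul (hC x hx) (hD x hx) (norm_nonneg _) ((norm_nonneg _).trans (hC x hx))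

theorem derivBound_lt_top (hΩ : IsCompact Ω) (hΩL : HasLipschitzBoundary Ω)
    (hΦK : ∀ x ∈ Ω, ∀ y ∈ Ω, inner ℝ (Φ x) (Φ y) = K x y)
    (hKm : ContDiffOn ℝ ((2 * m : ℕ) : WithTop ℕ∞)
      (fun z : EuclideanSpace ℝ (Fin n) × EuclideanSpace ℝ (Fin n) => K z.1 z.2) (Ω ×ˢ Ω))
    (hΦ : ContDiffOn ℝ m Φ (interior Ω)) (p : ℝ≥0∞) : derivBound Ω K m p < ∞ := by
  rw [derivBound, Finset.sup_lt_iff (by simp)]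
  intro α hα
  rw [mem_multiIndices] at hα
  refine ENNReal.sum_lt_top.2 fun β hβ => ENNReal.mul_lt_top (ENNReal.natCast_lt_top _) ?_
  rw [Finset.mem_Iic] at hβ
  have h1 : ∑ i, β i ≤ m := hα ▸ Finset.sum_le_sum fun i _ => hβ i
  have h2 : ∑ i, (α - β) i ≤ m := hα ▸ Finset.sum_le_sum fun i _ => Nat.sub_le _ _
  rw [eLpNorm_congr_ae (sqrt_diagDeriv_ae_eq hΩ hΩL hΦK hΦ h1 h2)]
  exact (memLp_norm_mul_norm hΩ hΩL hΦK hKm hΦ h1 h2 p).2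

/-- The Gagliardo–Nirenberg inequality for the squared norm of a contraction of the feature
map. -/
theorem eLpNorm_norm_sq_le (hΩ : IsCompact Ω) (hΩL : HasLipschitzBoundary Ω)
    (hΦK : ∀ x ∈ Ω, ∀ y ∈ Ω, inner ℝ (Φ x) (Φ y) = K x y)
    (hKm : ContDiffOn ℝ ((2 * m : ℕ) : WithTop ℕ∞)
      (fun z : EuclideanSpace ℝ (Fin n) × EuclideanSpace ℝ (Fin n) => K z.1 z.2) (Ω ×ˢ Ω))
    (hΦ : ContDiffOn ℝ m Φ (interior Ω)) (hn : 0 < n) (hm : 0 < m) (hΦc : ContinuousOn Φ Ω) (Q : H →L[ℝ] H)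
    (hQ : ∀ h, ‖Q h‖ ≤ ‖h‖) {p : ℝ≥0∞} (hp : 1 ≤ p) (hpn : (n : ℝ≥0∞) / m < p) :
    eLpNorm (fun x => ‖Q (Φ x)‖ ^ 2) ∞ (volume.restrict Ω) ≤ gnConst Ω m p *
      (eLpNorm (fun x => ‖Q (Φ x)‖ ^ 2) 1 (volume.restrict Ω) ^ (1 - gnTheta n m p) *
        derivBound Ω K m p ^ gnTheta n m p +
        eLpNorm (fun x => ‖Q (Φ x)‖ ^ 2) 1 (volume.restrict Ω)) := by
  obtain ⟨hθ0, hθ1⟩ := gnTheta_mem_Ioo hn hm hpn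
  set u : EuclideanSpace ℝ (Fin n) → ℝ := fun x => ‖Q (Φ x)‖ ^ 2 with hu
  -- The zero function is not admissible in the supremum and is treated apart.
  by_cases hu0 : u =ᵐ[volume.restrict Ω] 0
  · rw [eLpNorm_congr_ae hu0, eLpNorm_zero]
    exact zero_le
  have hU := isOpen_interior (s := Ω)
  have huinner : u = fun x => (inner ℝ (Q (Φ x)) (Q (Φ x)) : ℝ) := by
    ext x
    rw [real_inner_self_eq_norm_sq]
  have hQΦ : ContDiffOn ℝ m (fun x => Q (Φ x)) (interior Ω) := Q.contDiff.comp_contDiffOn hΦ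
  have huC : ContDiffOn ℝ m u (interior Ω) := by
    rw [huinner]
    exact hQΦ.inner ℝ hQΦ
  have huc : ContinuousOn u Ω := (Q.continuous.comp_continuousOn hΦc).norm.pow 2
  obtain ⟨Cu, hCu⟩ := hΩ.exists_bound_of_continuousOn huc
  have huLp : ∀ q, MemLp u q (volume.restrict Ω) := fun q =>
    memLp_of_continuousOn_interior hΩ hΩL (huc.mono interior_subset)
      (fun x hx => hCu x (interior_subset hx)) q
  -- The reversed order is what integration by parts produces; for values it is immaterial by
  -- `dirDeriv_perm`.
  set v : (Fin n → ℕ) → EuclideanSpace ℝ (Fin n) → ℝ :=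
    fun α => dirDeriv (dirList α).reverse u with hv
  have hvb : ∀ α ∈ multiIndices n m, ∀ x ∈ interior Ω, ‖v α x‖ ≤ ∑ β ∈ Finset.Iic α,
      ((∏ j, (α j).choose (β j) : ℕ) : ℝ) *
        (‖dirDeriv (dirList β) Φ x‖ * ‖dirDeriv (dirList (α - β)) Φ x‖) := by
    intro α hα x hx
    rw [mem_multiIndices] at hα
    have hαl : (dirList α).length = m := by rw [length_dirList, hα]
    rw [hv]
    simp only
    rw [dirDeriv_perm hU (List.reverse_perm _) huC (by simp [hαl]) hx, huinner,
      dirDeriv_inner hU hQΦ hQΦ α hα.le hx]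
    refine (norm_sum_le _ _).trans (Finset.sum_le_sum fun β hβ => ?_)
    rw [Finset.mem_Iic] at hβ
    have h1 : ∑ i, β i ≤ m := hα ▸ Finset.sum_le_sum fun i _ => hβ i
    have h2 : ∑ i, (α - β) i ≤ m := hα ▸ Finset.sum_le_sum fun i _ => Nat.sub_le _ _
    rw [norm_mul, Real.norm_natCast,
      dirDeriv_clm_comp hU Q _ hΦ (by rwa [length_dirList]) hx,
      dirDeriv_clm_comp hU Q _ hΦ (by rwa [length_dirList]) hx]
    refine mul_le_mul_of_nonneg_left ((norm_inner_le_norm _ _).trans ?_) (Nat.cast_nonneg _)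
    exact mul_le_mul (hQ _) (hQ _) (norm_nonneg _) (norm_nonneg _)
  have hvle : ∀ α ∈ multiIndices n m, eLpNorm (v α) p (volume.restrict Ω) ≤
      ∑ β ∈ Finset.Iic α, ((∏ i, (α i).choose (β i) : ℕ) : ℝ≥0∞) *
        eLpNorm (fun x => √(diagDeriv Ω K β x * diagDeriv Ω K (α - β) x)) p
          (volume.restrict Ω) := by
    intro α hα
    set g : (Fin n → ℕ) → EuclideanSpace ℝ (Fin n) → ℝ := fun β =>
      ((∏ j, (α j).choose (β j) : ℕ) : ℝ) • fun x =>
        ‖dirDeriv (dirList β) Φ x‖ * ‖dirDeriv (dirList (α - β)) Φ x‖ with hg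
    have h0 : ∀ᵐ x ∂volume.restrict Ω, ‖v α x‖ ≤ (∑ β ∈ Finset.Iic α, g β) x := by
      rw [← restrict_interior_eq hΩ hΩL]
      filter_upwards [ae_restrict_mem hU.measurableSet] with x hx
      rw [Finset.sum_apply]
      exact hvb α hα x hx
    have hβ1 : ∀ β ∈ Finset.Iic α, ∑ i, β i ≤ m ∧ ∑ i, (α - β) i ≤ m := by
      intro β hβ
      rw [Finset.mem_Iic] at hβ
      rw [mem_multiIndices] at hα
      exact ⟨hα ▸ Finset.sum_le_sum fun i _ => hβ i,
        hα ▸ Finset.sum_le_sum fun i _ => Nat.sub_le _ _⟩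
    refine (eLpNorm_mono_ae_real h0).trans ((eLpNorm_sum_le (fun β hβ => ?_) hp).trans
      (Finset.sum_le_sum fun β hβ => le_of_eq ?_))
    · exact (memLp_norm_mul_norm hΩ hΩL hΦK hKm hΦ (hβ1 β hβ).1 (hβ1 β hβ).2 p).1.const_smul _
    · rw [hg, eLpNorm_const_smul,
        eLpNorm_congr_ae (sqrt_diagDeriv_ae_eq hΩ hΩL hΦK hΦ (hβ1 β hβ).1 (hβ1 β hβ).2),
        Real.enorm_natCast]
  have hsup : ((multiIndices n m).sup fun α => eLpNorm (v α) p (volume.restrict Ω)) ≤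
      derivBound Ω K m p :=
    Finset.sup_mono_fun hvle
  have hDtop := derivBound_lt_top hΩ hΩL hΦK hKm hΦ p
  have hadm : GNAdmissible Ω m p u v := by
    refine ⟨huLp 1, huLp p, hu0, fun α hα => ⟨?_, ?_⟩, fun α hα η hη hc hs => ?_⟩
    · rw [← restrict_interior_eq hΩ hΩL]
      refine ContinuousOn.aestronglyMeasurable ?_ hU.measurableSet
      refine continuousOn_dirDeriv hU _ huC ?_
      rw [List.length_reverse, length_dirList, mem_multiIndices.1 hα]
    · exact ((Finset.le_sup (f := fun α => eLpNorm (v α) p (volume.restrict Ω)) hα).trans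
        hsup).trans_lt hDtop
    · have h1 : multiDeriv univ α η = dirDeriv (dirList α) η := funext fun x =>
        multiDeriv_eqOn isOpen_univ subset_rfl α η (mem_univ x)
      rw [h1, setIntegral_mul_dirDeriv volume hU hη hc hs _ huC
        (by rw [length_dirList, mem_multiIndices.1 hα]), length_dirList]
  have h1 : eLpNorm u ∞ (volume.restrict Ω) /
      (eLpNorm u 1 (volume.restrict Ω) ^ (1 - gnTheta n m p) *
          ((multiIndices n m).sup fun α => eLpNorm (v α) p (volume.restrict Ω)) ^ gnTheta n m p +
        eLpNorm u 1 (volume.restrict Ω)) ≤ gnConst Ω m p :=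
    le_iSup_of_le u (le_iSup_of_le v (le_iSup_of_le hadm le_rfl))
  have hu1 : eLpNorm u 1 (volume.restrict Ω) ≠ 0 := by
    rw [Ne, eLpNorm_eq_zero_iff (huLp 1).1 one_ne_zero]
    exact hu0
  rw [ENNReal.div_le_iff] at h1
  · refine h1.trans ?_
    gcongr
  · exact fun h => hu1 (add_eq_zero.1 h).2
  · refine ENNReal.add_ne_top.2 ⟨ENNReal.mul_ne_top ?_ ?_, (huLp 1).2.ne⟩
    · exact ENNReal.rpow_ne_top_of_nonneg (by linarith) (huLp 1).2.ne
    · exact ENNReal.rpow_ne_top_of_nonneg hθ0.le (hsup.trans_lt hDtop).ne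

end Diagonal

/-! ### The truncation error -/

section Main

variable {n m : ℕ} {Ω : Set (EuclideanSpace ℝ (Fin n))}
  {K : EuclideanSpace ℝ (Fin n) → EuclideanSpace ℝ (Fin n) → ℝ}
  {lam : ℕ → ℝ} {φ : ℕ → EuclideanSpace ℝ (Fin n) → ℝ}

/-- The remainder of the Mercer expansion is the kernel of a contraction of the feature map, and
its trace is the tail of the eigenvalues. -/
theorem IsMercerSystem.exists_remainder {H : Type*} [NormedAddCommGroup H]
    [InnerProductSpace ℝ H] [CompleteSpace H] {Φ : EuclideanSpace ℝ (Fin n) → H}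
    (hsys : IsMercerSystem Ω K lam φ) (hΩ : IsCompact Ω) (hcl : Ω ⊆ closure (interior Ω))
    (hΦK : ∀ x ∈ Ω, ∀ y ∈ Ω, inner ℝ (Φ x) (Φ y) = K x y)
    (htot : ∀ h : H, (∀ x ∈ Ω, inner ℝ (Φ x) h = 0) → h = 0) (hΦc : ContinuousOn Φ Ω) (N : ℕ) :
    ∃ Q : H →L[ℝ] H, (∀ h, ‖Q h‖ ≤ ‖h‖) ∧
      (∀ x ∈ Ω, ∀ y ∈ Ω, inner ℝ (Q (Φ x)) (Q (Φ y)) =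
        K x y - ∑ i ∈ Finset.range N, lam i * φ i x * φ i y) ∧
      eLpNorm (fun x => ‖Q (Φ x)‖ ^ 2) 1 (volume.restrict Ω) = tailSum lam N := by
  obtain ⟨hlam, hφ, e, heΦ, he, hetot⟩ := hsys.exists_orthonormal hΩ hcl hΦK htot hΦc
  have hΩm : MeasurableSet Ω := hΩ.isClosed.measurableSet
  obtain ⟨Q, hQ⟩ := exists_truncation (P := fun j => lam j ≠ 0) he N
  have hQsq : ∀ h, ‖Q h‖ ^ 2 + ∑ j ∈ Finset.range N, (inner ℝ (e j) h : ℝ) ^ 2 = ‖h‖ ^ 2 :=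
    fun h => by
      rw [← real_inner_self_eq_norm_sq, ← real_inner_self_eq_norm_sq, hQ]
      simp only [sq, sub_add_cancel]
  have hmul : ∀ j, ∀ x ∈ Ω, ∀ y ∈ Ω,
      (inner ℝ (e j) (Φ x) * inner ℝ (e j) (Φ y) : ℝ) = lam j * φ j x * φ j y := by
    intro j x hx y hy
    rw [heΦ j x hx, heΦ j y hy]
    linear_combination φ j x * φ j y * Real.mul_self_sqrt (hlam j)
  refine ⟨Q, fun h => ?_, fun x hx y hy => ?_, ?_⟩
  · refine le_of_sq_le_sq ?_ (norm_nonneg _)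
    rw [← hQsq h]
    exact le_add_of_nonneg_right (Finset.sum_nonneg fun j _ => sq_nonneg _)
  · rw [hQ, hΦK x hx y hy]
    exact congrArg _ (Finset.sum_congr rfl fun j _ => hmul j x hx y hy)
  -- Parseval for `h` minus its first `N` terms gives `‖Q h‖ ^ 2` as a tail, which is integrated
  -- term by term against the normalised eigenfunctions.
  · have hsum : ∀ h, HasSum (fun i => (inner ℝ (e (N + i)) h : ℝ) ^ 2) (‖Q h‖ ^ 2) := by
      intro h
      have h1 := hasSum_inner_sq (P := fun j => lam j ≠ 0) he hetot h
      rw [← hQsq h] at h1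
      simpa only [add_comm N] using (hasSum_nat_add_iff N).2 h1
    have hen : ∀ h, ‖(‖Q h‖ ^ 2 : ℝ)‖ₑ = ∑' i, ENNReal.ofReal ((inner ℝ (e (N + i)) h : ℝ) ^ 2) := by
      intro h
      rw [Real.enorm_of_nonneg (sq_nonneg _), ← (hsum h).tsum_eq,
        ENNReal.ofReal_tsum_of_nonneg (fun i => sq_nonneg _) (hsum h).summable]
    rw [eLpNorm_one_eq_lintegral_enorm, tailSum]
    simp only [hen]
    rw [lintegral_tsum fun i => ?_]
    · refine tsum_congr fun i => ?_
      have h1 : ∫⁻ x in Ω, ENNReal.ofReal ((inner ℝ (e (N + i)) (Φ x) : ℝ) ^ 2) =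
          ∫⁻ x in Ω, ENNReal.ofReal (lam (N + i)) * ENNReal.ofReal (φ (N + i) x ^ 2) := by
        refine setLIntegral_congr_fun hΩm fun x hx => ?_
        rw [← ENNReal.ofReal_mul (hlam _), sq, hmul _ x hx x hx, sq, mul_assoc]
      rw [h1, lintegral_const_mul' _ _ ENNReal.ofReal_ne_top]
      -- When the eigenvalue is `0` the function `φ` is arbitrary, possibly of infinite norm, and
      -- the factor `0` removes it.
      by_cases h0 : lam (N + i) = 0
      · simp [h0]
      · rw [(hφ _ h0).2, mul_one]
    · exact (((continuousOn_const.inner hΦc).pow 2).aemeasurable hΩm).ennreal_ofReal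

/-- By Cauchy–Schwarz an off-diagonal value is at most the larger of the two diagonal values, and
for a continuous function the essential supremum bounds every value. -/
theorem truncError_le {H : Type*} [NormedAddCommGroup H] [InnerProductSpace ℝ H]
    {Ψ : EuclideanSpace ℝ (Fin n) → H} (hcl : Ω ⊆ closure (interior Ω)) {N : ℕ}
    (hΨ : ∀ x ∈ Ω, ∀ y ∈ Ω, inner ℝ (Ψ x) (Ψ y) =
        K x y - ∑ i ∈ Finset.range N, lam i * φ i x * φ i y) (hΨc : ContinuousOn Ψ Ω) :
    truncError Ω K lam φ N ≤ eLpNorm (fun x => ‖Ψ x‖ ^ 2) ∞ (volume.restrict Ω) := by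
  have h1 : ∀ x ∈ Ω, ENNReal.ofReal (‖Ψ x‖ ^ 2) ≤
      eLpNorm (fun x => ‖Ψ x‖ ^ 2) ∞ (volume.restrict Ω) := fun x hx => by
    have := enorm_le_eLpNorm_top (f := fun x => ‖Ψ x‖ ^ 2) (hΨc.norm.pow 2) hcl hx
    rwa [Real.enorm_of_nonneg (sq_nonneg _)] at this
  refine iSup₂_le fun x hx => iSup₂_le fun y hy => ?_
  rw [← hΨ x hx y hy]
  have h2 := abs_real_inner_le_norm (Ψ x) (Ψ y)
  rcases le_total ‖Ψ x‖ ‖Ψ y‖ with h | h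
  · refine (ENNReal.ofReal_le_ofReal (h2.trans ?_)).trans (h1 y hy)
    rw [sq]
    exact mul_le_mul_of_nonneg_right h (norm_nonneg _)
  · refine (ENNReal.ofReal_le_ofReal (h2.trans ?_)).trans (h1 x hx)
    rw [sq]
    exact mul_le_mul_of_nonneg_left h (norm_nonneg _)

theorem tailSum_le_tailSum_zero (lam : ℕ → ℝ) (N : ℕ) : tailSum lam N ≤ tailSum lam 0 := by
  simp only [tailSum, zero_add]
  exact ENNReal.tsum_comp_le_tsum_of_injective (add_right_injective N)
    fun i => ENNReal.ofReal (lam i)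

theorem one_sub_gnTheta_top (hn : 0 < n) : 1 - gnTheta n m ∞ = (m : ℝ) / (m + n) := by
  rw [gnTheta_eq hn]
  have : (0 : ℝ) < n := Nat.cast_pos.2 hn
  have hnm : (n : ℝ) + m ≠ 0 := by positivity
  simp only [ENNReal.inv_top, ENNReal.toReal_zero, mul_zero, sub_zero]
  rw [one_sub_div hnm, add_sub_cancel_left, add_comm]

theorem tailSum_lt_top_and_truncError_le (hn : 0 < n) (hm : 0 < m) (hΩ : IsCompact Ω)
    (hΩL : HasLipschitzBoundary Ω) (hK : IsMercerKernel Ω K)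
    (hKm : ContDiffOn ℝ ((2 * m : ℕ) : WithTop ℕ∞)
      (fun z : EuclideanSpace ℝ (Fin n) × EuclideanSpace ℝ (Fin n) => K z.1 z.2) (Ω ×ˢ Ω))
    (hsys : IsMercerSystem Ω K lam φ) :
    tailSum lam 0 < ∞ ∧ (∀ p, derivBound Ω K m p < ∞) ∧
    ∀ p : ℝ≥0∞, 1 ≤ p → (n : ℝ≥0∞) / m < p → ∀ N : ℕ, truncError Ω K lam φ N ≤
      gnConst Ω m p * (tailSum lam N ^ (1 - gnTheta n m p) *
        derivBound Ω K m p ^ gnTheta n m p + tailSum lam N) := by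
  have hcl := subset_closure_interior hΩ hΩL
  obtain ⟨H, _, _, _, Φ, hΦK, htot, hΦc⟩ := hK.exists_feature_map
  have hΦ : ContDiffOn ℝ m Φ (interior Ω) := by
    refine contDiffOn_of_kernel isOpen_interior m ?_
    refine (hKm.mono (prod_mono interior_subset interior_subset)).congr fun z hz => ?_
    exact hΦK z.1 (interior_subset hz.1) z.2 (interior_subset hz.2)
  refine ⟨?_, derivBound_lt_top hΩ hΩL hΦK hKm hΦ, fun p hp hpn N => ?_⟩
  · obtain ⟨Q, -, -, hQ⟩ := hsys.exists_remainder hΩ hcl hΦK htot hΦc 0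
    rw [← hQ]
    have hc : ContinuousOn (fun x => ‖Q (Φ x)‖ ^ 2) Ω :=
      (Q.continuous.comp_continuousOn hΦc).norm.pow 2
    obtain ⟨C, hC⟩ := hΩ.exists_bound_of_continuousOn hc
    exact (memLp_of_continuousOn_interior hΩ hΩL (hc.mono interior_subset)
      (fun x hx => hC x (interior_subset hx)) 1).2
  · obtain ⟨Q, hQle, hQK, hQ1⟩ := hsys.exists_remainder hΩ hcl hΦK htot hΦc N
    rw [← hQ1]
    exact (truncError_le hcl hQK (Q.continuous.comp_continuousOn hΦc)).trans
      (eLpNorm_norm_sq_le hΩ hΩL hΦK hKm hΦ hn hm hΦc Q hQle hp hpn)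

end Main

end MercerGN

end

theorem theorem1 {n m : ℕ} (hn : 0 < n) (hm : 0 < m)
    (Ω : Set (EuclideanSpace ℝ (Fin n))) (hΩ : IsCompact Ω)
    (hΩL : MercerGN.HasLipschitzBoundary Ω)
    (K : EuclideanSpace ℝ (Fin n) → EuclideanSpace ℝ (Fin n) → ℝ)
    (hK : MercerGN.IsMercerKernel Ω K)
    (hKm : ContDiffOn ℝ ((2 * m : ℕ) : WithTop ℕ∞)
      (fun z : EuclideanSpace ℝ (Fin n) × EuclideanSpace ℝ (Fin n) => K z.1 z.2) (Ω ×ˢ Ω))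
    (lam : ℕ → ℝ) (φ : ℕ → EuclideanSpace ℝ (Fin n) → ℝ)
    (hsys : MercerGN.IsMercerSystem Ω K lam φ) :
    MercerGN.tailSum lam 0 < ∞ ∧
    (∀ p : ℝ≥0∞, 1 ≤ p → (n : ℝ≥0∞) / m < p →
      MercerGN.gnConst Ω m p < ∞ ∧ MercerGN.derivBound Ω K m p < ∞ ∧
      ∀ N : ℕ, MercerGN.truncError Ω K lam φ N ≤
        MercerGN.gnConst Ω m p * MercerGN.tailSum lam N ^ (1 - MercerGN.gnTheta n m p) *
            MercerGN.derivBound Ω K m p ^ MercerGN.gnTheta n m p +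
          MercerGN.gnConst Ω m p * MercerGN.tailSum lam N) ∧
    ∃ A : ℝ≥0, ∀ N : ℕ, MercerGN.truncError Ω K lam φ N ≤
      A * MercerGN.tailSum lam N ^ ((m : ℝ) / (m + n)) := by

  obtain ⟨h1, h2, h3⟩ :=
    MercerGN.tailSum_lt_top_and_truncError_le hn hm hΩ hΩL hK hKm hsys
  refine ⟨h1, fun p hp hpn => ⟨MercerGN.gnConst_lt_top hn hm hΩ hΩL hp hpn, h2 p, fun N => ?_⟩, ?_⟩
  · refine (h3 p hp hpn N).trans (le_of_eq ?_)
    rw [mul_add, mul_assoc]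
  · have hpn : (n : ℝ≥0∞) / m < ∞ :=
      ENNReal.div_lt_top (ENNReal.natCast_ne_top n) (Nat.cast_ne_zero.2 hm.ne')
    obtain ⟨hθ0, hθ1⟩ := MercerGN.gnTheta_mem_Ioo hn hm hpn
    set θ := MercerGN.gnTheta n m ∞ with hθ
    have hA : MercerGN.gnConst Ω m ∞ *
        (MercerGN.derivBound Ω K m ∞ ^ θ + MercerGN.tailSum lam 0 ^ θ) ≠ ∞ :=
      ENNReal.mul_ne_top (MercerGN.gnConst_lt_top hn hm hΩ hΩL le_top hpn).ne
        (ENNReal.add_ne_top.2 ⟨ENNReal.rpow_ne_top_of_nonneg hθ0.le (h2 ∞).ne,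
          ENNReal.rpow_ne_top_of_nonneg hθ0.le h1.ne⟩)
    refine ⟨(MercerGN.gnConst Ω m ∞ *
        (MercerGN.derivBound Ω K m ∞ ^ θ + MercerGN.tailSum lam 0 ^ θ)).toNNReal, fun N => ?_⟩
    rw [ENNReal.coe_toNNReal hA, ← MercerGN.one_sub_gnTheta_top hn, ← hθ]
    refine (h3 ∞ le_top hpn N).trans ?_
    rw [← hθ, mul_assoc, add_mul, mul_comm (MercerGN.derivBound Ω K m ∞ ^ θ)]
    -- The linear term is absorbed into the power `1 - θ`, since all tails are bounded by the full
    -- sum.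
    have hT : MercerGN.tailSum lam N ≤
        MercerGN.tailSum lam 0 ^ θ * MercerGN.tailSum lam N ^ (1 - θ) := by
      calc MercerGN.tailSum lam N
          = MercerGN.tailSum lam N ^ θ * MercerGN.tailSum lam N ^ (1 - θ) := by
            rw [← ENNReal.rpow_add_of_nonneg _ _ hθ0.le (by linarith), add_sub_cancel,
              ENNReal.rpow_one]
        _ ≤ _ := by
            gcongr
            exact MercerGN.tailSum_le_tailSum_zero lam N
    gcongr
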